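/- **Setting.** Let $1\le s\le d$, $n\ge 1$, $\sigma>0$. The ground truth $w^\star\in\mathbb R^d$ is random: its support $\mathcal S$ is uniform among the subsets of $\{1,\dots,d\}$ of size $s$ and, given $\mathcal S$, its nonzero entries are independent and uniform on $\{-1/\sqrt s,1/\sqrt s\}$ (so $\|w^\star\|_2=1$). Given $w^\star$, let $\mathsf P$ be the law of $(x,y)$ with $x\sim N(0,I_d)$, $y=\langle w^\star,x\rangle+\varepsilon$, $\varepsilon\sim N(0,\sigma^2)$ independent of $x$. One observes $n$ i.i.d. pairs $(x_i,y_i)\sim\mathsf P$ with noise $\varepsilon_i$; inputs, noise and $w^\star$ are independent. For a feature map $\Phi$ and a parameter $w$ let $L_\Phi(w)=\mathbb E_{\mathsf P}(\langle\Phi x,w\rangle-y)^2$ and $\mathcal E_\Phi(w)=L_\Phi(w)-\inf_{w'}L_\Phi(w')$; write $\mathcal E=\mathcal E_{\mathrm{id}}$. Gradient descent (GD) on examples $(z_i,y_i)$ with step size $\eta$ starts at $0$ and runs on $\frac1{2n}\sum_i(y_i-\langle w,z_i\rangle)^2$. Let $\hat R=\mathrm{diag}(\hat r_1,\dots,\hat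 r_d)$ with $\hat r_j=\frac1n\sum_i x_{ij}y_i$, and let $\tilde w^t_{\mathsf{gd}}$ be the result of $t$ GD steps on $(\hat R x_i,y_i)_{i\le n}$. Further let $w^t_{\mathsf{gd}}$ be the result of $t$ GD steps on the raw examples $(x_i,y_i)$, let $\hat w_\lambda=\frac1n(\hat\Sigma+\lambda I)^{-1}X^\top y$ with $\hat\Sigma=\frac1nX^\top X$ be the ridge estimator, $\lambda>0$, and let $w_{\mathrm{ols}}$ be the least squares solution (of minimal norm if there are several). **Upper bound.** There are absolute constants $c,K>0$ and, for every $\sigma>0$, a constant $C=C(\sigma)>0$ such that the following holds for all $n,d,s$ as above and all $\delta\in(0,1)$ with $d/\delta\ge2$. For every number of steps $t\ge1$ with $$t\ge K\log(ns/\sigma^2),\qquad n\ge C\,t^2s^3d^{2/3},$$ there is a step size $\eta>0$ such that, with probability at least $1-\delta$ over $w^\star$ and the sample, $$\mathcal E_{\hat R}(\tilde w^t_{\mathsf{gd}})\le c\,\sigma^2\log^2(ns/\sigma^2)\,\log^2(d/\delta)\Big(\frac sn+\frac{ds^2}{n^2}\Big).$$ **Lower bounds.** For all $M,B>0$ there are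 $C,c>0$ depending only on $M$ and $B$ such that the following holds for all $n,d,s$ as above, all $\sigma>0$ with $\sigma^2\le M$ and all $\delta\in(0,1)$. Let $w$ be any one of: $\hat w_\lambda$ with any $\lambda>0$; $w_{\mathrm{ols}}$; $w^t_{\mathsf{gd}}$ with any $\eta>0$ and any finite $t\ge0$. Then, with probability at least $1-\delta$ over the inputs and the noise, $$\mathbb E_{w^\star}[\mathcal E(w)]\ \ge\ c\,\frac{\sigma^2d}{n}\quad\text{if } n\ge C\big(d+\log(1/\delta)\big)\text{ and }\log(1/\delta)\le B\,d,$$ $$\mathbb E_{w^\star}[\mathcal E(w)]\ \ge\ c\Big(1-\frac nd+\frac{\sigma^2n}{d}\Big)\quad\text{if } d\ge C\big(n+\log(1/\delta)\big).$$ Here $\mathbb E_{w^\star}$ averages over $w^\star$ with inputs and noise held fixed. -/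

import Mathlib

open MeasureTheory ProbabilityTheory

namespace SparseRegression

noncomputable section

/-- The feature space `ℝ^d` with its Euclidean structure. -/
abbrev Feat (d : ℕ) : Type := EuclideanSpace ℝ (Fin d)

/-! ### The model -/

/-- The coefficient vector with support `S`, modulus `1/√s` on `S` and signs given by `τ`. -/
def signVector (d s : ℕ) (S : Finset (Fin d)) (τ : Fin d → Bool) : Feat d :=
  WithLp.toLp 2 fun i => if i ∈ S then (if τ i then 1 / √(s : ℝ) else -(1 / √(s : ℝ))) else 0

lemma supports_nonempty {d s : ℕ} (h : s ≤ d) :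
    (Finset.powersetCard s (Finset.univ : Finset (Fin d))).Nonempty :=
  Finset.powersetCard_nonempty.2 (by simpa using h)

/-- The law of the ground truth `w⋆`: the support is uniform among the subsets of `{1, …, d}` of
size `s`; given the support, the nonzero entries are independent and uniform on `{-1/√s, 1/√s}`. -/
def prior (d s : ℕ) (h : s ≤ d) : PMF (Feat d) :=
  (PMF.uniformOfFinset (Finset.powersetCard s Finset.univ) (supports_nonempty h)).bind fun S =>
    (PMF.uniformOfFintype (Fin d → Bool)).map (signVector d s S)

/-- The law of the Gaussian label noise, with mean `0` and variance `σ²`. -/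
def noiseLaw (σ : ℝ) : Measure ℝ := gaussianReal 0 (σ ^ 2).toNNReal

/-- The law `P` of a fresh pair `(x, y)`: `x ∼ N(0, I)` and `y = ⟨w⋆, x⟩ + N(0, σ²)`. -/
def population {d : ℕ} (σ : ℝ) (wstar : Feat d) : Measure (Feat d × ℝ) :=
  ((stdGaussian (Feat d)).prod (noiseLaw σ)).map fun p => (p.1, inner ℝ wstar p.1 + p.2)

/-- The joint law of the `n` i.i.d. inputs `x₁, …, xₙ ∼ N(0, I)` and of the `n` i.i.d. noise
variables `ε₁, …, εₙ ∼ N(0, σ²)`, which are independent of the inputs. -/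
def sampleLaw (n d : ℕ) (σ : ℝ) : Measure ((Fin n → Feat d) × (Fin n → ℝ)) :=
  (Measure.pi fun _ => stdGaussian (Feat d)).prod (Measure.pi fun _ => noiseLaw σ)

/-- The labels `yᵢ = ⟨w⋆, xᵢ⟩ + εᵢ`. -/
def labels {n d : ℕ} (wstar : Feat d) (X : Fin n → Feat d) (ε : Fin n → ℝ) : Fin n → ℝ :=
  fun i => inner ℝ wstar (X i) + ε i

/-! ### Risks -/

/-- Population risk of the predictor `x ↦ ⟨Φ x, w⟩`, where `Φ` is the feature map in use. -/
def popRisk {d : ℕ} (P : Measure (Feat d × ℝ)) (Φ : Feat d → Feat d) (w : Feat d) : ℝ :=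
  ∫ p, (inner ℝ (Φ p.1) w - p.2) ^ 2 ∂P

/-- Excess risk of the parameter `w` when the features are mapped by `Φ`. -/
def excessRisk {d : ℕ} (P : Measure (Feat d × ℝ)) (Φ : Feat d → Feat d) (w : Feat d) : ℝ :=
  popRisk P Φ w - ⨅ w' : Feat d, popRisk P Φ w'

/-- Empirical square loss `(1/2n) ∑ᵢ (yᵢ - ⟨w, zᵢ⟩)²`. -/
def empLoss {n d : ℕ} (Z : Fin n → Feat d) (y : Fin n → ℝ) (w : Feat d) : ℝ :=
  1 / (2 * (n : ℝ)) * ∑ i, (y i - inner ℝ w (Z i)) ^ 2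

/-! ### Estimators -/

/-- `t` steps of gradient descent with step size `η` on the empirical loss, started at `0`. -/
def gdEstimator {n d : ℕ} (η : ℝ) (t : ℕ) (Z : Fin n → Feat d) (y : Fin n → ℝ) : Feat d :=
  (fun w => w - η • gradient (empLoss Z y) w)^[t] 0

/-- Empirical correlations `r̂ⱼ = (1/n) ∑ᵢ xᵢⱼ yᵢ` between the features and the label. -/
def corr {n d : ℕ} (X : Fin n → Feat d) (y : Fin n → ℝ) (j : Fin d) : ℝ :=
  1 / (n : ℝ) * ∑ i, X i j * y i

/-- The preprocessing map `x ↦ R̂ x` with `R̂ = diag(r̂₁, …, r̂_d)`. -/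
def preprocess {n d : ℕ} (X : Fin n → Feat d) (y : Fin n → ℝ) (x : Feat d) : Feat d :=
  WithLp.toLp 2 fun j => corr X y j * x j

/-- Preprocess-then-optimize: `t` steps of gradient descent on the preprocessed examples. -/
def preGDEstimator {n d : ℕ} (η : ℝ) (t : ℕ) (X : Fin n → Feat d) (y : Fin n → ℝ) : Feat d :=
  gdEstimator η t (fun i => preprocess X y (X i)) y

/-- The `n × d` design matrix, whose rows are the inputs. -/
def design {n d : ℕ} (X : Fin n → Feat d) : Matrix (Fin n) (Fin d) ℝ :=
  Matrix.of fun i j => X i j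

/-- The empirical covariance `Σ̂ = (1/n) Xᵀ X`. -/
def empCov {n d : ℕ} (X : Fin n → Feat d) : Matrix (Fin d) (Fin d) ℝ :=
  (1 / (n : ℝ)) • ((design X).transpose * design X)

/-- The ridge estimator `(1/n) (Σ̂ + lam I)⁻¹ Xᵀ y`. -/
def ridgeEstimator {n d : ℕ} (lam : ℝ) (X : Fin n → Feat d) (y : Fin n → ℝ) : Feat d :=
  WithLp.toLp 2 <| (1 / (n : ℝ)) •
    ((empCov X + lam • (1 : Matrix (Fin d) (Fin d) ℝ))⁻¹.mulVec
      ((design X).transpose.mulVec y))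

/-- `w` minimizes the empirical square loss. -/
def IsLeastSquares {n d : ℕ} (X : Fin n → Feat d) (y : Fin n → ℝ) (w : Feat d) : Prop :=
  ∀ w', empLoss X y w ≤ empLoss X y w'

/-- `w` is the ordinary least squares estimator: the least squares solution, and the one of
minimal norm if there are several. -/
def IsOLS {n d : ℕ} (X : Fin n → Feat d) (y : Fin n → ℝ) (w : Feat d) : Prop :=
  IsLeastSquares X y w ∧ ∀ w', IsLeastSquares X y w' → ‖w‖ ≤ ‖w'‖

/-- The baselines on the raw features: ridge regression with some regularization parameter, OLS,
and gradient descent with some step size and some finite number of steps. -/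
def IsBaseline {n d : ℕ} (est : (Fin n → Feat d) → (Fin n → ℝ) → Feat d) : Prop :=
  (∃ lam : ℝ, 0 < lam ∧ est = ridgeEstimator lam) ∨
  (∀ X y, IsOLS X y (est X y)) ∨
  (∃ (η : ℝ) (t : ℕ), 0 < η ∧ est = gdEstimator η t)

/-- `E_{w⋆}[excess risk]` of an estimator on the raw features, for given inputs and noise. -/
def meanExcessRisk {n d : ℕ} (s : ℕ) (h : s ≤ d) (σ : ℝ)
    (est : (Fin n → Feat d) → (Fin n → ℝ) → Feat d)
    (X : Fin n → Feat d) (ε : Fin n → ℝ) : ℝ :=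
  ∫ wstar, excessRisk (population σ wstar) id (est X (labels wstar X ε))
    ∂(prior d s h).toMeasure

/-- Excess risk of preprocess-then-optimize. -/
def preGDExcessRisk {n d : ℕ} (σ η : ℝ) (t : ℕ) (wstar : Feat d)
    (X : Fin n → Feat d) (ε : Fin n → ℝ) : ℝ :=
  excessRisk (population σ wstar) (preprocess X (labels wstar X ε))
    (preGDEstimator η t X (labels wstar X ε))

end

end SparseRegression

namespace SparseRegression

/-! ### Gaussian exponential moments -/

/-! Upper bound. In the original coordinates the error `e = R̂ w - w⋆` of gradient descent on
preprocessed data obeys `e ← e - D (Σ̂ e - ξ)` with `D = η R̂²` and `ξ = Xᵀ ε / n`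
(`preGDError_succ_apply`): it is gradient descent with a diagonal preconditioner. Since `r̂ = Σ̂ w⋆
+ ξ`, concentration puts each `r̂ⱼ` within `(√s + σ) κ` of `w⋆ⱼ`, where `κ² = 48 log (d/δ) / n`.
With `η = s / 4` the entries of `D` are of order one on the support and at most `ρ`, of order `s² (1
+ σ²) log (d/δ) / n`, off it. On the support the error therefore contracts by `31/32` per step down
to the noise level; off the support it starts at `0` and barely moves in `t` steps.
`measure_not_regularSample` supplies the concentration, `NearIsotropic.norm_restr_step_le` and
`NearIsotropic.norm_restr_compl_step_le` the two coupled inequalities, `coupled_recursion_le` solves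
them, and `rate_bound` converts the solution into the rate. If `n ≤ s log² (d/δ)`, the claimed bound
exceeds `2`, and a tiny step size, which leaves the error near `-w⋆` of norm one, is enough
(`exists_stepsize_le_two`).

Lower bounds. Ridge and gradient descent are linear in the labels, `w = T y`, and OLS is a limit of
ridge. As the prior is centred with covariance `I / d`, the mean excess risk is exactly `‖T X -
I‖²_F / d + ‖T ε‖²` (`meanExcessRisk_linear`). For `d ≥ 2n`, the rank of `T` is at most `n`, so the
first term is at least `1 - n/d ≥ 1/2`. For `n ≥ 2d` there is a dichotomy on the singular values of
`T`. If fewer than `d/2` of their squares reach `1/(64 n)`, then `T X` is far from `I` and the first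
term is at least `1/8`. Otherwise a Gaussian small-ball estimate makes `‖T ε‖²` at least of order
`σ² d / n`, with failure probability exponentially small in `d`. -/

theorem lintegral_exp_mul_sq_gaussianReal {a : ℝ} (ha : a < 1 / 2) :
    ∫⁻ x, ENNReal.ofReal (Real.exp (a * x ^ 2)) ∂(gaussianReal 0 1) =
      ENNReal.ofReal ((√(1 - 2 * a))⁻¹) := by
  rw [gaussianReal_of_var_ne_zero _ one_ne_zero,
    lintegral_withDensity_eq_lintegral_mul _ (measurable_gaussianPDF 0 1) (by fun_prop)]
  have h1 : ∀ x : ℝ, (gaussianPDF 0 1 * fun x => ENNReal.ofReal (Real.exp (a * x ^ 2))) x =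
      ENNReal.ofReal ((√(2 * Real.pi))⁻¹ * Real.exp (-(1 / 2 - a) * x ^ 2)) := by
    intro x
    rw [Pi.mul_apply, gaussianPDF, ← ENNReal.ofReal_mul (gaussianPDFReal_nonneg _ _ _),
      gaussianPDFReal]
    congr 1
    rw [mul_assoc, ← Real.exp_add]
    congr 2
    · simp
    · simp; ring
  have hb : 0 < 1 / 2 - a := by linarith
  rw [lintegral_congr h1, ← ofReal_integral_eq_lintegral_ofReal
    ((integrable_exp_neg_mul_sq hb).const_mul _) (ae_of_all _ fun x => by positivity),
    integral_const_mul, integral_gaussian]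
  congr 1
  rw [← Real.sqrt_inv, ← Real.sqrt_inv, ← Real.sqrt_mul (by positivity)]
  congr 1
  have := Real.pi_pos
  have h2 : 1 - 2 * a ≠ 0 := by linarith
  field_simp

/-- Second-order control of the chi-square moment generating function for both signs of `a`, so that
it serves upper and lower tails alike. -/
theorem inv_sqrt_one_sub_le_exp {a : ℝ} (ha : |a| ≤ 1 / 4) :
    (√(1 - 2 * a))⁻¹ ≤ Real.exp (a + 2 * a ^ 2) := by
  obtain ⟨h1, h2⟩ := abs_le.1 ha
  have hpos : 0 < 1 - 2 * a := by linarith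
  have key : Real.exp (-(2 * a + 4 * a ^ 2)) ≤ 1 - 2 * a := by
    rw [Real.exp_neg]
    have h3 : (1 - 2 * a)⁻¹ ≤ Real.exp (2 * a + 4 * a ^ 2) := by
      rw [inv_le_iff_one_le_mul₀ hpos]
      -- `(1 - 2a)(1 + 2a + 4a²) = 1 - 8a³` is at least `1` only for `a ≤ 0`; for `a ≥ 0` the
      -- quadratic term of the exponential makes up the deficit.
      rcases le_total a 0 with h | h
      · have h5 := mul_le_mul_of_nonneg_left (Real.add_one_le_exp (2 * a + 4 * a ^ 2)) hpos.le
        nlinarith [mul_nonneg (sq_nonneg a) (neg_nonneg.2 h)]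
      · have h5 := mul_le_mul_of_nonneg_left
          (Real.quadratic_le_exp_of_nonneg (x := 2 * a + 4 * a ^ 2) (by positivity)) hpos.le
        have h6 : 0 ≤ a ^ 2 * (1 - 2 * a - (2 * a) ^ 2 - (2 * a) ^ 3) := by
          refine mul_nonneg (sq_nonneg a) ?_
          nlinarith [mul_nonneg h (sub_nonneg.2 h2), mul_nonneg (mul_nonneg h h) (sub_nonneg.2 h2)]
        nlinarith
    calc _ ≤ ((1 - 2 * a)⁻¹)⁻¹ := inv_anti₀ (by positivity) h3
      _ = _ := inv_inv _
  rw [inv_le_comm₀ (by positivity) (by positivity), ← Real.exp_neg]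
  apply Real.le_sqrt_of_sq_le
  rw [← Real.exp_nat_mul]
  convert key using 2
  push_cast
  ring

theorem lintegral_pi_prod {ι : Type*} [Fintype ι] {E : ι → Type*} [∀ i, MeasurableSpace (E i)]
    (μ : ∀ i, Measure (E i)) [∀ i, IsProbabilityMeasure (μ i)] {f : ∀ i, E i → ENNReal}
    (hf : ∀ i, Measurable (f i)) :
    ∫⁻ x, ∏ i, f i (x i) ∂(Measure.pi μ) = ∏ i, ∫⁻ y, f i y ∂(μ i) := by
  have h := iIndepFun_pi (μ := μ) (X := f) fun i => (hf i).aemeasurable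
  rw [lintegral_prod_eq_prod_lintegral_of_indepFun Finset.univ _ h
    fun i => (hf i).comp (measurable_pi_apply i)]
  refine Finset.prod_congr rfl fun i _ => ?_
  exact (measurePreserving_eval μ i).lintegral_comp (hf i)

theorem map_inner_stdGaussian {E : Type*} [NormedAddCommGroup E] [InnerProductSpace ℝ E]
    [FiniteDimensional ℝ E] [MeasurableSpace E] [BorelSpace E] {v : E} (hv : ‖v‖ = 1) :
    (stdGaussian E).map (fun x => inner ℝ v x) = gaussianReal 0 1 := by
  have h := IsGaussian.map_eq_gaussianReal (μ := stdGaussian E) (innerSL ℝ v)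
  rw [integral_strongDual_stdGaussian, variance_dual_stdGaussian, innerSL_apply_norm, hv] at h
  simpa using h

theorem noiseLaw_eq_map (σ : ℝ) :
    noiseLaw σ = (gaussianReal 0 1).map (fun x => σ * x) := by
  rw [gaussianReal_map_const_mul, noiseLaw]
  congr 1
  · simp
  · ext
    simp [sq_nonneg]

instance (σ : ℝ) : IsProbabilityMeasure (noiseLaw σ) := by
  unfold noiseLaw; infer_instance

instance (n d : ℕ) (σ : ℝ) : IsProbabilityMeasure (sampleLaw n d σ) := by
  unfold sampleLaw; infer_instance

/-- Chernoff's bound with a lower integral, so that no integrability has to be checked. -/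
theorem measure_le_exp_mul_lintegral {Ω : Type*} [MeasurableSpace Ω] (μ : Measure Ω)
    {f : Ω → ℝ} (hf : Measurable f) (a : ℝ) :
    μ {ω | a ≤ f ω} ≤
      ENNReal.ofReal (Real.exp (-a)) * ∫⁻ ω, ENNReal.ofReal (Real.exp (f ω)) ∂μ := by
  have h := mul_meas_ge_le_lintegral (μ := μ)
    (f := fun ω => ENNReal.ofReal (Real.exp (f ω))) (by fun_prop) (ENNReal.ofReal (Real.exp a))
  have hset : {ω | a ≤ f ω} =
      {ω | ENNReal.ofReal (Real.exp a) ≤ ENNReal.ofReal (Real.exp (f ω))} := by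
    ext ω
    simp [ENNReal.ofReal_le_ofReal_iff (Real.exp_pos _).le]
  rw [← hset] at h
  calc μ {ω | a ≤ f ω}
      = ENNReal.ofReal (Real.exp (-a)) * (ENNReal.ofReal (Real.exp a) * μ {ω | a ≤ f ω}) := by
        rw [← mul_assoc, ← ENNReal.ofReal_mul (Real.exp_pos _).le, ← Real.exp_add]
        simp
    _ ≤ _ := by gcongr

/-! ### Tails of the empirical covariance -/

section

variable {E : Type*} [NormedAddCommGroup E] [InnerProductSpace ℝ E]
    [FiniteDimensional ℝ E] [MeasurableSpace E] [BorelSpace E]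

theorem lintegral_exp_mul_sum_inner_sq (n : ℕ) {v : E} (hv : ‖v‖ = 1) {a : ℝ} (ha : a < 1 / 2) :
    ∫⁻ X, ENNReal.ofReal (Real.exp (a * ∑ i, inner ℝ v (X i) ^ 2))
        ∂(Measure.pi fun _ : Fin n => stdGaussian E) =
      ENNReal.ofReal ((√(1 - 2 * a))⁻¹) ^ n := by
  have h1 : ∀ X : Fin n → E, ENNReal.ofReal (Real.exp (a * ∑ i, inner ℝ v (X i) ^ 2)) =
      ∏ i, (fun x : E => ENNReal.ofReal (Real.exp (a * inner ℝ v x ^ 2))) (X i) := by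
    intro X
    rw [Finset.mul_sum, Real.exp_sum, ENNReal.ofReal_prod_of_nonneg fun i _ => (Real.exp_pos _).le]
  rw [lintegral_congr h1, lintegral_pi_prod (fun _ : Fin n => stdGaussian E)
    (f := fun _ x => ENNReal.ofReal (Real.exp (a * inner ℝ v x ^ 2))) fun i => by fun_prop]
  simp only [Finset.prod_const, Finset.card_univ, Fintype.card_fin]
  congr 1
  rw [← lintegral_exp_mul_sq_gaussianReal ha, ← map_inner_stdGaussian hv,
    lintegral_map (by fun_prop) (by fun_prop)]

theorem measure_sum_inner_sq_ge (n : ℕ) {v : E} (hv : ‖v‖ = 1) {κ : ℝ} (h0 : 0 ≤ κ)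
    (h1 : κ ≤ 1) :
    (Measure.pi fun _ : Fin n => stdGaussian E) {X | n * (1 + κ) ≤ ∑ i, inner ℝ v (X i) ^ 2} ≤
      ENNReal.ofReal (Real.exp (-(n * κ ^ 2 / 8))) := by
  -- The tilt `κ/4` gives the exponent `-n (κ/4)(1 + κ) + n (κ/4 + κ²/8) = -n κ²/8`.
  have hm := measure_le_exp_mul_lintegral (Measure.pi fun _ : Fin n => stdGaussian E)
    (f := fun X => κ / 4 * ∑ i, inner ℝ v (X i) ^ 2) (by fun_prop) (κ / 4 * (n * (1 + κ)))
  rw [lintegral_exp_mul_sum_inner_sq n hv (by linarith)] at hm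
  refine (measure_mono ?_).trans (hm.trans ?_)
  · intro X hX
    rw [Set.mem_ofPred_eq] at hX ⊢
    exact mul_le_mul_of_nonneg_left hX (by linarith)
  · rw [← ENNReal.ofReal_pow (by positivity), ← ENNReal.ofReal_mul (by positivity)]
    apply ENNReal.ofReal_le_ofReal
    calc _ ≤ Real.exp (-(κ / 4 * (n * (1 + κ)))) * Real.exp (κ / 4 + 2 * (κ / 4) ^ 2) ^ n := by
          gcongr
          exact inv_sqrt_one_sub_le_exp (by rw [abs_of_nonneg (by linarith)]; linarith)
      _ = _ := by
          rw [← Real.exp_nat_mul, ← Real.exp_add]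
          congr 1
          ring

theorem measure_sum_inner_sq_le (n : ℕ) {v : E} (hv : ‖v‖ = 1) {κ : ℝ} (h0 : 0 ≤ κ)
    (h1 : κ ≤ 1) :
    (Measure.pi fun _ : Fin n => stdGaussian E) {X | ∑ i, inner ℝ v (X i) ^ 2 ≤ n * (1 - κ)} ≤
      ENNReal.ofReal (Real.exp (-(n * κ ^ 2 / 8))) := by
  have hm := measure_le_exp_mul_lintegral (Measure.pi fun _ : Fin n => stdGaussian E)
    (f := fun X => -(κ / 4) * ∑ i, inner ℝ v (X i) ^ 2) (by fun_prop) (-(κ / 4) * (n * (1 - κ)))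
  rw [lintegral_exp_mul_sum_inner_sq n hv (by linarith)] at hm
  refine (measure_mono ?_).trans (hm.trans ?_)
  · intro X hX
    rw [Set.mem_ofPred_eq] at hX ⊢
    exact mul_le_mul_of_nonpos_left hX (by linarith)
  · rw [← ENNReal.ofReal_pow (by positivity), ← ENNReal.ofReal_mul (by positivity)]
    apply ENNReal.ofReal_le_ofReal
    calc _ ≤ Real.exp (-(-(κ / 4) * (n * (1 - κ)))) *
          Real.exp (-(κ / 4) + 2 * (-(κ / 4)) ^ 2) ^ n := by
          gcongr
          exact inv_sqrt_one_sub_le_exp (by rw [abs_neg, abs_of_nonneg (by linarith)]; linarith)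
      _ = _ := by
          rw [← Real.exp_nat_mul, ← Real.exp_add]
          congr 1
          ring

/-- Crude upper tail of a chi-square variable with `n` degrees of freedom. -/
theorem measure_sum_inner_sq_ge_of_le (n : ℕ) {v : E} (hv : ‖v‖ = 1) (u : ℝ) :
    (Measure.pi fun _ : Fin n => stdGaussian E)
        {X | 4 * (n + u) ≤ ∑ i, inner ℝ v (X i) ^ 2} ≤ ENNReal.ofReal (Real.exp (-u)) := by
  have hm := measure_le_exp_mul_lintegral (Measure.pi fun _ : Fin n => stdGaussian E)
    (f := fun X => 1 / 4 * ∑ i, inner ℝ v (X i) ^ 2) (by fun_prop) (1 / 4 * (4 * (n + u)))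
  rw [lintegral_exp_mul_sum_inner_sq n hv (by norm_num)] at hm
  refine (measure_mono ?_).trans (hm.trans ?_)
  · intro X hX
    rw [Set.mem_ofPred_eq] at hX ⊢
    exact mul_le_mul_of_nonneg_left hX (by norm_num)
  · rw [← ENNReal.ofReal_pow (by positivity), ← ENNReal.ofReal_mul (by positivity)]
    apply ENNReal.ofReal_le_ofReal
    calc _ ≤ Real.exp (-(1 / 4 * (4 * (n + u)))) * Real.exp (1 / 4 + 2 * (1 / 4) ^ 2) ^ n := by
          gcongr
          exact inv_sqrt_one_sub_le_exp (by norm_num)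
      _ ≤ _ := by
          rw [← Real.exp_nat_mul, ← Real.exp_add]
          apply Real.exp_le_exp.2
          have : (0 : ℝ) ≤ n := Nat.cast_nonneg n
          linarith

end


/-! ### Tails of the noise correlations and of the covariance entries. -/

theorem lintegral_exp_mul_sum_noiseLaw {n : ℕ} (σ : ℝ) (x : Fin n → ℝ) :
    ∫⁻ ε, ENNReal.ofReal (Real.exp (∑ i, x i * ε i)) ∂(Measure.pi fun _ : Fin n => noiseLaw σ) =
      ENNReal.ofReal (Real.exp (σ ^ 2 / 2 * ∑ i, x i ^ 2)) := by
  have h1 : ∀ ε : Fin n → ℝ, ENNReal.ofReal (Real.exp (∑ i, x i * ε i)) =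
      ∏ i, (fun y : ℝ => ENNReal.ofReal (Real.exp (x i * y))) (ε i) := by
    intro ε
    rw [Real.exp_sum, ENNReal.ofReal_prod_of_nonneg fun i _ => (Real.exp_pos _).le]
  rw [lintegral_congr h1, lintegral_pi_prod (fun _ : Fin n => noiseLaw σ)
    (f := fun i y => ENNReal.ofReal (Real.exp (x i * y))) fun i => by fun_prop, Finset.mul_sum,
    Real.exp_sum, ENNReal.ofReal_prod_of_nonneg fun i _ => (Real.exp_pos _).le]
  refine Finset.prod_congr rfl fun i _ => ?_
  have h := congrFun (mgf_fun_id_gaussianReal (μ := 0) (v := (σ ^ 2).toNNReal)) (x i)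
  rw [mgf] at h
  rw [noiseLaw, ← ofReal_integral_eq_lintegral_ofReal (integrable_exp_mul_gaussianReal _)
    (ae_of_all _ fun x => (Real.exp_pos _).le), h]
  congr 2
  rw [Real.coe_toNNReal _ (sq_nonneg σ)]
  ring

/-- Given the inputs the sum is Gaussian, so integrating out the noise leaves a chi-square
exponential moment. The tilt `κ/(2σ)` gives the exponent `n (-κ²/2 + κ²/8 + κ⁴/32) ≤ -n κ²/8`. -/
theorem measure_sum_mul_noise_ge {n d : ℕ} {σ : ℝ} (hσ : 0 < σ) {v : Feat d} (hv : ‖v‖ = 1) {κ : ℝ}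
    (h0 : 0 ≤ κ) (h1 : κ ≤ 1) :
    sampleLaw n d σ {ω | n * σ * κ ≤ ∑ i, inner ℝ v (ω.1 i) * ω.2 i} ≤
      ENNReal.ofReal (Real.exp (-(n * κ ^ 2 / 8))) := by
  have hm := measure_le_exp_mul_lintegral (sampleLaw n d σ)
    (f := fun ω => ∑ i, (κ / (2 * σ) * inner ℝ v (ω.1 i)) * ω.2 i) (by fun_prop)
    (κ / (2 * σ) * (n * σ * κ))
  rw [sampleLaw, lintegral_prod _ (by fun_prop)] at hm
  simp_rw [lintegral_exp_mul_sum_noiseLaw] at hm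
  have h2 : ∀ X : Fin n → Feat d, σ ^ 2 / 2 * ∑ i, (κ / (2 * σ) * inner ℝ v (X i)) ^ 2 =
      κ ^ 2 / 8 * ∑ i, inner ℝ v (X i) ^ 2 := by
    intro X
    rw [Finset.mul_sum, Finset.mul_sum]
    refine Finset.sum_congr rfl fun i _ => ?_
    field_simp
    ring
  simp_rw [h2] at hm
  have hk : κ ^ 2 ≤ 1 := pow_le_one₀ h0 h1
  rw [lintegral_exp_mul_sum_inner_sq n hv (by linarith)] at hm
  refine (measure_mono ?_).trans (hm.trans ?_)
  · intro ω hω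
    rw [Set.mem_ofPred_eq] at hω ⊢
    simp_rw [mul_assoc (κ / (2 * σ)), ← Finset.mul_sum]
    exact mul_le_mul_of_nonneg_left hω (by positivity)
  · rw [← ENNReal.ofReal_pow (by positivity), ← ENNReal.ofReal_mul (by positivity)]
    apply ENNReal.ofReal_le_ofReal
    calc _ ≤ Real.exp (-(κ / (2 * σ) * (n * σ * κ))) *
          Real.exp (κ ^ 2 / 8 + 2 * (κ ^ 2 / 8) ^ 2) ^ n := by
          gcongr
          exact inv_sqrt_one_sub_le_exp (by rw [abs_of_nonneg (by positivity)]; linarith)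
      _ ≤ _ := by
          rw [← Real.exp_nat_mul, ← Real.exp_add]
          apply Real.exp_le_exp.2
          have h3 : κ / (2 * σ) * (n * σ * κ) = n * κ ^ 2 / 2 := by field_simp
          rw [h3]
          have hn : (0 : ℝ) ≤ n := Nat.cast_nonneg n
          have h4 : n * (κ ^ 2 * κ ^ 2) ≤ n * κ ^ 2 := by
            gcongr
            nlinarith [sq_nonneg κ]
          nlinarith

theorem measure_abs_sum_mul_noise_ge {n d : ℕ} {σ : ℝ} (hσ : 0 < σ) (j : Fin d) {κ : ℝ}
    (h0 : 0 ≤ κ) (h1 : κ ≤ 1) :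
    sampleLaw n d σ {ω | ¬ |∑ i, ω.1 i j * ω.2 i| ≤ n * σ * κ} ≤
      ENNReal.ofReal (2 * Real.exp (-(n * κ ^ 2 / 8))) := by
  have hv : ‖(EuclideanSpace.single j (1 : ℝ) : Feat d)‖ = 1 := by simp
  have hv' : ‖-(EuclideanSpace.single j (1 : ℝ) : Feat d)‖ = 1 := by simp
  rw [two_mul, ENNReal.ofReal_add (by positivity) (by positivity)]
  refine (measure_mono ?_).trans ((measure_union_le _ _).trans (add_le_add
    (measure_sum_mul_noise_ge hσ hv h0 h1) (measure_sum_mul_noise_ge hσ hv' h0 h1)))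
  intro ω hω
  simp only [Set.mem_union, Set.mem_ofPred_eq, inner_neg_left, EuclideanSpace.inner_single_left,
    map_one, one_mul, neg_mul, Finset.sum_neg_distrib] at hω ⊢
  rw [not_le, lt_abs] at hω
  exact hω.imp le_of_lt le_of_lt

/-- Off-diagonal entries follow by polarization: `xⱼ xₖ` is half the difference of the squares along
the unit vectors `(eⱼ ± eₖ)/√2`, whence up to four tail events. -/
theorem measure_empCov_entry {n d : ℕ} (j k : Fin d) {κ : ℝ} (h0 : 0 ≤ κ) (h1 : κ ≤ 1) :
    (Measure.pi fun _ : Fin n => stdGaussian (Feat d))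
      {X | ¬ |∑ i, X i j * X i k - if j = k then (n : ℝ) else 0| ≤ n * κ} ≤
      ENNReal.ofReal (4 * Real.exp (-(n * κ ^ 2 / 8))) := by
  set e : ℝ := Real.exp (-(n * κ ^ 2 / 8)) with he
  have he0 : 0 < e := Real.exp_pos _
  by_cases hjk : j = k
  · subst hjk
    have hv : ‖(EuclideanSpace.single j (1 : ℝ) : Feat d)‖ = 1 := by simp
    calc _ ≤ ENNReal.ofReal e + ENNReal.ofReal e := by
          refine (measure_mono ?_).trans ((measure_union_le _ _).trans (add_le_add
            (measure_sum_inner_sq_ge n hv h0 h1) (measure_sum_inner_sq_le n hv h0 h1)))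
          intro X hX
          simp only [Set.mem_union, Set.mem_ofPred_eq, EuclideanSpace.inner_single_left,
            map_one, one_mul, if_true] at hX ⊢
          rw [not_le, lt_abs] at hX
          simp_rw [pow_two]
          exact hX.imp (fun h => by linarith) (fun h => by linarith)
      _ ≤ _ := by
          rw [← ENNReal.ofReal_add he0.le he0.le]
          exact ENNReal.ofReal_le_ofReal (by linarith)
  · have hn : ∀ c : ℝ, c ^ 2 = 1 → ‖(√2)⁻¹ • (EuclideanSpace.single j (1 : ℝ) +
        c • EuclideanSpace.single k (1 : ℝ) : Feat d)‖ = 1 := by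
      intro c hc
      rw [norm_smul, ← sq_eq_sq₀ (by positivity) zero_le_one, mul_pow, norm_add_sq_real, norm_smul]
      simp [inner_smul_right, hjk, hc, EuclideanSpace.inner_single_left]
      norm_num
    have h1' := hn 1 (by norm_num)
    have h2' := hn (-1) (by norm_num)
    calc _ ≤ (ENNReal.ofReal e + ENNReal.ofReal e) + (ENNReal.ofReal e + ENNReal.ofReal e) := by
          refine (measure_mono ?_).trans ((measure_union_le _ _).trans (add_le_add
            ((measure_union_le _ _).trans (add_le_add
            (measure_sum_inner_sq_ge n h1' h0 h1) (measure_sum_inner_sq_le n h1' h0 h1)))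
            ((measure_union_le _ _).trans (add_le_add
            (measure_sum_inner_sq_ge n h2' h0 h1) (measure_sum_inner_sq_le n h2' h0 h1)))))
          intro X hX
          simp only [Set.mem_union, Set.mem_ofPred_eq, inner_add_left, inner_smul_left,
            EuclideanSpace.inner_single_left, map_one, one_mul, hjk, if_false, sub_zero, mul_pow,
            conj_trivial, ← Finset.mul_sum, inv_pow, Real.sq_sqrt zero_le_two] at hX ⊢
          by_contra! hcon
          apply hX
          have h3 : ∑ i, X i j * X i k = 2⁻¹ * (2⁻¹ * ∑ i, (X i j + X i k) ^ 2 -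
              2⁻¹ * ∑ i, (X i j + -1 * X i k) ^ 2) := by
            rw [← mul_sub, ← Finset.sum_sub_distrib, Finset.mul_sum, Finset.mul_sum]
            exact Finset.sum_congr rfl fun i _ => by ring
          rw [h3, abs_le]
          obtain ⟨⟨h4, h5⟩, h6, h7⟩ := hcon
          constructor <;> linarith
      _ ≤ _ := by
          rw [← ENNReal.ofReal_add he0.le he0.le, ← ENNReal.ofReal_add (by linarith) (by linarith)]
          exact ENNReal.ofReal_le_ofReal (by linarith)

/-! ### Nets and the operator norm of the design matrix. -/

/-- A `1/2`-net of the unit ball with at most `5 ^ d` points of norm one. -/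
theorem exists_finset_norm_sub_lt (E : Type*) [NormedAddCommGroup E] [NormedSpace ℝ E]
    [FiniteDimensional ℝ E] :
    ∃ N : Finset E, N.card ≤ 5 ^ Module.finrank ℝ E ∧ (∀ v ∈ N, ‖v‖ = 1) ∧
      ∀ v : E, ‖v‖ = 1 → ∃ w ∈ N, ‖v - w‖ ≤ 1 / 2 := by
  let P : Finset E → Prop := fun N => (∀ v ∈ N, ‖v‖ = 1) ∧
    ∀ v ∈ N, ∀ w ∈ N, v ≠ w → 1 / 2 ≤ ‖v - w‖
  have hcard : ∀ N, P N → N.card ≤ 5 ^ Module.finrank ℝ E := by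
    intro N hN
    classical
    -- Doubling turns a `1/2`-separated set on the unit sphere into a `1`-separated set in the ball
    -- of radius `2`, the normalization of the packing bound.
    have hinj : Function.Injective (fun v : E => (2 : ℝ) • v) := smul_right_injective _ two_ne_zero
    rw [← Finset.card_image_of_injective N hinj]
    apply Besicovitch.card_le_of_separated
    · intro c hc
      obtain ⟨v, hv, rfl⟩ := Finset.mem_image.1 hc
      rw [norm_smul, hN.1 v hv]
      norm_num
    · intro c hc c' hc' hne
      obtain ⟨v, hv, rfl⟩ := Finset.mem_image.1 hc
      obtain ⟨w, hw, rfl⟩ := Finset.mem_image.1 hc'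
      have h := hN.2 v hv w hw (fun h => hne (by rw [h]))
      rw [← smul_sub, norm_smul, Real.norm_two]
      linarith
  have hex : ∃ m, ∃ N, P N ∧ N.card = m := ⟨0, ∅, by simp [P], rfl⟩
  -- A separated set of maximal cardinality is a net: a unit vector far from all its points could be
  -- added to it.
  obtain ⟨N, hN, hmax⟩ : ∃ N, P N ∧ ∀ N', P N' → N'.card ≤ N.card := by
    classical
    obtain ⟨N, hN, hNc⟩ := Nat.findGreatest_spec (P := fun m => ∃ N, P N ∧ N.card = m)
      (n := 5 ^ Module.finrank ℝ E) (Nat.zero_le _) ⟨∅, by simp [P], rfl⟩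
    exact ⟨N, hN, fun N' hN' => hNc ▸ Nat.le_findGreatest (hcard N' hN') ⟨N', hN', rfl⟩⟩
  refine ⟨N, hcard N hN, hN.1, fun v hv => ?_⟩
  classical
  by_contra! hcon
  have hvN : v ∉ N := fun h => by
    have := hcon v h
    norm_num at this
  have h := hmax (insert v N) ⟨fun w hw => ?_, fun w hw w' hw' hne => ?_⟩
  · rw [Finset.card_insert_of_notMem hvN] at h
    omega
  · rcases Finset.mem_insert.1 hw with rfl | hw
    exacts [hv, hN.1 w hw]
  · rcases Finset.mem_insert.1 hw with rfl | hw₁ <;>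
      rcases Finset.mem_insert.1 hw' with rfl | hw₂
    · exact absurd rfl hne
    · exact (hcon w' hw₂).le
    · rw [norm_sub_rev]
      exact (hcon w hw₁).le
    · exact hN.2 w hw₁ w' hw₂ hne

/-- Replacing a unit vector by a net point costs at most `‖T‖ / 2`, so `‖T‖ ≤ b + ‖T‖ / 2`. -/
theorem opNorm_le_of_net {E F : Type*} [NormedAddCommGroup E] [NormedSpace ℝ E]
    [NormedAddCommGroup F] [NormedSpace ℝ F] (T : E →L[ℝ] F) {N : Finset E} {b : ℝ} (hb : 0 ≤ b)
    (hN : ∀ v : E, ‖v‖ = 1 → ∃ w ∈ N, ‖v - w‖ ≤ 1 / 2) (hT : ∀ w ∈ N, ‖T w‖ ≤ b) :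
    ‖T‖ ≤ 2 * b := by
  have h : ‖T‖ ≤ b + ‖T‖ / 2 := by
    refine T.opNorm_le_bound (by positivity) fun x => ?_
    rcases eq_or_ne x 0 with rfl | hx
    · simp
    have hx0 : 0 < ‖x‖ := norm_pos_iff.2 hx
    obtain ⟨w, hw, hvw⟩ := hN (‖x‖⁻¹ • x) (by rw [norm_smul, norm_inv, norm_norm]; field_simp)
    have h2 : ‖T (‖x‖⁻¹ • x)‖ ≤ b + ‖T‖ / 2 := by
      calc ‖T (‖x‖⁻¹ • x)‖ = ‖T w + T (‖x‖⁻¹ • x - w)‖ := by rw [← map_add]; simp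
        _ ≤ ‖T w‖ + ‖T‖ * ‖‖x‖⁻¹ • x - w‖ := (norm_add_le _ _).trans (by
            gcongr; exact T.le_opNorm _)
        _ ≤ b + ‖T‖ * (1 / 2) := by
            gcongr
            exact hT w hw
        _ = _ := by ring
    rw [map_smul, norm_smul, norm_inv, norm_norm, inv_mul_le_iff₀ hx0] at h2
    linarith
  linarith

/-- The design matrix as a continuous linear map between Euclidean spaces. -/
noncomputable def designCLM {n d : ℕ} (X : Fin n → Feat d) :
    Feat d →L[ℝ] EuclideanSpace ℝ (Fin n) :=
  (PiLp.continuousLinearEquiv 2 ℝ (fun _ : Fin n => ℝ)).symm.toContinuousLinearMap ∘L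
    ContinuousLinearMap.pi fun i => innerSL ℝ (X i)

@[simp]
theorem designCLM_apply {n d : ℕ} (X : Fin n → Feat d) (v : Feat d) (i : Fin n) :
    designCLM X v i = inner ℝ v (X i) := by
  simp [designCLM, real_inner_comm]

theorem norm_designCLM_apply_sq {n d : ℕ} (X : Fin n → Feat d) (v : Feat d) :
    ‖designCLM X v‖ ^ 2 = ∑ i, inner ℝ v (X i) ^ 2 := by
  simp [EuclideanSpace.real_norm_sq_eq]

/-- Union bound over a net of at most `5 ^ d ≤ exp (2 d)` points; the term `2 d` in the level pays
for it. -/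
theorem measure_opNorm_designCLM (n d : ℕ) {u : ℝ} (hu : 0 ≤ u) :
    (Measure.pi fun _ : Fin n => stdGaussian (Feat d))
      {X | ¬ ‖designCLM X‖ ^ 2 ≤ 16 * (n + (2 * d + u))} ≤ ENNReal.ofReal (Real.exp (-u)) := by
  obtain ⟨N, hcard, hN1, hN⟩ := exists_finset_norm_sub_lt (Feat d)
  rw [finrank_euclideanSpace_fin] at hcard
  calc _ ≤ ∑ v ∈ N, (Measure.pi fun _ : Fin n => stdGaussian (Feat d))
        {X | 4 * (n + (2 * d + u)) ≤ ∑ i, inner ℝ v (X i) ^ 2} := by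
        refine (measure_mono ?_).trans (measure_biUnion_finset_le _ _)
        intro X hX
        rw [Set.mem_ofPred_eq] at hX
        simp only [Set.mem_iUnion, Set.mem_ofPred_eq, exists_prop]
        by_contra! hcon
        apply hX
        have h := opNorm_le_of_net (designCLM X) (Real.sqrt_nonneg (4 * (n + (2 * d + u)))) hN
          (fun w hw => Real.le_sqrt_of_sq_le
            (by rw [norm_designCLM_apply_sq]; exact (hcon w hw).le))
        calc ‖designCLM X‖ ^ 2 ≤ (2 * √(4 * (n + (2 * d + u)))) ^ 2 := by gcongr
          _ = _ := by
            rw [mul_pow, Real.sq_sqrt (by positivity)]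
            ring
    _ ≤ ∑ v ∈ N, ENNReal.ofReal (Real.exp (-(2 * d + u))) :=
        Finset.sum_le_sum fun v hv => measure_sum_inner_sq_ge_of_le n (hN1 v hv) _
    _ = ENNReal.ofReal (N.card * Real.exp (-(2 * d + u))) := by
        rw [Finset.sum_const, nsmul_eq_mul, ENNReal.ofReal_mul (by positivity),
          ENNReal.ofReal_natCast]
    _ ≤ _ := by
        apply ENNReal.ofReal_le_ofReal
        have h5 : (5 : ℝ) ≤ Real.exp 2 := by
          have := Real.quadratic_le_exp_of_nonneg (x := 2) (by norm_num)
          linarith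
        calc N.card * Real.exp (-(2 * d + u)) ≤ Real.exp 2 ^ d * Real.exp (-(2 * d + u)) := by
              gcongr
              calc (N.card : ℝ) ≤ 5 ^ d := by exact_mod_cast hcard
                _ ≤ _ := by gcongr
          _ = _ := by
              rw [← Real.exp_nat_mul, ← Real.exp_add]
              congr 1
              ring

/-- The sample is regular: empirical covariance and noise correlation are entrywise close to their
means, and the design matrix has controlled operator norm. -/
structure RegularSample {n d : ℕ} (σ κ u : ℝ) (X : Fin n → Feat d) (ε : Fin n → ℝ) : Prop where
  cov : ∀ j k, |∑ i, X i j * X i k - if j = k then (n : ℝ) else 0| ≤ n * κ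
  noise : ∀ j, |∑ i, X i j * ε i| ≤ n * σ * κ
  op : ‖designCLM X‖ ^ 2 ≤ 16 * (n + (2 * d + u))

theorem measure_not_regularSample {n d : ℕ} {σ κ u : ℝ} (hσ : 0 < σ) (h0 : 0 ≤ κ) (h1 : κ ≤ 1)
    (hu : 0 ≤ u) :
    sampleLaw n d σ {ω | ¬ RegularSample σ κ u ω.1 ω.2} ≤
      ENNReal.ofReal ((4 * d ^ 2 + 2 * d) * Real.exp (-(n * κ ^ 2 / 8)) + Real.exp (-u)) := by
  set e : ℝ := Real.exp (-(n * κ ^ 2 / 8)) with he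
  have he0 : 0 < e := Real.exp_pos _
  have hfst : ∀ s : Set (Fin n → Feat d), sampleLaw n d σ {ω | ω.1 ∈ s} =
      (Measure.pi fun _ : Fin n => stdGaussian (Feat d)) s := by
    intro s
    have : {ω : (Fin n → Feat d) × (Fin n → ℝ) | ω.1 ∈ s} = s ×ˢ Set.univ := by
      ext ω; simp
    rw [this, sampleLaw, Measure.prod_prod, measure_univ, mul_one]
  have hsub : {ω | ¬ RegularSample σ κ u ω.1 ω.2} ⊆
      ((⋃ j : Fin d, ⋃ k : Fin d, {ω : (Fin n → Feat d) × (Fin n → ℝ) | ω.1 ∈ {X : Fin n → Feat d |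
        ¬ |∑ i, X i j * X i k - if j = k then (n : ℝ) else 0| ≤ n * κ}}) ∪
      (⋃ j : Fin d, {ω : (Fin n → Feat d) × (Fin n → ℝ) |
        ¬ |∑ i, ω.1 i j * ω.2 i| ≤ n * σ * κ})) ∪
      {ω : (Fin n → Feat d) × (Fin n → ℝ) | ω.1 ∈ {X : Fin n → Feat d |
        ¬ ‖designCLM X‖ ^ 2 ≤ 16 * (n + (2 * d + u))}} := by
    intro ω hω
    rw [Set.mem_ofPred_eq] at hω
    by_contra hcon
    simp only [Set.mem_union, Set.mem_iUnion, Set.mem_ofPred_eq, not_or, not_exists,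
      not_not] at hcon
    exact hω ⟨hcon.1.1, hcon.1.2, hcon.2⟩
  rw [show (4 * (d : ℝ) ^ 2 + 2 * d) * e = d * (d * (4 * e)) + d * (2 * e) by ring,
    ENNReal.ofReal_add (by positivity) (by positivity),
    ENNReal.ofReal_add (by positivity) (by positivity)]
  refine (measure_mono hsub).trans ((measure_union_le _ _).trans (add_le_add
    ((measure_union_le _ _).trans (add_le_add ?_ ?_)) ?_))
  · have hsum : ENNReal.ofReal (d * (d * (4 * e))) =
        ∑ _j : Fin d, ∑ _k : Fin d, ENNReal.ofReal (4 * e) := by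
      simp [ENNReal.ofReal_mul]
    rw [hsum]
    refine (measure_iUnion_fintype_le _ _).trans (Finset.sum_le_sum fun j _ => ?_)
    refine (measure_iUnion_fintype_le _ _).trans (Finset.sum_le_sum fun k _ => ?_)
    rw [hfst]
    exact measure_empCov_entry j k h0 h1
  · have hsum : ENNReal.ofReal (d * (2 * e)) = ∑ _j : Fin d, ENNReal.ofReal (2 * e) := by
      simp [ENNReal.ofReal_mul]
    rw [hsum]
    exact (measure_iUnion_fintype_le _ _).trans (Finset.sum_le_sum fun j _ =>
      measure_abs_sum_mul_noise_ge hσ j h0 h1)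
  · rw [hfst]
    exact measure_opNorm_designCLM n d hu


/-! ### Risks -/

theorem integral_inner_sq_stdGaussian {d : ℕ} (a : Feat d) :
    ∫ x, inner ℝ a x ^ 2 ∂(stdGaussian (Feat d)) = ‖a‖ ^ 2 := by
  have h := variance_dual_stdGaussian (E := Feat d) (innerSL ℝ a)
  rw [variance_eq_integral (by fun_prop), integral_strongDual_stdGaussian,
    innerSL_apply_norm] at h
  simpa using h

theorem memLp_inner_stdGaussian {d : ℕ} (a : Feat d) :
    MemLp (fun x => inner ℝ a x) 2 (stdGaussian (Feat d)) :=
  IsGaussian.memLp_dual (stdGaussian (Feat d)) (innerSL ℝ a) 2 (by norm_num)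

theorem integral_sq_noiseLaw (σ : ℝ) : ∫ x, x ^ 2 ∂(noiseLaw σ) = σ ^ 2 := by
  have h := variance_fun_id_gaussianReal (μ := 0) (v := (σ ^ 2).toNNReal)
  rw [variance_eq_integral (by fun_prop), integral_id_gaussianReal,
    Real.coe_toNNReal _ (sq_nonneg σ)] at h
  simpa [noiseLaw] using h

/-- The effective parameter `u` covers both uses: `u = w` for raw features and `u = R̂ w` for
preprocessed ones. -/
theorem popRisk_population {d : ℕ} (σ : ℝ) (wstar : Feat d) {Φ : Feat d → Feat d} {w u : Feat d}
    (hΦ : Measurable Φ) (h : ∀ x, inner ℝ (Φ x) w = inner ℝ u x) :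
    popRisk (population σ wstar) Φ w = ‖u - wstar‖ ^ 2 + σ ^ 2 := by
  set a := u - wstar with ha
  have hf := memLp_inner_stdGaussian a
  have hg : MemLp (fun x : ℝ => x) 2 (noiseLaw σ) := memLp_id_gaussianReal 2
  rw [popRisk, population, integral_map (by fun_prop) (by fun_prop)]
  have h1 : ∀ p : Feat d × ℝ, (inner ℝ (Φ p.1) w - (inner ℝ wstar p.1 + p.2)) ^ 2 =
      inner ℝ a p.1 ^ 2 + p.2 ^ 2 - 2 * (inner ℝ a p.1 * p.2) := by
    intro p
    rw [h, ha, inner_sub_left]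
    ring
  simp only [h1]
  have i1 : Integrable (fun p : Feat d × ℝ => inner ℝ a p.1 ^ 2)
      ((stdGaussian (Feat d)).prod (noiseLaw σ)) := hf.integrable_sq.comp_fst _
  have i2 : Integrable (fun p : Feat d × ℝ => p.2 ^ 2)
      ((stdGaussian (Feat d)).prod (noiseLaw σ)) := hg.integrable_sq.comp_snd _
  have i3 : Integrable (fun p : Feat d × ℝ => inner ℝ a p.1 * p.2)
      ((stdGaussian (Feat d)).prod (noiseLaw σ)) :=
    (hf.integrable one_le_two).mul_prod (hg.integrable one_le_two)
  have i12 : Integrable (fun p : Feat d × ℝ => inner ℝ a p.1 ^ 2 + p.2 ^ 2)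
      ((stdGaussian (Feat d)).prod (noiseLaw σ)) := i1.add i2
  rw [integral_sub i12 (i3.const_mul 2), integral_add i1 i2, integral_const_mul,
    integral_prod_mul (fun x => inner ℝ a x) (fun y : ℝ => y),
    integral_fun_fst (fun x => inner ℝ a x ^ 2), integral_fun_snd (fun y : ℝ => y ^ 2),
    integral_inner_sq_stdGaussian, integral_sq_noiseLaw,
    show ∫ y, y ∂(noiseLaw σ) = 0 from integral_id_gaussianReal]
  simp

theorem excessRisk_id {d : ℕ} (σ : ℝ) (wstar w : Feat d) :
    excessRisk (population σ wstar) id w = ‖w - wstar‖ ^ 2 := by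
  have h : ∀ w, popRisk (population σ wstar) id w = ‖w - wstar‖ ^ 2 + σ ^ 2 := fun w =>
    popRisk_population σ wstar measurable_id fun x => real_inner_comm _ _
  have hinf : ⨅ w', popRisk (population σ wstar) id w' = σ ^ 2 := by
    apply le_antisymm
    · refine (ciInf_le ⟨σ ^ 2, ?_⟩ wstar).trans (by rw [h]; simp)
      rintro _ ⟨w', rfl⟩
      simp only [h]
      nlinarith [sq_nonneg ‖w' - wstar‖]
    · refine le_ciInf fun w' => ?_
      rw [h]
      nlinarith [sq_nonneg ‖w' - wstar‖]
  rw [excessRisk, hinf, h]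
  ring

theorem inner_preprocess {n d : ℕ} (X : Fin n → Feat d) (y : Fin n → ℝ) (x w : Feat d) :
    inner ℝ (preprocess X y x) w = inner ℝ (preprocess X y w) x := by
  simp only [preprocess, PiLp.inner_apply, RCLike.inner_apply, conj_trivial]
  exact Finset.sum_congr rfl fun i _ => by ring

theorem continuous_preprocess {n d : ℕ} (X : Fin n → Feat d) (y : Fin n → ℝ) :
    Continuous (preprocess X y) := by
  unfold preprocess
  fun_prop

/-- The best preprocessed predictor still pays the noise variance. Only an inequality is available,
since `w⋆` may be out of reach when some `r̂ⱼ` vanishes. -/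
theorem excessRisk_preprocess_le {n d : ℕ} (σ : ℝ) (wstar : Feat d) (X : Fin n → Feat d)
    (y : Fin n → ℝ) (w : Feat d) :
    excessRisk (population σ wstar) (preprocess X y) w ≤ ‖preprocess X y w - wstar‖ ^ 2 := by
  have h : ∀ w, popRisk (population σ wstar) (preprocess X y) w =
      ‖preprocess X y w - wstar‖ ^ 2 + σ ^ 2 := fun w =>
    popRisk_population σ wstar (continuous_preprocess X y).measurable
      fun x => inner_preprocess X y x w
  have hinf : σ ^ 2 ≤ ⨅ w', popRisk (population σ wstar) (preprocess X y) w' := by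
    refine le_ciInf fun w' => ?_
    rw [h]
    nlinarith [sq_nonneg ‖preprocess X y w' - wstar‖]
  rw [excessRisk, h]
  linarith

/-! ### Gradient descent -/

theorem gradient_empLoss {n d : ℕ} (Z : Fin n → Feat d) (y : Fin n → ℝ) (w : Feat d) :
    gradient (empLoss Z y) w = (1 / (n : ℝ)) • ∑ i, (inner ℝ w (Z i) - y i) • Z i := by
  apply HasGradientAt.gradient
  rw [hasGradientAt_iff_hasFDerivAt]
  have h1 : ∀ i, HasFDerivAt (fun w : Feat d => (y i - inner ℝ w (Z i)) ^ 2)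
      ((2 * (y i - inner ℝ w (Z i))) • -(innerSL ℝ (Z i))) w := by
    intro i
    have h2 : HasFDerivAt (fun w : Feat d => y i - inner ℝ w (Z i)) (-(innerSL ℝ (Z i))) w := by
      have h3 := ((innerSL ℝ (Z i)).hasFDerivAt (x := w)).const_sub (y i)
      refine h3.congr_of_eventuallyEq (Filter.Eventually.of_forall fun v => ?_)
      simp [real_inner_comm]
    have h4 := h2.pow 2
    simpa using h4
  have h5 := (HasFDerivAt.fun_sum fun i (_ : i ∈ Finset.univ) => h1 i).const_mul
    (1 / (2 * (n : ℝ)))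
  refine h5.congr_fderiv ?_
  ext v
  simp only [_root_.smul_apply, _root_.sum_apply, smul_eq_mul,
    _root_.neg_apply, innerSL_apply_apply, InnerProductSpace.toDual_apply_apply,
    inner_smul_left, sum_inner, conj_trivial, Finset.mul_sum]
  refine Finset.sum_congr rfl fun i _ => ?_
  by_cases hn : (n : ℝ) = 0
  · simp [hn]
  · field_simp
    ring

theorem gdEstimator_zero {n d : ℕ} (η : ℝ) (Z : Fin n → Feat d) (y : Fin n → ℝ) :
    gdEstimator η 0 Z y = 0 := rfl

theorem gdEstimator_succ {n d : ℕ} (η : ℝ) (t : ℕ) (Z : Fin n → Feat d) (y : Fin n → ℝ) :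
    gdEstimator η (t + 1) Z y = gdEstimator η t Z y -
      η • ((1 / (n : ℝ)) • ∑ i, (inner ℝ (gdEstimator η t Z y) (Z i) - y i) • Z i) := by
  rw [gdEstimator, Function.iterate_succ_apply', gradient_empLoss]
  rfl

/-- Error, in the original coordinates, of gradient descent on the preprocessed examples. -/
noncomputable def preGDError {n d : ℕ} (η : ℝ) (t : ℕ) (wstar : Feat d) (X : Fin n → Feat d)
    (ε : Fin n → ℝ) : Feat d :=
  preprocess X (labels wstar X ε) (preGDEstimator η t X (labels wstar X ε)) - wstar

theorem preGDExcessRisk_le {n d : ℕ} (σ η : ℝ) (t : ℕ) (wstar : Feat d) (X : Fin n → Feat d)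
    (ε : Fin n → ℝ) :
    preGDExcessRisk σ η t wstar X ε ≤ ‖preGDError η t wstar X ε‖ ^ 2 :=
  excessRisk_preprocess_le _ _ _ _ _

theorem preGDError_zero {n d : ℕ} (η : ℝ) (wstar : Feat d) (X : Fin n → Feat d)
    (ε : Fin n → ℝ) : preGDError η 0 wstar X ε = -wstar := by
  ext j
  simp [preGDError, preGDEstimator, gdEstimator_zero, preprocess]

/-- Of the two factors `r̂ⱼ`, one comes from the gradient in the preprocessed features and one from
mapping the parameter back. -/
theorem preGDError_succ_apply {n d : ℕ} (η : ℝ) (t : ℕ) (wstar : Feat d) (X : Fin n → Feat d)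
    (ε : Fin n → ℝ) (j : Fin d) :
    preGDError η (t + 1) wstar X ε j = preGDError η t wstar X ε j -
      η * corr X (labels wstar X ε) j ^ 2 *
        (1 / n * ∑ i, (inner ℝ (preGDError η t wstar X ε) (X i) - ε i) * X i j) := by
  set y := labels wstar X ε with hy
  set v := preGDEstimator η t X y with hv
  have hsucc : preGDEstimator η (t + 1) X y = v - η • ((1 / (n : ℝ)) •
      ∑ i, (inner ℝ v (preprocess X y (X i)) - y i) • preprocess X y (X i)) :=
    gdEstimator_succ η t _ y
  have hin : ∀ i, inner ℝ v (preprocess X y (X i)) - y i =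
      inner ℝ (preGDError η t wstar X ε) (X i) - ε i := by
    intro i
    rw [real_inner_comm, inner_preprocess, preGDError, inner_sub_left, ← hy, ← hv, hy, labels]
    ring
  rw [preGDError, ← hy, hsucc]
  simp only [hin]
  have hj : (preprocess X y (v - η • ((1 / (n : ℝ)) • ∑ i,
      (inner ℝ (preGDError η t wstar X ε) (X i) - ε i) • preprocess X y (X i)))) j =
      corr X y j * (v j - η * (1 / n * ∑ i,
        (inner ℝ (preGDError η t wstar X ε) (X i) - ε i) * (corr X y j * X i j))) := by
    simp [preprocess]
  rw [PiLp.sub_apply, hj]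
  have hj0 : preGDError η t wstar X ε j = corr X y j * v j - wstar j := by
    simp [preGDError, preprocess, hv, hy]
  rw [hj0]
  have hs : ∑ i, (inner ℝ (preGDError η t wstar X ε) (X i) - ε i) * (corr X y j * X i j) =
      corr X y j * ∑ i, (inner ℝ (preGDError η t wstar X ε) (X i) - ε i) * X i j := by
    rw [Finset.mul_sum]
    exact Finset.sum_congr rfl fun i _ => by ring
  rw [hs]
  ring


/-! ### The prior -/

/-- As a finite combination of point masses, the prior integrates every function; expectations over
`w⋆` become finite sums with no measurability conditions. -/
theorem toMeasure_prior {d s : ℕ} (h : s ≤ d) :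
    (prior d s h).toMeasure = ∑ S ∈ Finset.powersetCard s (Finset.univ : Finset (Fin d)),
      ∑ τ : Fin d → Bool, (((d.choose s : ENNReal))⁻¹ * ((2 : ENNReal) ^ d)⁻¹) •
        Measure.dirac (signVector d s S τ) := by
  ext A hA
  rw [prior, PMF.toMeasure_bind_apply _ _ _ hA, tsum_eq_sum (s := Finset.powersetCard s Finset.univ)
    (fun S hS => by rw [PMF.uniformOfFinset_apply_of_notMem _ hS, zero_mul]),
    Measure.finsetSum_apply]
  refine Finset.sum_congr rfl fun S hS => ?_
  rw [PMF.uniformOfFinset_apply_of_mem _ hS, Measure.finsetSum_apply,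
    PMF.toMeasure_map_apply _ _ _ (by fun_prop) hA, PMF.toMeasure_apply_fintype, Finset.mul_sum]
  refine Finset.sum_congr rfl fun τ _ => ?_
  rw [Measure.smul_apply, Measure.dirac_apply' _ hA, Finset.card_powersetCard, Finset.card_univ,
    Fintype.card_fin, smul_eq_mul, mul_assoc]
  congr 1
  by_cases hτ : signVector d s S τ ∈ A
  · rw [Set.indicator_of_mem hτ, Set.indicator_of_mem (by exact hτ)]
    simp
  · rw [Set.indicator_of_notMem hτ, Set.indicator_of_notMem (by exact hτ)]
    simp

theorem prior_ae_signVector {d s : ℕ} (h : s ≤ d) :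
    (prior d s h).toMeasure {w | ¬ ∃ S : Finset (Fin d), ∃ τ, S.card = s ∧ w = signVector d s S τ} =
      0 := by
  rw [toMeasure_prior, Measure.finsetSum_apply]
  refine Finset.sum_eq_zero fun S hS => ?_
  rw [Measure.finsetSum_apply]
  refine Finset.sum_eq_zero fun τ _ => ?_
  rw [Measure.smul_apply, smul_eq_mul]
  refine mul_eq_zero_of_right _ ?_
  rw [Measure.dirac_apply, Set.indicator_of_notMem]
  simp only [Set.mem_ofPred_eq, not_not]
  exact ⟨S, τ, (Finset.mem_powersetCard.1 hS).2, rfl⟩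

theorem integral_prior {d s : ℕ} (h : s ≤ d) (f : Feat d → ℝ) :
    ∫ w, f w ∂(prior d s h).toMeasure =
      ((d.choose s : ℝ)⁻¹ * ((2 : ℝ) ^ d)⁻¹) *
        ∑ S ∈ Finset.powersetCard s (Finset.univ : Finset (Fin d)), ∑ τ : Fin d → Bool,
          f (signVector d s S τ) := by
  have hint : ∀ S τ, Integrable f ((((d.choose s : ENNReal))⁻¹ * ((2 : ENNReal) ^ d)⁻¹) •
        Measure.dirac (signVector d s S τ)) := by
    intro S τ
    refine Integrable.smul_measure (integrable_dirac (by simp)) (ENNReal.mul_ne_top ?_ ?_)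
    · exact ENNReal.inv_ne_top.2 (by exact_mod_cast (Nat.choose_pos h).ne')
    · exact ENNReal.inv_ne_top.2 (by positivity)
  rw [toMeasure_prior, integral_finsetSum_measure fun S _ =>
    integrable_finsetSum_measure.2 fun τ _ => hint S τ, Finset.mul_sum]
  refine Finset.sum_congr rfl fun S hS => ?_
  rw [integral_finsetSum_measure fun τ _ => hint S τ, Finset.mul_sum]
  refine Finset.sum_congr rfl fun τ hτ => ?_
  rw [integral_smul_measure, integral_dirac]
  simp

/-- Flipping the `j`-th sign pairs each term with its opposite. -/
theorem sum_bool_mul_eq_zero {d : ℕ} (j : Fin d) (a : ℝ) (g : (Fin d → Bool) → ℝ)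
    (hg : ∀ τ b, g (Function.update τ j b) = g τ) :
    ∑ τ : Fin d → Bool, (if τ j then a else -a) * g τ = 0 := by
  refine Finset.sum_involution (fun τ _ => Function.update τ j (!τ j)) ?_ ?_ ?_ ?_
  · intro τ _
    rw [hg]
    by_cases h : τ j <;> simp [h]
  · intro τ _ _ heq
    have := congrFun heq j
    simp at this
  · simp
  · simp

theorem sum_signVector_apply {d s : ℕ} (S : Finset (Fin d)) (j : Fin d) :
    ∑ τ : Fin d → Bool, signVector d s S τ j = 0 := by
  by_cases hj : j ∈ S
  · have h := sum_bool_mul_eq_zero j (1 / √(s : ℝ)) (fun _ => 1) (fun _ _ => rfl)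
    simpa [signVector, hj] using h
  · simp [signVector, hj]

theorem sum_signVector_mul {d s : ℕ} (S : Finset (Fin d)) (j k : Fin d) :
    ∑ τ : Fin d → Bool, signVector d s S τ j * signVector d s S τ k =
      if j = k ∧ j ∈ S then 2 ^ d / (s : ℝ) else 0 := by
  by_cases hj : j ∈ S
  · by_cases hjk : j = k
    · subst hjk
      have h : ∀ τ : Fin d → Bool, signVector d s S τ j * signVector d s S τ j = 1 / (s : ℝ) := by
        intro τ
        have h2 : (√(s : ℝ))⁻¹ * (√(s : ℝ))⁻¹ = (s : ℝ)⁻¹ := by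
          rw [← mul_inv, Real.mul_self_sqrt (Nat.cast_nonneg s)]
        by_cases hτ : τ j <;> simp [signVector, hj, hτ, h2]
      simp [h, hj]
      ring
    · have h := sum_bool_mul_eq_zero j (1 / √(s : ℝ)) (fun τ => signVector d s S τ k)
        (fun τ b => by simp [signVector, Function.update_of_ne (Ne.symm hjk)])
      rw [if_neg (by simp [hjk]), ← h]
      exact Finset.sum_congr rfl fun τ _ => by simp [signVector, hj]
  · simp [signVector, hj]

theorem card_filter_mem_powersetCard {d s : ℕ} (hs : 1 ≤ s) (j : Fin d) :
    ((Finset.powersetCard s (Finset.univ : Finset (Fin d))).filter (j ∈ ·)).card =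
      (d - 1).choose (s - 1) := by
  classical
  have h : (Finset.powersetCard s (Finset.univ : Finset (Fin d))).filter (j ∈ ·) =
      (Finset.powersetCard (s - 1) (Finset.univ.erase j)).image (insert j) := by
    ext S
    simp only [Finset.mem_filter, Finset.mem_powersetCard, Finset.subset_univ, true_and,
      Finset.mem_image]
    constructor
    · rintro ⟨hc, hj⟩
      exact ⟨S.erase j, ⟨Finset.erase_subset_erase _ (Finset.subset_univ _),
        by rw [Finset.card_erase_of_mem hj, hc]⟩, Finset.insert_erase hj⟩
    · rintro ⟨T, ⟨hT, hc⟩, rfl⟩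
      have hjT : j ∉ T := fun h => by simpa using hT h
      exact ⟨by rw [Finset.card_insert_of_notMem hjT, hc]; omega, Finset.mem_insert_self _ _⟩
  rw [h, Finset.card_image_of_injOn, Finset.card_powersetCard, Finset.card_erase_of_mem
    (Finset.mem_univ j), Finset.card_univ, Fintype.card_fin]
  intro T hT T' hT' heq
  have hjT : ∀ T : Finset (Fin d), T ∈ Finset.powersetCard (s - 1) (Finset.univ.erase j) → j ∉ T :=
    fun T hT h => by simpa using (Finset.mem_powersetCard.1 hT).1 h
  rw [← Finset.erase_insert (hjT T hT), ← Finset.erase_insert (hjT T' hT')]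
  exact congrArg (fun U => U.erase j) heq

/-- The prior is centred with covariance `I / d`. -/
theorem integral_prior_norm_sq {d s : ℕ} (h : s ≤ d) (hs : 1 ≤ s) {F : Type*}
    [NormedAddCommGroup F] [InnerProductSpace ℝ F] (T : Feat d →ₗ[ℝ] F) (b : F) :
    ∫ w, ‖T w + b‖ ^ 2 ∂(prior d s h).toMeasure =
      (1 / (d : ℝ)) * ∑ j, ‖T (EuclideanSpace.single j 1)‖ ^ 2 + ‖b‖ ^ 2 := by
  set e : Fin d → F := fun j => T (EuclideanSpace.single j 1) with he
  have hT : ∀ w : Feat d, T w = ∑ j, w j • e j := by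
    intro w
    conv_lhs => rw [← (EuclideanSpace.basisFun (Fin d) ℝ).sum_repr w]
    simp [he]
  have hexp : ∀ w : Feat d, ‖T w + b‖ ^ 2 = ∑ j, ∑ k, w j * w k * inner ℝ (e j) (e k) +
      2 * ∑ j, w j * inner ℝ (e j) b + ‖b‖ ^ 2 := by
    intro w
    rw [norm_add_sq_real, hT, ← real_inner_self_eq_norm_sq, sum_inner, sum_inner]
    simp only [inner_sum, inner_smul_left, inner_smul_right, conj_trivial]
    congr 2
    exact Finset.sum_congr rfl fun j _ => Finset.sum_congr rfl fun k _ => by ring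
  have hS : ∀ S : Finset (Fin d), ∑ τ : Fin d → Bool, ‖T (signVector d s S τ) + b‖ ^ 2 =
      2 ^ d / (s : ℝ) * ∑ j, (if j ∈ S then ‖e j‖ ^ 2 else 0) + 2 ^ d * ‖b‖ ^ 2 := by
    intro S
    simp only [hexp, Finset.sum_add_distrib, ← Finset.mul_sum]
    rw [Finset.sum_comm, Finset.sum_comm (s := Finset.univ) (t := Finset.univ)
      (f := fun τ j => signVector d s S τ j * inner ℝ (e j) b)]
    simp only [← Finset.sum_mul, sum_signVector_apply, zero_mul, Finset.sum_const_zero, mul_zero,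
      add_zero]
    congr 1
    · rw [Finset.mul_sum]
      refine Finset.sum_congr rfl fun j _ => ?_
      rw [Finset.sum_comm]
      simp only [← Finset.sum_mul, sum_signVector_mul]
      by_cases hj : j ∈ S <;> simp [hj]
    · simp
  rw [integral_prior]
  simp only [hS]
  -- A coordinate lies in the support with probability `s / d`; this cancels the entry variance `1 /
  -- s` and leaves `1 / d`.
  have hd : d.choose s * s = d * (d - 1).choose (s - 1) := by
    obtain ⟨d', rfl⟩ : ∃ d', d = d' + 1 := ⟨d - 1, by omega⟩
    obtain ⟨s', rfl⟩ : ∃ s', s = s' + 1 := ⟨s - 1, by omega⟩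
    simpa using (Nat.add_one_mul_choose_eq d' s').symm
  have hd' : (d.choose s : ℝ) * s = d * (d - 1).choose (s - 1) := by exact_mod_cast hd
  have hcs : (d.choose s : ℝ) ≠ 0 := by exact_mod_cast (Nat.choose_pos h).ne'
  have hs0 : (s : ℝ) ≠ 0 := by exact_mod_cast (by omega : s ≠ 0)
  have hd0 : (d : ℝ) ≠ 0 := by exact_mod_cast (by omega : d ≠ 0)
  have hsum : ∑ S ∈ Finset.powersetCard s (Finset.univ : Finset (Fin d)),
      ∑ j, (if j ∈ S then ‖e j‖ ^ 2 else 0) = (d - 1).choose (s - 1) * ∑ j, ‖e j‖ ^ 2 := by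
    rw [Finset.sum_comm, Finset.mul_sum]
    refine Finset.sum_congr rfl fun j _ => ?_
    rw [← Finset.sum_filter, Finset.sum_const, card_filter_mem_powersetCard hs, nsmul_eq_mul]
  rw [Finset.sum_add_distrib, ← Finset.mul_sum, hsum, Finset.sum_const, Finset.card_powersetCard,
    Finset.card_univ, Fintype.card_fin, nsmul_eq_mul]
  field_simp
  linear_combination (-∑ j, ‖e j‖ ^ 2) * hd'

theorem norm_signVector {d s : ℕ} (hs : 1 ≤ s) {S : Finset (Fin d)} (hS : S.card = s)
    (τ : Fin d → Bool) : ‖signVector d s S τ‖ ^ 2 = 1 := by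
  rw [EuclideanSpace.real_norm_sq_eq]
  have hs0 : (s : ℝ) ≠ 0 := by exact_mod_cast (by omega : s ≠ 0)
  have h : ∀ j, signVector d s S τ j ^ 2 = if j ∈ S then 1 / (s : ℝ) else 0 := by
    intro j
    by_cases hj : j ∈ S <;> by_cases hτ : τ j <;>
      simp [signVector, hj, hτ, inv_pow, Real.sq_sqrt (Nat.cast_nonneg s)]
  simp [h, hS, hs0]


/-! ### Coordinate restriction -/

/-- The restriction of a vector to a set of coordinates. -/
noncomputable def restr {d : ℕ} (S : Finset (Fin d)) (v : Feat d) : Feat d :=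
  WithLp.toLp 2 fun j => if j ∈ S then v j else 0

section Restr

variable {d : ℕ} (S : Finset (Fin d)) (u v : Feat d)

theorem restr_apply (j : Fin d) : restr S v j = if j ∈ S then v j else 0 := rfl

theorem norm_restr_sq : ‖restr S v‖ ^ 2 = ∑ j ∈ S, v j ^ 2 := by
  rw [EuclideanSpace.real_norm_sq_eq]
  simp [restr_apply, ite_pow]

theorem restr_add : restr S (u + v) = restr S u + restr S v := by
  ext j
  by_cases h : j ∈ S <;> simp [restr_apply, h]

theorem restr_add_restr_compl : restr S v + restr Sᶜ v = v := by
  ext j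
  by_cases h : j ∈ S <;> simp [restr_apply, h]

theorem norm_sq_eq_restr : ‖v‖ ^ 2 = ‖restr S v‖ ^ 2 + ‖restr Sᶜ v‖ ^ 2 := by
  rw [norm_restr_sq, norm_restr_sq, EuclideanSpace.real_norm_sq_eq, Finset.sum_add_sum_compl]

theorem norm_restr_le : ‖restr S v‖ ≤ ‖v‖ := by
  apply le_of_sq_le_sq _ (norm_nonneg v)
  rw [norm_sq_eq_restr S v]
  linarith [sq_nonneg ‖restr Sᶜ v‖]

theorem inner_restr_left : inner ℝ (restr S u) v = inner ℝ (restr S u) (restr S v) := by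
  simp only [PiLp.inner_apply, restr_apply, RCLike.inner_apply, conj_trivial]
  exact Finset.sum_congr rfl fun j _ => by by_cases h : j ∈ S <;> simp [h]

variable {S u v}

theorem norm_restr_le_mul {b : ℝ} (hb : 0 ≤ b) (h : ∀ j ∈ S, |u j| ≤ b * |v j|) :
    ‖restr S u‖ ≤ b * ‖restr S v‖ := by
  apply le_of_sq_le_sq _ (by positivity)
  rw [mul_pow, norm_restr_sq, norm_restr_sq, Finset.mul_sum]
  refine Finset.sum_le_sum fun j hj => ?_
  rw [← sq_abs, ← sq_abs (v j), ← mul_pow]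
  exact pow_le_pow_left₀ (abs_nonneg _) (h j hj) 2

theorem norm_restr_le_sqrt_card_mul {b : ℝ} (hb : 0 ≤ b) (h : ∀ j ∈ S, |v j| ≤ b) :
    ‖restr S v‖ ≤ √(S.card : ℝ) * b := by
  apply le_of_sq_le_sq _ (by positivity)
  rw [mul_pow, norm_restr_sq, Real.sq_sqrt (Nat.cast_nonneg _), ← nsmul_eq_mul, ← Finset.sum_const]
  refine Finset.sum_le_sum fun j hj => ?_
  rw [← sq_abs]
  exact pow_le_pow_left₀ (abs_nonneg _) (h j hj) 2

end Restr

/-! ### Diagonally preconditioned gradient descent -/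

/-- A nearly isotropic covariance operator `A = T† T`: its entries are `κ`-close to those of the
identity, and it has norm at most `G`. -/
structure NearIsotropic {d : ℕ} {F : Type*} [NormedAddCommGroup F] [InnerProductSpace ℝ F]
    (A : Feat d →ₗ[ℝ] Feat d) (T : Feat d →L[ℝ] F) (κ G : ℝ) : Prop where
  inner_eq : ∀ u v, inner ℝ (A u) v = inner ℝ (T u) (T v)
  norm_sq_le : ∀ v, ‖T v‖ ^ 2 ≤ G * ‖v‖ ^ 2
  entry : ∀ j k, |A (EuclideanSpace.single k 1) j - if j = k then 1 else 0| ≤ κ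

namespace NearIsotropic

variable {d : ℕ} {F : Type*} [NormedAddCommGroup F] [InnerProductSpace ℝ F]
  {A : Feat d →ₗ[ℝ] Feat d} {T : Feat d →L[ℝ] F} {κ G : ℝ} (hA : NearIsotropic A T κ G)
  (S : Finset (Fin d))

include hA

theorem abs_sub_apply_le (hκ : 0 ≤ κ) (v : Feat d) (j : Fin d) :
    |A (restr S v) j - restr S v j| ≤ κ * (√(S.card : ℝ) * ‖restr S v‖) := by
  have h1 : A (restr S v) j - restr S v j =
      ∑ k ∈ S, (A (EuclideanSpace.single k 1) j - if j = k then 1 else 0) * v k := by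
    have h2 : restr S v = ∑ k ∈ S, v k • (EuclideanSpace.single k (1 : ℝ) : Feat d) := by
      ext i
      simp [restr_apply, Pi.single_apply]
    simp only [sub_mul, Finset.sum_sub_distrib]
    congr 1
    · rw [h2, map_sum]
      simp [mul_comm]
    · simp [restr_apply]
  rw [h1]
  calc _ ≤ ∑ k ∈ S, κ * |v k| := by
        refine (Finset.abs_sum_le_sum_abs _ _).trans (Finset.sum_le_sum fun k _ => ?_)
        rw [abs_mul]
        exact mul_le_mul_of_nonneg_right (hA.entry j k) (abs_nonneg _)
    _ = κ * ∑ k ∈ S, |v k| := (Finset.mul_sum _ _ _).symm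
    _ ≤ _ := by
        gcongr
        apply le_of_sq_le_sq _ (by positivity)
        rw [mul_pow, Real.sq_sqrt (Nat.cast_nonneg _), norm_restr_sq]
        simpa using sq_sum_le_card_mul_sum_sq (s := S) (f := fun k => |v k|)

/-- On vectors supported in `S` only an `s × s` block of `A - 1` matters; with entries at most `κ`,
its norm is at most `s κ ≤ 1`. -/
theorem norm_sq_restr_le (hκ : 0 ≤ κ) (hs : S.card * κ ≤ 1) (v : Feat d) :
    ‖T (restr S v)‖ ^ 2 ≤ 2 * ‖restr S v‖ ^ 2 := by
  set p := restr S v with hp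
  have h0 : inner ℝ (restr S (A p - p)) p = inner ℝ (A p - p) p :=
    (real_inner_comm _ _).trans ((inner_restr_left S v (A p - p)).symm.trans (real_inner_comm _ _))
  have h1 : ‖T p‖ ^ 2 = ‖p‖ ^ 2 + inner ℝ (restr S (A p - p)) p := by
    rw [h0, ← real_inner_self_eq_norm_sq, ← hA.inner_eq, ← real_inner_self_eq_norm_sq,
      inner_sub_left]
    ring
  have h2 : ‖restr S (A p - p)‖ ≤ √(S.card : ℝ) * (κ * (√(S.card : ℝ) * ‖p‖)) :=
    norm_restr_le_sqrt_card_mul (by positivity) fun j _ => hA.abs_sub_apply_le S hκ v j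
  have h3 : √(S.card : ℝ) * (κ * (√(S.card : ℝ) * ‖p‖)) = S.card * κ * ‖p‖ := by
    linear_combination κ * ‖p‖ * Real.mul_self_sqrt (Nat.cast_nonneg (α := ℝ) (S.card))
  have h4 : ‖restr S (A p - p)‖ ≤ ‖p‖ := by
    rw [h3] at h2
    exact h2.trans (mul_le_of_le_one_left (norm_nonneg _) hs)
  have h5 := real_inner_le_norm (restr S (A p - p)) p
  nlinarith [mul_le_mul_of_nonneg_right h4 (norm_nonneg p)]

/-- In `A = T† T` the factor acting on the support costs only `√2` and the other costs `√G`, better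
than `G` when `G` is large. `norm_restr_apply_le` is the adjoint estimate, so that passing off the
support and back costs `2 G` in all. -/
theorem norm_apply_restr_le (hG : 0 ≤ G) (hκ : 0 ≤ κ) (hs : S.card * κ ≤ 1) (v : Feat d) :
    ‖A (restr S v)‖ ≤ √(2 * G) * ‖restr S v‖ := by
  set p := restr S v with hp
  have h1 : ‖A p‖ ^ 2 ≤ ‖T p‖ * ‖T (A p)‖ := by
    rw [← real_inner_self_eq_norm_sq, hA.inner_eq]
    exact real_inner_le_norm _ _
  have h2 : ‖T p‖ ≤ √2 * ‖p‖ := by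
    apply le_of_sq_le_sq _ (by positivity)
    rw [mul_pow, Real.sq_sqrt zero_le_two]
    exact hA.norm_sq_restr_le S hκ hs v
  have h3 : ‖T (A p)‖ ≤ √G * ‖A p‖ := by
    apply le_of_sq_le_sq _ (by positivity)
    rw [mul_pow, Real.sq_sqrt hG]
    exact hA.norm_sq_le _
  rcases (norm_nonneg (A p)).eq_or_lt with h0 | h0
  · rw [← h0]; positivity
  · refine le_of_mul_le_mul_right ?_ h0
    calc ‖A p‖ * ‖A p‖ = ‖A p‖ ^ 2 := (sq _).symm
      _ ≤ (√2 * ‖p‖) * (√G * ‖A p‖) := h1.trans (by gcongr)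
      _ = _ := by rw [Real.sqrt_mul zero_le_two]; ring

theorem norm_restr_apply_le (hG : 0 ≤ G) (hκ : 0 ≤ κ) (hs : S.card * κ ≤ 1) (q : Feat d) :
    ‖restr S (A q)‖ ≤ √(2 * G) * ‖q‖ := by
  set r := restr S (A q) with hr
  have h1 : ‖r‖ ^ 2 ≤ ‖T q‖ * ‖T r‖ := by
    rw [← real_inner_self_eq_norm_sq, hr, ← inner_restr_left, real_inner_comm, ← hr, hA.inner_eq]
    exact real_inner_le_norm _ _
  have h2 : ‖T r‖ ≤ √2 * ‖r‖ := by
    apply le_of_sq_le_sq _ (by positivity)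
    rw [mul_pow, Real.sq_sqrt zero_le_two]
    exact hA.norm_sq_restr_le S hκ hs _
  have h3 : ‖T q‖ ≤ √G * ‖q‖ := by
    apply le_of_sq_le_sq _ (by positivity)
    rw [mul_pow, Real.sq_sqrt hG]
    exact hA.norm_sq_le _
  rcases (norm_nonneg r).eq_or_lt with h0 | h0
  · rw [← h0]; positivity
  · refine le_of_mul_le_mul_right ?_ h0
    calc ‖r‖ * ‖r‖ = ‖r‖ ^ 2 := (sq _).symm
      _ ≤ (√G * ‖q‖) * (√2 * ‖r‖) := h1.trans (by gcongr)
      _ = _ := by rw [Real.sqrt_mul zero_le_two]; ring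

theorem norm_apply_le (hG : 0 ≤ G) (q : Feat d) : ‖A q‖ ≤ G * ‖q‖ := by
  have h3 : ∀ v, ‖T v‖ ≤ √G * ‖v‖ := by
    intro v
    apply le_of_sq_le_sq _ (by positivity)
    rw [mul_pow, Real.sq_sqrt hG]
    exact hA.norm_sq_le _
  have h1 : ‖A q‖ ^ 2 ≤ ‖T q‖ * ‖T (A q)‖ := by
    rw [← real_inner_self_eq_norm_sq, hA.inner_eq]
    exact real_inner_le_norm _ _
  rcases (norm_nonneg (A q)).eq_or_lt with h0 | h0
  · rw [← h0]; positivity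
  · refine le_of_mul_le_mul_right ?_ h0
    calc ‖A q‖ * ‖A q‖ = ‖A q‖ ^ 2 := (sq _).symm
      _ ≤ (√G * ‖q‖) * (√G * ‖A q‖) := h1.trans (by gcongr <;> exact h3 _)
      _ = _ := by linear_combination ‖q‖ * ‖A q‖ * Real.mul_self_sqrt hG

/-- One step, on the support. -/
theorem norm_restr_step_le (hG : 0 ≤ G) (hκ : 0 ≤ κ) (hs : S.card * κ ≤ 1 / 32) {ν : ℝ}
    (hν : 0 ≤ ν) {D : Fin d → ℝ} (hD : ∀ j ∈ S, 1 / 16 ≤ D j ∧ D j ≤ 1) {ξ e e' : Feat d}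
    (hξ : ∀ j, |ξ j| ≤ ν) (he : ∀ j, e' j = e j - D j * (A e j - ξ j)) :
    ‖restr S e'‖ ≤ (1 - 1 / 32) * ‖restr S e‖ + √(2 * G) * ‖restr Sᶜ e‖ +
      √(S.card : ℝ) * ν := by
  set p := restr S e with hp
  set q := restr Sᶜ e with hq
  -- With `p`, `q` the parts of `e` on and off the support, the new error on the support is `(1 - D)
  -- p - D (A - 1) p - D A q + D ξ`; the first two terms contribute `15/16 + 1/32 = 31/32`.
  set a : Feat d := WithLp.toLp 2 fun j => (1 - D j) * e j with ha
  set b : Feat d := WithLp.toLp 2 fun j => -(D j * (A p j - p j)) with hb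
  set c : Feat d := WithLp.toLp 2 fun j => -(D j * A q j) with hc
  set f : Feat d := WithLp.toLp 2 fun j => D j * ξ j with hf
  have hs1 : S.card * κ ≤ 1 := hs.trans (by norm_num)
  have hdec : restr S e' = restr S a + restr S b + restr S c + restr S f := by
    rw [← restr_add, ← restr_add, ← restr_add]
    ext j
    by_cases hj : j ∈ S
    · have h1 : A e j = A p j + A q j := by
        rw [← PiLp.add_apply, ← map_add, hp, hq, restr_add_restr_compl]
      have h2 : p j = e j := by rw [hp, restr_apply, if_pos hj]
      simp only [restr_apply, hj, if_true, he, h1, ha, hb, hc, hf, PiLp.add_apply, h2]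
      ring
    · simp [restr_apply, hj]
  have h1 : ‖restr S a‖ ≤ (15 / 16) * ‖p‖ := by
    refine norm_restr_le_mul (by norm_num) fun j hj => ?_
    obtain ⟨h, h'⟩ := hD j hj
    simp only [ha, abs_mul]
    gcongr
    rw [abs_le]
    constructor <;> linarith
  have h2 : ‖restr S b‖ ≤ (1 / 32) * ‖p‖ := by
    have h := norm_restr_le_sqrt_card_mul (S := S) (v := b)
      (b := κ * (√(S.card : ℝ) * ‖p‖)) (by positivity) fun j hj => by
        obtain ⟨h, h'⟩ := hD j hj
        simp only [hb, abs_neg, abs_mul]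
        have h3 := hA.abs_sub_apply_le S hκ e j
        rw [abs_of_nonneg (by linarith : 0 ≤ D j)]
        exact (mul_le_of_le_one_left (abs_nonneg _) h').trans h3
    refine h.trans ?_
    have h3 : √(S.card : ℝ) * (κ * (√(S.card : ℝ) * ‖p‖)) = S.card * κ * ‖p‖ := by
      linear_combination κ * ‖p‖ * Real.mul_self_sqrt (Nat.cast_nonneg (α := ℝ) (S.card))
    rw [h3]
    gcongr
  have h3 : ‖restr S c‖ ≤ √(2 * G) * ‖q‖ := by
    have h : ‖restr S c‖ ≤ 1 * ‖restr S (A q)‖ := by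
      refine norm_restr_le_mul zero_le_one fun j hj => ?_
      obtain ⟨h, h'⟩ := hD j hj
      simp only [hc, abs_neg, abs_mul]
      rw [abs_of_nonneg (by linarith : 0 ≤ D j)]
      gcongr
    rw [one_mul] at h
    exact h.trans (hA.norm_restr_apply_le S hG hκ hs1 q)
  have h4 : ‖restr S f‖ ≤ √(S.card : ℝ) * ν := by
    refine norm_restr_le_sqrt_card_mul hν fun j hj => ?_
    obtain ⟨h, h'⟩ := hD j hj
    simp only [hf, abs_mul]
    rw [abs_of_nonneg (by linarith : 0 ≤ D j)]
    exact (mul_le_of_le_one_left (abs_nonneg _) h').trans (hξ j)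
  rw [hdec]
  refine (norm_add_le _ _).trans ?_
  refine (add_le_add_left ((norm_add_le _ _).trans (add_le_add_left (norm_add_le _ _) _)) _).trans ?_
  linarith

/-- One step, off the support. -/
theorem norm_restr_compl_step_le (hG : 0 ≤ G) (hκ : 0 ≤ κ) (hs : S.card * κ ≤ 1) {ν : ℝ}
    (hν : 0 ≤ ν) {ρ : ℝ} (hρ : 0 ≤ ρ) {D : Fin d → ℝ} (hD : ∀ j ∉ S, 0 ≤ D j ∧ D j ≤ ρ)
    {ξ e e' : Feat d} (hξ : ∀ j, |ξ j| ≤ ν) (he : ∀ j, e' j = e j - D j * (A e j - ξ j)) :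
    ‖restr Sᶜ e'‖ ≤ ‖restr Sᶜ e‖ + ρ * (G * ‖restr Sᶜ e‖ +
      min (√(2 * G)) (√(d : ℝ) * √(S.card : ℝ) * κ) * ‖restr S e‖ + √(d : ℝ) * ν) := by
  set p := restr S e with hp
  set q := restr Sᶜ e with hq
  set b : Feat d := WithLp.toLp 2 fun j => -(D j * (A e j - ξ j)) with hb
  have hcard : √((Sᶜ).card : ℝ) ≤ √(d : ℝ) := by
    apply Real.sqrt_le_sqrt
    exact_mod_cast (Finset.card_le_univ _).trans (by simp)
  have hdec : restr Sᶜ e' = q + restr Sᶜ b := by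
    rw [hq, ← restr_add]
    ext j
    by_cases hj : j ∈ Sᶜ <;> simp [restr_apply, hj, he, hb]
    ring
  have h1 : ‖restr Sᶜ b‖ ≤ ρ * ‖restr Sᶜ (A e - ξ)‖ := by
    refine norm_restr_le_mul hρ fun j hj => ?_
    obtain ⟨h, h'⟩ := hD j (Finset.mem_compl.1 hj)
    simp only [hb, abs_neg, abs_mul, PiLp.sub_apply]
    rw [abs_of_nonneg h]
    gcongr
  have h2 : restr Sᶜ (A e - ξ) = restr Sᶜ (A q) + restr Sᶜ (A p) + restr Sᶜ (-ξ) := by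
    rw [← restr_add, ← restr_add, ← map_add, hp, hq, add_comm (restr Sᶜ e),
      restr_add_restr_compl, sub_eq_add_neg]
  have h3 : ‖restr Sᶜ (A q)‖ ≤ G * ‖q‖ := (norm_restr_le _ _).trans (hA.norm_apply_le hG q)
  -- Both bounds are needed later: the operator norm bound for the persistent part of the error on
  -- the support, the entrywise one for its initial transient.
  have h4 : ‖restr Sᶜ (A p)‖ ≤ min (√(2 * G)) (√(d : ℝ) * √(S.card : ℝ) * κ) * ‖p‖ := by
    rw [min_mul_of_nonneg _ _ (norm_nonneg _)]
    refine le_min ((norm_restr_le _ _).trans (hA.norm_apply_restr_le S hG hκ hs e)) ?_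
    have h := norm_restr_le_sqrt_card_mul (S := Sᶜ) (v := A p)
      (b := κ * (√(S.card : ℝ) * ‖p‖)) (by positivity) fun j hj => by
        have h3 := hA.abs_sub_apply_le S hκ e j
        rwa [← hp, show p j = 0 by rw [hp, restr_apply, if_neg (Finset.mem_compl.1 hj)],
          sub_zero] at h3
    refine h.trans ?_
    calc _ ≤ √(d : ℝ) * (κ * (√(S.card : ℝ) * ‖p‖)) := by gcongr
      _ = _ := by ring
  have h5 : ‖restr Sᶜ (-ξ)‖ ≤ √(d : ℝ) * ν := by
    refine (norm_restr_le_sqrt_card_mul hν fun j hj => ?_).trans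
      (mul_le_mul_of_nonneg_right hcard hν)
    simpa using hξ j
  rw [hdec]
  refine (norm_add_le _ _).trans (add_le_add_right (h1.trans ?_) _)
  gcongr
  rw [h2]
  refine (norm_add_le _ _).trans (add_le_add ((norm_add_le _ _).trans (add_le_add h3 h4)) h5)

end NearIsotropic

/-- A two-dimensional comparison principle: `x` contracts up to a perturbation by `z`, and `z` is
almost constant. -/
theorem coupled_recursion_le {x z : ℕ → ℝ} {h g G ρ νS νN : ℝ} {t : ℕ}
    (hh : 0 ≤ h) (hg : 0 ≤ g) (hρ : 0 ≤ ρ) (hS : 0 ≤ νS) (hN : 0 ≤ νN) (hhG : h ^ 2 = 2 * G)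
    (x0 : x 0 ≤ 1) (z0 : z 0 = 0)
    (hxs : ∀ k, x (k + 1) ≤ (1 - 1 / 32) * x k + h * z k + νS)
    (hzs : ∀ k, z (k + 1) ≤ z k + ρ * (G * z k + min h g * x k + νN))
    (ht : t * ρ * G ≤ 1 / 256) {Z : ℝ}
    (hZ : Z = 2 * (t * ρ * (32 * h * νS + νN) + 32 * ρ * g)) :
    x t ≤ (1 - 1 / 32) ^ t + 32 * (h * Z + νS) ∧ z t ≤ Z := by
  have hG : 0 ≤ G := by nlinarith [sq_nonneg h]
  have hZ0 : 0 ≤ Z := by rw [hZ]; positivity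
  -- The fixed point of `x ↦ (31/32) x + h Z + νS`, that is, the floor of `x` as long as `z ≤ Z`.
  set F := 32 * (h * Z + νS) with hF
  have hF0 : 0 ≤ F := by positivity
  -- The transient `(31/32)^k` of `x` is charged at rate `g` and sums to at most `32 ρ g`; the floor
  -- `F` is charged at rate `h`, and `32 h² Z = 64 G Z`. As `t ρ G ≤ 1/256`, feedback uses `65/256`
  -- of `Z`, while the remaining terms are exactly half of `Z`; this closes the induction.
  have key : ∀ k ≤ t, x k ≤ (1 - 1 / 32) ^ k + F ∧
      z k ≤ k * (ρ * (G * Z + h * F + νN)) + ρ * g * (32 * (1 - (1 - 1 / 32) ^ k)) ∧ z k ≤ Z := by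
    intro k
    induction k with
    | zero =>
      intro _
      refine ⟨?_, ?_, ?_⟩
      · rw [pow_zero]; linarith
      · simp [z0]
      · rw [z0]; exact hZ0
    | succ k ih =>
      intro hk
      obtain ⟨h1, h2, h3⟩ := ih (by omega)
      have hpow : 0 ≤ (1 - 1 / 32 : ℝ) ^ k := by positivity
      have h4 : min h g * x k ≤ g * (1 - 1 / 32) ^ k + h * F := by
        rcases le_total h g with hle | hle
        · rw [min_eq_left hle]
          nlinarith [mul_le_mul_of_nonneg_left h1 hh, mul_le_mul_of_nonneg_right hle hpow]
        · rw [min_eq_right hle]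
          nlinarith [mul_le_mul_of_nonneg_left h1 hg, mul_le_mul_of_nonneg_right hle hF0]
      have h5 : z (k + 1) ≤ (k + 1 : ℕ) * (ρ * (G * Z + h * F + νN)) +
          ρ * g * (32 * (1 - (1 - 1 / 32) ^ (k + 1))) := by
        have h6 : ρ * (G * z k + min h g * x k + νN) ≤
            ρ * (G * Z + (g * (1 - 1 / 32) ^ k + h * F) + νN) := by gcongr
        have h7 := hzs k
        rw [pow_succ]
        push_cast
        linarith
      refine ⟨?_, h5, h5.trans ?_⟩
      · have h6 := hxs k
        have h7 : h * z k ≤ h * Z := by gcongr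
        rw [pow_succ]
        rw [hF] at h1 ⊢
        linarith
      · have hkt : ((k + 1 : ℕ) : ℝ) ≤ t := by exact_mod_cast hk
        have hpow' : 0 ≤ (1 - 1 / 32 : ℝ) ^ (k + 1) := by positivity
        have h8 : ρ * g * (32 * (1 - (1 - 1 / 32) ^ (k + 1))) ≤ ρ * g * 32 := by
          gcongr
          linarith
        have h9 : ((k + 1 : ℕ) : ℝ) * (ρ * (G * Z + h * F + νN)) ≤
            t * (ρ * (G * Z + h * F + νN)) := by gcongr
        have h10 : t * (ρ * (G * Z + h * F + νN)) =
            t * ρ * G * Z + 64 * (t * ρ * G * Z) + t * ρ * (32 * h * νS + νN) := by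
          rw [hF]
          linear_combination (32 * t * ρ * Z) * hhG
        have h11 : t * ρ * G * Z ≤ 1 / 256 * Z := by gcongr
        linarith
  exact ⟨(key t le_rfl).1, (key t le_rfl).2.2⟩


/-! ### Preprocess-then-optimize on a regular sample -/

/-- The empirical covariance as a linear map. -/
noncomputable def covMap {n d : ℕ} (X : Fin n → Feat d) : Feat d →ₗ[ℝ] Feat d where
  toFun v := (1 / (n : ℝ)) • ∑ i, inner ℝ v (X i) • X i
  map_add' u v := by simp only [inner_add_left, add_smul, Finset.sum_add_distrib, smul_add]
  map_smul' c v := by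
    simp only [inner_smul_left, conj_trivial, mul_smul, ← Finset.smul_sum, RingHom.id_apply]
    rw [smul_comm]

theorem covMap_apply {n d : ℕ} (X : Fin n → Feat d) (v : Feat d) :
    covMap X v = (1 / (n : ℝ)) • ∑ i, inner ℝ v (X i) • X i := rfl

theorem covMap_apply_apply {n d : ℕ} (X : Fin n → Feat d) (v : Feat d) (j : Fin d) :
    covMap X v j = 1 / n * ∑ i, inner ℝ v (X i) * X i j := by
  simp [covMap_apply]

theorem RegularSample.nearIsotropic {n d : ℕ} {σ κ u : ℝ} {X : Fin n → Feat d} {ε : Fin n → ℝ}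
    (hX : RegularSample σ κ u X ε) (hn : 1 ≤ n) :
    NearIsotropic (covMap X) ((√(n : ℝ))⁻¹ • designCLM X) κ (16 * (n + (2 * d + u)) / n) := by
  have hn0 : (0 : ℝ) < n := by exact_mod_cast hn
  refine ⟨fun w v => ?_, fun v => ?_, fun j k => ?_⟩
  · rw [covMap_apply, inner_smul_left, sum_inner, _root_.smul_apply, _root_.smul_apply,
      inner_smul_left, inner_smul_right, PiLp.inner_apply]
    simp only [designCLM_apply, conj_trivial, inner_smul_left, RCLike.inner_apply]
    rw [← mul_assoc, ← mul_inv, Real.mul_self_sqrt hn0.le, one_div]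
    congr 1
    refine Finset.sum_congr rfl fun i _ => ?_
    rw [real_inner_comm v, mul_comm]
  · rw [_root_.smul_apply, norm_smul, mul_pow, norm_inv, inv_pow, Real.norm_eq_abs, sq_abs,
      Real.sq_sqrt hn0.le, mul_div_assoc, mul_comm (16 : ℝ), div_mul_eq_mul_div, div_mul_eq_mul_div,
      inv_mul_eq_div]
    gcongr
    calc ‖designCLM X v‖ ^ 2 ≤ (‖designCLM X‖ * ‖v‖) ^ 2 := by
          gcongr; exact (designCLM X).le_opNorm v
      _ = ‖designCLM X‖ ^ 2 * ‖v‖ ^ 2 := mul_pow _ _ _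
      _ ≤ _ := by
          gcongr
          linarith [hX.op]
  · have h := hX.cov j k
    have h1 : covMap X (EuclideanSpace.single k 1) j - (if j = k then 1 else 0) =
        1 / n * (∑ i, X i j * X i k - if j = k then (n : ℝ) else 0) := by
      rw [covMap_apply_apply, mul_sub]
      congr 1
      · congr 1
        exact Finset.sum_congr rfl fun i _ => by
          rw [EuclideanSpace.inner_single_left, map_one, one_mul, mul_comm]
      · split_ifs
        · field_simp
        · simp
    rw [h1, abs_mul, abs_of_pos (by positivity)]
    calc _ ≤ 1 / n * (n * κ) := by gcongr
      _ = κ := by field_simp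

/-- Hypothesis `h2` keeps each `r̂ⱼ` on the support within half of `±1/√s`, so the step size `s/4`
puts `Dⱼ` between `1/16` and `9/16`. Off the support `w⋆ⱼ = 0`, so `r̂ⱼ` is pure deviation and `Dⱼ ≤
ρ`. -/
theorem norm_preGDError_sq_le {n d s t : ℕ} {σ κ u ρ G Z : ℝ} {X : Fin n → Feat d} {ε : Fin n → ℝ}
    (hX : RegularSample σ κ u X ε) (hn : 1 ≤ n) (hs : 1 ≤ s) (hσ : 0 < σ) (hκ : 0 ≤ κ)
    (hu : 0 ≤ u) {S : Finset (Fin d)} (hS : S.card = s) (τ : Fin d → Bool)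
    (h1 : s * κ ≤ 1 / 32) (h2 : (√(s : ℝ) + σ) * κ ≤ 1 / (2 * √(s : ℝ)))
    (hρ : ρ = s / 4 * ((√(s : ℝ) + σ) * κ) ^ 2) (hG : G = 16 * (n + (2 * d + u)) / n)
    (ht : t * ρ * G ≤ 1 / 256)
    (hZ : Z = 2 * (t * ρ * (32 * √(2 * G) * (√(s : ℝ) * (σ * κ)) + √(d : ℝ) * (σ * κ)) +
      32 * ρ * (√(d : ℝ) * √(s : ℝ) * κ))) :
    ‖preGDError (s / 4) t (signVector d s S τ) X ε‖ ^ 2 ≤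
      ((1 - 1 / 32) ^ t + 32 * (√(2 * G) * Z + √(s : ℝ) * (σ * κ))) ^ 2 + Z ^ 2 := by
  set w := signVector d s S τ with hw
  set ξ : Feat d := WithLp.toLp 2 fun j => 1 / (n : ℝ) * ∑ i, ε i * X i j with hξ
  have hn0 : (0 : ℝ) < n := by exact_mod_cast hn
  have hs0 : (0 : ℝ) < s := by exact_mod_cast hs
  have hr0 : 0 < √(s : ℝ) := Real.sqrt_pos.2 hs0
  have hrr : √(s : ℝ) * √(s : ℝ) = s := Real.mul_self_sqrt hs0.le
  have hA := hX.nearIsotropic hn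
  rw [← hG] at hA
  have hG0 : 0 ≤ G := by rw [hG]; positivity
  have hρ0 : 0 ≤ ρ := by rw [hρ]; positivity
  have hξle : ∀ j, |ξ j| ≤ σ * κ := by
    intro j
    have h := hX.noise j
    simp only [hξ, abs_mul]
    rw [abs_of_pos (by positivity : 0 < 1 / (n : ℝ))]
    simp_rw [mul_comm (ε _)]
    calc _ ≤ 1 / (n : ℝ) * (n * σ * κ) := by gcongr
      _ = _ := by field_simp
  have hwS : restr S w = w := by
    ext j
    by_cases hj : j ∈ S <;> simp [restr_apply, hw, signVector, hj]
  have hw1 : ‖w‖ = 1 := by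
    have := norm_signVector hs hS τ
    rwa [← hw, pow_eq_one_iff_of_nonneg (norm_nonneg w) two_ne_zero] at this
  have hcorr : ∀ j, corr X (labels w X ε) j = covMap X w j + ξ j := by
    intro j
    rw [covMap_apply_apply, corr]
    simp only [hξ, labels]
    rw [← mul_add, ← Finset.sum_add_distrib]
    congr 1
    exact Finset.sum_congr rfl fun i _ => by ring
  have hdev : ∀ j, |corr X (labels w X ε) j - w j| ≤ (√(s : ℝ) + σ) * κ := by
    intro j
    have h := hA.abs_sub_apply_le S hκ w j
    rw [hwS, hw1, hS, mul_one] at h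
    rw [hcorr, add_sub_right_comm]
    calc _ ≤ κ * √(s : ℝ) + σ * κ := (abs_add_le _ _).trans (add_le_add h (hξle j))
      _ = _ := by ring
  set D : Fin d → ℝ := fun j => s / 4 * corr X (labels w X ε) j ^ 2 with hD
  have hDS : ∀ j ∈ S, 1 / 16 ≤ D j ∧ D j ≤ 1 := by
    intro j hj
    have h := abs_le.1 ((hdev j).trans h2)
    set r := corr X (labels w X ε) j with hr
    have hinv : 1 / (2 * √(s : ℝ)) = (√(s : ℝ))⁻¹ / 2 := by rw [one_div, mul_inv]; ring
    rw [hinv] at h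
    have hri : 0 < (√(s : ℝ))⁻¹ := by positivity
    have hsi : (s : ℝ) * ((√(s : ℝ))⁻¹ * (√(s : ℝ))⁻¹) = 1 := by
      rw [← mul_inv, hrr]; field_simp
    have hlow : ((√(s : ℝ))⁻¹ / 2) ^ 2 ≤ r ^ 2 ∧ r ^ 2 ≤ ((√(s : ℝ))⁻¹ * 3 / 2) ^ 2 := by
      by_cases hτ : τ j
      · have hwj : w j = (√(s : ℝ))⁻¹ := by simp [hw, signVector, hj, hτ]
        rw [hwj] at h
        constructor <;> apply pow_le_pow_left₀ <;> linarith [h.1, h.2]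
      · have hwj : w j = -(√(s : ℝ))⁻¹ := by simp [hw, signVector, hj, hτ]
        rw [hwj] at h
        rw [← neg_sq r]
        constructor <;> apply pow_le_pow_left₀ <;> linarith [h.1, h.2]
    have hDj : D j = s / 4 * r ^ 2 := rfl
    have hl := mul_le_mul_of_nonneg_left hlow.1 (by positivity : 0 ≤ (s : ℝ) / 4)
    have hr' := mul_le_mul_of_nonneg_left hlow.2 (by positivity : 0 ≤ (s : ℝ) / 4)
    have e1 : (s : ℝ) / 4 * ((√(s : ℝ))⁻¹ / 2) ^ 2 = 1 / 16 := by linear_combination hsi / 16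
    have e2 : (s : ℝ) / 4 * ((√(s : ℝ))⁻¹ * 3 / 2) ^ 2 = 9 / 16 := by
      linear_combination 9 * hsi / 16
    rw [hDj]
    constructor <;> linarith
  have hDc : ∀ j ∉ S, 0 ≤ D j ∧ D j ≤ ρ := by
    intro j hj
    refine ⟨by simp only [hD]; positivity, ?_⟩
    have h := hdev j
    have hwj : w j = 0 := by simp [hw, signVector, hj]
    rw [hwj, sub_zero] at h
    simp only [hD]
    rw [hρ, ← sq_abs (corr _ _ _)]
    gcongr
  set e : ℕ → Feat d := fun k => preGDError (s / 4) k w X ε with he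
  have hstep : ∀ k j, e (k + 1) j = e k j - D j * (covMap X (e k) j - ξ j) := by
    intro k j
    simp only [he]
    rw [preGDError_succ_apply, covMap_apply_apply]
    simp only [hξ, hD]
    rw [← mul_sub, ← Finset.sum_sub_distrib]
    simp only [sub_mul]
  have hSκ : S.card * κ ≤ 1 / 32 := by rw [hS]; exact h1
  have hmain := coupled_recursion_le (x := fun k => ‖restr S (e k)‖)
    (z := fun k => ‖restr Sᶜ (e k)‖) (h := √(2 * G)) (g := √(d : ℝ) * √(s : ℝ) * κ) (G := G)
    (ρ := ρ) (νS := √(s : ℝ) * (σ * κ)) (νN := √(d : ℝ) * (σ * κ)) (t := t) (Z := Z)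
    (by positivity) (by positivity) hρ0 (by positivity) (by positivity)
    (Real.sq_sqrt (by positivity)) ?_ ?_ ?_ ?_ ht hZ
  · rw [norm_sq_eq_restr S]
    obtain ⟨ha, hb⟩ := hmain
    exact add_le_add (pow_le_pow_left₀ (norm_nonneg _) ha 2)
      (pow_le_pow_left₀ (norm_nonneg _) hb 2)
  · have : e 0 = -w := preGDError_zero _ _ _ _
    refine (norm_restr_le S _).trans ?_
    rw [this, norm_neg, hw1]
  · have : e 0 = -w := preGDError_zero _ _ _ _
    rw [← sq_eq_zero_iff, norm_restr_sq]
    refine Finset.sum_eq_zero fun j hj => ?_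
    simp [this, hw, signVector, Finset.mem_compl.1 hj]
  · intro k
    have h := hA.norm_restr_step_le S hG0 hκ hSκ (by positivity) hDS hξle (hstep k)
    rw [hS] at h
    exact h
  · intro k
    have h := hA.norm_restr_compl_step_le S hG0 hκ (hSκ.trans (by norm_num)) (by positivity) hρ0
      hDc hξle (hstep k)
    rw [hS] at h
    exact h

/-! ### Scalar estimates for the rate. -/

theorem sq_add_add_le (a b c : ℝ) : (a + b + c) ^ 2 ≤ 3 * (a ^ 2 + b ^ 2 + c ^ 2) := by
  nlinarith [sq_nonneg (a - b), sq_nonneg (a - c), sq_nonneg (b - c)]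

/-- Size of the operator norm proxy `G` and of the sample size. -/
theorem opNorm_proxy_le {n d s t L σ G : ℝ} (hn : 1 ≤ n) (hs : 1 ≤ s) (ht : 1 ≤ t)
    (hsd : s ≤ d) (hL : 1 / 2 ≤ L) (hG : G = 16 * (n + (2 * d + 2 * L)) / n)
    (H1 : t * s ^ 2 * (1 + σ ^ 2) * L ≤ n / 600000) :
    0 ≤ G ∧ G ≤ 48 * (1 + d / n) ∧ s ≤ n := by
  have hn0 : 0 < n := by linarith
  have hs0 : 0 < s := by linarith
  have hd0 : 0 < d := by linarith
  have hL0 : 0 < L := by linarith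
  have hτ : 1 ≤ 1 + σ ^ 2 := le_add_of_nonneg_right (sq_nonneg σ)
  have hs2 : s ≤ s ^ 2 := le_self_pow₀ hs two_ne_zero
  have hbase : s ^ 2 * L ≤ n / 600000 := by
    refine le_trans ?_ H1
    calc s ^ 2 * L = 1 * s ^ 2 * 1 * L := by ring
      _ ≤ _ := by gcongr
  have hLn : L ≤ n := by
    have := mul_le_mul_of_nonneg_right (hs.trans hs2) hL0.le
    linarith
  have hsn : s ≤ n := by
    have := mul_le_mul_of_nonneg_left hL (sq_nonneg s)
    linarith
  set W := 1 + d / n with hW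
  have hW0 : 0 < W := by positivity
  have hGW : G ≤ 48 * W := by
    have : G = 16 + 32 * (d / n) + 32 * (L / n) := by rw [hG]; field_simp; ring
    have h2 : L / n ≤ 1 := (div_le_one hn0).2 hLn
    rw [this, hW]
    have : 0 ≤ d / n := by positivity
    linarith
  have hG0 : 0 ≤ G := by rw [hG]; positivity
  exact ⟨hG0, hGW, hsn⟩

theorem off_support_step_le {n s L σ κ : ℝ} (hs : 1 ≤ s) (hκ : κ ^ 2 = 48 * L / n) :
    s / 4 * ((√s + σ) * κ) ^ 2 ≤ 24 * s ^ 2 * (1 + σ ^ 2) * L / n := by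
  have hs0 : 0 < s := by linarith
  have hss : √s ^ 2 = s := Real.sq_sqrt hs0.le
  have h1 : (√s + σ) ^ 2 ≤ 2 * s * (1 + σ ^ 2) := by
    have h2 := mul_le_mul_of_nonneg_right hs (sq_nonneg σ)
    have h3 := sq_nonneg (√s - σ)
    rw [sub_sq] at h3
    rw [add_sq]
    linarith
  calc s / 4 * ((√s + σ) * κ) ^ 2 = s / 4 * ((√s + σ) ^ 2 * κ ^ 2) := by rw [mul_pow]
    _ ≤ s / 4 * ((2 * s * (1 + σ ^ 2)) * κ ^ 2) := by gcongr
    _ = _ := by rw [hκ]; ring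

/-- All terms of `Z²` are dominated by a multiple of `ρ² κ² d · s t² (1 + σ²)`. With `ρ` of order
`s² (1 + σ²) L / n` this is `σ² s L² / n` times the ratio that `H3` bounds by one. -/
theorem off_support_bound {n d s t L σ κ ρ G Z : ℝ} (hn : 1 ≤ n) (hs : 1 ≤ s) (ht : 1 ≤ t)
    (hsd : s ≤ d) (hL : 1 / 2 ≤ L) (hσ : 0 < σ) (hκ : κ ^ 2 = 48 * L / n)
    (hρ : ρ = s / 4 * ((√s + σ) * κ) ^ 2) (hG0 : 0 ≤ G) (hGW : G ≤ 48 * (1 + d / n)) (hsn : s ≤ n)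
    (hZ : Z = 2 * (t * ρ * (32 * √(2 * G) * (√s * (σ * κ)) + √d * (σ * κ)) +
      32 * ρ * (√d * √s * κ)))
    (H3 : s ^ 4 * L * d * t ^ 2 * ((1 + σ ^ 2) ^ 3 / σ ^ 2) ≤ n ^ 2) :
    Z ^ 2 ≤ 12 * 196609 * 576 * 48 * (σ ^ 2 * (s * L ^ 2 / n)) := by
  have hn0 : 0 < n := by linarith
  have hs0 : 0 < s := by linarith
  have hd0 : 0 < d := by linarith
  have hL0 : 0 < L := by linarith
  have hh : √(2 * G) ^ 2 = 2 * G := Real.sq_sqrt (by positivity)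
  have hss : √s ^ 2 = s := Real.sq_sqrt hs0.le
  have hdd : √d ^ 2 = d := Real.sq_sqrt hd0.le
  have hρ0 : 0 ≤ ρ := by rw [hρ]; positivity
  have hρle : ρ ≤ 24 * s ^ 2 * (1 + σ ^ 2) * L / n := hρ ▸ off_support_step_le hs hκ
  have hZ1 : Z ^ 2 ≤ 12 * (1024 * (t * ρ) ^ 2 * (2 * G) * (s * (σ ^ 2 * κ ^ 2)) +
      (t * ρ) ^ 2 * (d * (σ ^ 2 * κ ^ 2)) + 1024 * ρ ^ 2 * (d * s * κ ^ 2)) := by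
    set a := t * ρ * (32 * √(2 * G) * (√s * (σ * κ))) with ha
    set b := t * ρ * (√d * (σ * κ)) with hb
    set c := 32 * ρ * (√d * √s * κ) with hc
    have hZ' : Z = 2 * (a + b + c) := by rw [hZ]; ring
    have ha2 : a ^ 2 = 1024 * (t * ρ) ^ 2 * (2 * G) * (s * (σ ^ 2 * κ ^ 2)) := by
      rw [ha]
      simp only [mul_pow, hh, hss]
      ring
    have hb2 : b ^ 2 = (t * ρ) ^ 2 * (d * (σ ^ 2 * κ ^ 2)) := by
      rw [hb]
      simp only [mul_pow, hdd]
    have hc2 : c ^ 2 = 1024 * ρ ^ 2 * (d * s * κ ^ 2) := by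
      rw [hc]
      simp only [mul_pow, hdd, hss]
      ring
    rw [← ha2, ← hb2, ← hc2, hZ', mul_pow]
    linarith [sq_add_add_le a b c]
  have hGs : 2 * G * s ≤ 192 * d := by
    have h1 : d / n * s ≤ d := by
      rw [div_mul_eq_mul_div, div_le_iff₀ hn0]
      gcongr
    have h2 : G * s ≤ 48 * (1 + d / n) * s := by gcongr
    have h3 : 48 * (1 + d / n) * s = 48 * s + 48 * (d / n * s) := by ring
    linarith
  have hZ2 : Z ^ 2 ≤ 12 * 196609 * (ρ ^ 2 * κ ^ 2 * d * (s * t ^ 2 * (1 + σ ^ 2))) := by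
    have h1 : 1024 * (t * ρ) ^ 2 * (2 * G) * (s * (σ ^ 2 * κ ^ 2)) ≤
        1024 * 192 * (ρ ^ 2 * κ ^ 2 * d * (t ^ 2 * σ ^ 2)) := by
      have := mul_le_mul_of_nonneg_left hGs
        (by positivity : 0 ≤ 1024 * (t * ρ) ^ 2 * (σ ^ 2 * κ ^ 2))
      linarith
    have h2 : t ^ 2 * σ ^ 2 + s ≤ s * t ^ 2 * (1 + σ ^ 2) := by
      have ht2 : 1 ≤ t ^ 2 := one_le_pow₀ ht
      have h3 := mul_le_mul_of_nonneg_left ht2 hs0.le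
      have h4 := mul_le_mul_of_nonneg_right hs (by positivity : 0 ≤ t ^ 2 * σ ^ 2)
      linarith
    have h3 := mul_le_mul_of_nonneg_left h2 (by positivity : 0 ≤ ρ ^ 2 * κ ^ 2 * d)
    have h4 : 0 ≤ ρ ^ 2 * κ ^ 2 * d * s := by positivity
    have h5 : 12 * (1024 * (t * ρ) ^ 2 * (2 * G) * (s * (σ ^ 2 * κ ^ 2)) +
        (t * ρ) ^ 2 * (d * (σ ^ 2 * κ ^ 2)) + 1024 * ρ ^ 2 * (d * s * κ ^ 2)) ≤
        12 * 196609 * (ρ ^ 2 * κ ^ 2 * d * (t ^ 2 * σ ^ 2 + s)) := by linarith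
    exact hZ1.trans (h5.trans (mul_le_mul_of_nonneg_left h3 (by norm_num)))
  have h1 : ρ ^ 2 * κ ^ 2 * d * (s * t ^ 2 * (1 + σ ^ 2)) ≤
      (24 * s ^ 2 * (1 + σ ^ 2) * L / n) ^ 2 * κ ^ 2 * d * (s * t ^ 2 * (1 + σ ^ 2)) := by
    gcongr
  have h2 : (24 * s ^ 2 * (1 + σ ^ 2) * L / n) ^ 2 * κ ^ 2 * d * (s * t ^ 2 * (1 + σ ^ 2)) =
      576 * 48 * (σ ^ 2 * (s * L ^ 2 / n)) *
        (s ^ 4 * L * d * t ^ 2 * ((1 + σ ^ 2) ^ 3 / σ ^ 2) / n ^ 2) := by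
    rw [hκ]
    field_simp
    norm_num
  have h3 : s ^ 4 * L * d * t ^ 2 * ((1 + σ ^ 2) ^ 3 / σ ^ 2) / n ^ 2 ≤ 1 :=
    (div_le_one (by positivity)).2 H3
  have h4 := mul_le_mul_of_nonneg_left h3 (by positivity : 0 ≤ 576 * 48 * (σ ^ 2 * (s * L ^ 2 / n)))
  linarith

/-- The scalar estimate turning the recursion bound into the rate. -/
theorem rate_bound {n d s t L σ κ ρ G Z E : ℝ} (hn : 1 ≤ n) (hs : 1 ≤ s) (ht : 1 ≤ t)
    (hsd : s ≤ d) (hL : 1 / 2 ≤ L) (hσ : 0 < σ) (hκ : κ ^ 2 = 48 * L / n)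
    (hρ : ρ = s / 4 * ((√s + σ) * κ) ^ 2) (hG : G = 16 * (n + (2 * d + 2 * L)) / n)
    (hZ : Z = 2 * (t * ρ * (32 * √(2 * G) * (√s * (σ * κ)) + √d * (σ * κ)) +
      32 * ρ * (√d * √s * κ)))
    (hE : E ^ 2 ≤ σ ^ 2 / (n * s))
    (H1 : t * s ^ 2 * (1 + σ ^ 2) * L ≤ n / 600000)
    (H3 : s ^ 4 * L * d * t ^ 2 * ((1 + σ ^ 2) ^ 3 / σ ^ 2) ≤ n ^ 2) :
    (E + 32 * (√(2 * G) * Z + √s * (σ * κ))) ^ 2 + Z ^ 2 ≤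
      10 ^ 17 * (σ ^ 2 * L ^ 2 * (s / n + d * s ^ 2 / n ^ 2)) := by
  obtain ⟨hG0, hGW, hsn⟩ := opNorm_proxy_le hn hs ht hsd hL hG H1
  have hZ3 := off_support_bound hn hs ht hsd hL hσ hκ hρ hG0 hGW hsn hZ H3
  have hn0 : 0 < n := by linarith
  have hs0 : 0 < s := by linarith
  have hd0 : 0 < d := by linarith
  have hL0 : 0 < L := by linarith
  have hs2 : s ≤ s ^ 2 := le_self_pow₀ hs two_ne_zero
  have hh : √(2 * G) ^ 2 = 2 * G := Real.sq_sqrt (by positivity)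
  have hss : √s ^ 2 = s := Real.sq_sqrt hs0.le
  set W := 1 + d / n with hW
  have hW0 : 0 < W := by positivity
  set R := s * L ^ 2 / n with hR
  have hR0 : 0 < R := by positivity
  set Q := σ ^ 2 * L ^ 2 * (s / n + d * s ^ 2 / n ^ 2) with hQ
  -- The coupling back to the support multiplies `Z²` by `2 G ≤ 96 W`. This is the source of the
  -- `d/n²` term of the rate; one factor `s` is given away.
  have hWR : W * (σ ^ 2 * R) ≤ Q := by
    have : W * (σ ^ 2 * R) = σ ^ 2 * L ^ 2 * (s / n + d * s / n ^ 2) := by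
      rw [hW, hR]; field_simp
    rw [this, hQ]
    gcongr
  have hRQ : σ ^ 2 * R ≤ Q := by
    refine le_trans ?_ hWR
    have : 1 ≤ W := by rw [hW]; linarith [div_pos hd0 hn0]
    exact le_mul_of_one_le_left (by positivity) this
  have hE1 : E ^ 2 ≤ 4 * (σ ^ 2 * R) := by
    refine hE.trans ?_
    rw [hR, div_le_iff₀ (by positivity)]
    have : 4 * (σ ^ 2 * (s * L ^ 2 / n)) * (n * s) = σ ^ 2 * (4 * L ^ 2 * s ^ 2) := by field_simp
    rw [this]
    refine le_mul_of_one_le_right (sq_nonneg σ) (one_le_mul_of_one_le_of_one_le ?_ (one_le_pow₀ hs))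
    have := pow_le_pow_left₀ (by norm_num) hL 2
    linarith
  have hν : (√s * (σ * κ)) ^ 2 ≤ 96 * (σ ^ 2 * R) := by
    have h1 : (√s * (σ * κ)) ^ 2 = 48 * σ ^ 2 * (s / n) * L := by
      rw [mul_pow, mul_pow, hss, hκ]; ring
    have h2 : 96 * (σ ^ 2 * R) = 48 * σ ^ 2 * (s / n) * (2 * L ^ 2) := by rw [hR]; ring
    rw [h1, h2]
    refine mul_le_mul_of_nonneg_left ?_ (by positivity)
    have := mul_le_mul_of_nonneg_right hL hL0.le
    linarith
  have hhZ : (√(2 * G) * Z) ^ 2 ≤ 96 * (12 * 196609 * 576 * 48 * Q) := by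
    rw [mul_pow, hh]
    calc 2 * G * Z ^ 2 ≤ 2 * (48 * W) * (12 * 196609 * 576 * 48 * (σ ^ 2 * R)) := by gcongr
      _ = 96 * (12 * 196609 * 576 * 48 * (W * (σ ^ 2 * R))) := by ring
      _ ≤ _ := by gcongr
  have hfin : (E + 32 * (√(2 * G) * Z + √s * (σ * κ))) ^ 2 ≤
      3 * E ^ 2 + 3072 * (√(2 * G) * Z) ^ 2 + 3072 * (√s * (σ * κ)) ^ 2 := by
    have h := sq_add_add_le E (32 * (√(2 * G) * Z)) (32 * (√s * (σ * κ)))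
    rw [mul_pow 32, mul_pow 32] at h
    rw [mul_add, ← add_assoc]
    linarith
  have hQ0 : 0 ≤ Q := le_trans (by positivity) hRQ
  linarith


/-! ### The upper bound -/

/-- Joint continuity yields measurability in the sample and the limit of vanishing step size. -/
theorem continuous_preGDError (n d t : ℕ) :
    Continuous fun p : ℝ × Feat d × (Fin n → Feat d) × (Fin n → ℝ) =>
      preGDError p.1 t p.2.1 p.2.2.1 p.2.2.2 := by
  induction t with
  | zero =>
    simp only [preGDError_zero]
    fun_prop
  | succ t ih =>
    have hj : ∀ j, Continuous fun p : ℝ × Feat d × (Fin n → Feat d) × (Fin n → ℝ) =>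
        preGDError p.1 (t + 1) p.2.1 p.2.2.1 p.2.2.2 j := by
      intro j
      simp only [preGDError_succ_apply, corr, labels]
      fun_prop
    have := (PiLp.continuous_toLp 2 (fun _ : Fin d => ℝ)).comp (continuous_pi hj)
    exact this

theorem preGDError_stepsize_zero {n d : ℕ} (t : ℕ) (wstar : Feat d) (X : Fin n → Feat d)
    (ε : Fin n → ℝ) : preGDError 0 t wstar X ε = -wstar := by
  induction t with
  | zero => exact preGDError_zero _ _ _ _
  | succ t ih =>
    ext j
    rw [preGDError_succ_apply, ih]
    simp

/-- The regularity event does not involve `w⋆`, so one event `B` handles all sign vectors at once;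
neither set needs to be measurable. -/
theorem measure_prod_le_of_signVector {n d s : ℕ} (hsd : s ≤ d) (σ : ℝ)
    {A : Set (Feat d × (Fin n → Feat d) × (Fin n → ℝ))}
    {B : Set ((Fin n → Feat d) × (Fin n → ℝ))}
    (h : ∀ (S : Finset (Fin d)) (τ : Fin d → Bool) ω, S.card = s → (signVector d s S τ, ω) ∈ A →
      ω ∈ B) :
    ((prior d s hsd).toMeasure.prod (sampleLaw n d σ)) A ≤ sampleLaw n d σ B := by
  have hsub : A ⊆ {w | ¬ ∃ S : Finset (Fin d), ∃ τ, S.card = s ∧ w = signVector d s S τ} ×ˢ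
      Set.univ ∪ Set.univ ×ˢ B := by
    rintro ⟨w, ω⟩ hω
    by_cases hw : ∃ S : Finset (Fin d), ∃ τ, S.card = s ∧ w = signVector d s S τ
    · obtain ⟨S, τ, hS, rfl⟩ := hw
      exact Or.inr ⟨trivial, h S τ ω hS hω⟩
    · exact Or.inl ⟨hw, trivial⟩
  refine (measure_mono hsub).trans ((measure_union_le _ _).trans ?_)
  rw [Measure.prod_prod, Measure.prod_prod, prior_ae_signVector]
  simp

/-- As the step size tends to `0`, the error tends pointwise to `-w⋆`, of norm one, hence also in
measure. The step size found is not explicit. -/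
theorem exists_stepsize_le_two {n d s : ℕ} (t : ℕ) (hsd : s ≤ d) (hs : 1 ≤ s) (σ : ℝ) {δ : ℝ}
    (hδ : 0 < δ) : ∃ η : ℝ, 0 < η ∧
      ((prior d s hsd).toMeasure.prod (sampleLaw n d σ))
        {ω | ¬ preGDExcessRisk σ η t ω.1 ω.2.1 ω.2.2 ≤ 2} ≤ ENNReal.ofReal δ := by
  set μ := (prior d s hsd).toMeasure.prod (sampleLaw n d σ) with hμ
  set f : ℕ → Feat d × (Fin n → Feat d) × (Fin n → ℝ) → ℝ := fun k ω =>
    ‖preGDError (1 / ((k : ℝ) + 1)) t ω.1 ω.2.1 ω.2.2‖ ^ 2 with hf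
  have hmeas : ∀ k, AEStronglyMeasurable (f k) μ := fun k => by
    have h := (continuous_preGDError n d t).comp
      (continuous_const.prodMk continuous_id : Continuous fun
        ω : Feat d × (Fin n → Feat d) × (Fin n → ℝ) => ((1 / ((k : ℝ) + 1) : ℝ), ω))
    exact (h.norm.pow 2).aestronglyMeasurable
  have hlim : ∀ ω, Filter.Tendsto (fun k => f k ω) Filter.atTop (nhds (‖ω.1‖ ^ 2)) := by
    intro ω
    have h := (continuous_preGDError n d t).comp
      (continuous_id.prodMk continuous_const : Continuous fun η : ℝ => (η, ω))
    have h0 := ((h.norm.pow 2).tendsto 0).comp (tendsto_one_div_add_atTop_nhds_zero_nat (𝕜 := ℝ))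
    have h1 : ‖ω.1‖ ^ 2 = ‖preGDError 0 t ω.1 ω.2.1 ω.2.2‖ ^ 2 := by
      rw [preGDError_stepsize_zero, norm_neg]
    rw [h1]
    exact h0
  have hin := tendstoInMeasure_of_tendsto_ae hmeas (ae_of_all μ hlim) 1 one_pos
  obtain ⟨k, hk⟩ := (hin.eventually_lt_const (ENNReal.ofReal_pos.2 hδ)).exists
  refine ⟨1 / ((k : ℝ) + 1), by positivity, ?_⟩
  set N : Set (Feat d) := {w | ¬ ∃ S : Finset (Fin d), ∃ τ, S.card = s ∧ w = signVector d s S τ}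
  have hsub : {ω : Feat d × (Fin n → Feat d) × (Fin n → ℝ) |
      ¬ preGDExcessRisk σ (1 / ((k : ℝ) + 1)) t ω.1 ω.2.1 ω.2.2 ≤ 2} ⊆
      N ×ˢ Set.univ ∪ {ω | 1 ≤ edist (f k ω) (‖ω.1‖ ^ 2)} := by
    rintro ⟨w, X, ε⟩ hω
    by_cases hw : ∃ S : Finset (Fin d), ∃ τ, S.card = s ∧ w = signVector d s S τ
    · obtain ⟨S, τ, hS, hwe⟩ := hw
      refine Or.inr ?_
      have h1 : ‖w‖ ^ 2 = 1 := hwe ▸ norm_signVector hs hS τ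
      simp only [Set.mem_ofPred_eq, not_le] at hω ⊢
      have h2 := hω.trans_le (preGDExcessRisk_le _ _ _ _ _ _)
      rw [h1, edist_dist, Real.dist_eq, ENNReal.one_le_ofReal]
      refine le_trans ?_ (le_abs_self _)
      simp only [hf]
      linarith
    · exact Or.inl ⟨hw, trivial⟩
  refine (measure_mono hsub).trans ((measure_union_le _ _).trans ?_)
  rw [hμ, Measure.prod_prod, prior_ae_signVector, zero_mul, zero_add]
  exact hk.le

theorem pow_le_of_log_le {n s t : ℕ} {σ : ℝ} (hn : 1 ≤ n) (hs : 1 ≤ s) (hσ : 0 < σ)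
    (ht : 16 * Real.log (n * s / σ ^ 2) ≤ t) :
    ((1 - 1 / 32 : ℝ) ^ t) ^ 2 ≤ σ ^ 2 / (n * s) := by
  have hn0 : (0 : ℝ) < n := by exact_mod_cast hn
  have hs0 : (0 : ℝ) < s := by exact_mod_cast hs
  have h1 : (1 - 1 / 32 : ℝ) ≤ Real.exp (-(1 / 32)) := by
    have := Real.add_one_le_exp (-(1 / 32 : ℝ))
    linarith
  calc ((1 - 1 / 32 : ℝ) ^ t) ^ 2 ≤ (Real.exp (-(1 / 32)) ^ t) ^ 2 := by gcongr
    _ = Real.exp (-(t / 16)) := by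
        rw [← Real.exp_nat_mul, ← Real.exp_nat_mul]
        congr 1
        push_cast
        ring
    _ ≤ Real.exp (-Real.log (n * s / σ ^ 2)) := Real.exp_le_exp.2 (by linarith)
    _ = _ := by
        rw [Real.exp_neg, Real.exp_log (by positivity), inv_div]

/-- With `x = δ/d ≤ 1/2`, the choice of `κ` makes the entrywise tails `x⁶` and the operator norm
tail `x²`; six powers absorb the union bound over `d²` entries. -/
theorem failure_probability_le {n d : ℕ} {δ κ : ℝ} (hd : 1 ≤ d) (hn : 1 ≤ n) (hδ : 0 < δ)
    (hδ1 : δ < 1) (hdδ : 2 * δ ≤ d) (hκ : κ ^ 2 = 48 * Real.log (d / δ) / n) :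
    (4 * (d : ℝ) ^ 2 + 2 * d) * Real.exp (-(n * κ ^ 2 / 8)) +
      Real.exp (-(2 * Real.log (d / δ))) ≤ δ := by
  have hd0 : (1 : ℝ) ≤ d := by exact_mod_cast hd
  have hn0 : (0 : ℝ) < n := by exact_mod_cast hn
  have hpos : 0 < (d : ℝ) / δ := by positivity
  have hx : Real.exp (-Real.log (d / δ)) = δ / d := by
    rw [Real.exp_neg, Real.exp_log hpos, inv_div]
  set x := δ / (d : ℝ) with hxd
  have hx0 : 0 < x := by positivity
  have hx2 : x ≤ 1 / 2 := by
    rw [hxd, div_le_iff₀ (by positivity)]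
    linarith
  have hdx : d * x = δ := by rw [hxd]; field_simp
  have h1 : Real.exp (-(n * κ ^ 2 / 8)) = x ^ 6 := by
    rw [← hx, ← Real.exp_nat_mul, hκ]
    congr 1
    push_cast
    field_simp
    ring
  have h2 : Real.exp (-(2 * Real.log (d / δ))) = x ^ 2 := by
    rw [← hx, ← Real.exp_nat_mul]
    congr 1
    push_cast
    ring
  rw [h1, h2]
  have h3 : (4 * (d : ℝ) ^ 2 + 2 * d) * x ^ 6 ≤ 3 / 8 * δ := by
    calc (4 * (d : ℝ) ^ 2 + 2 * d) * x ^ 6 ≤ (6 * (d : ℝ) ^ 2) * x ^ 6 := by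
          gcongr
          linarith [le_self_pow₀ hd0 two_ne_zero]
      _ = 6 * δ ^ 2 * x ^ 4 := by rw [← hdx]; ring
      _ ≤ 6 * δ * (1 / 2) ^ 4 := by
          gcongr
          exact pow_le_of_le_one hδ.le hδ1.le two_ne_zero
      _ = _ := by ring
  have h4 : x ^ 2 ≤ δ / 2 := by
    calc x ^ 2 = x * x := sq x
      _ ≤ 1 / 2 * x := by gcongr
      _ ≤ 1 / 2 * δ := by
          gcongr
          exact div_le_self hδ.le hd0
      _ = _ := by ring
  linarith

/-- The sample-size constant of the upper bound. -/
noncomputable def sampleConst (σ : ℝ) : ℝ :=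
  (600000 * (1 + σ ^ 2)) ^ 2 + ((1 + σ ^ 2) ^ 3 / σ ^ 2) ^ 2 + σ ^ 2 * Real.exp (1 + 1 / σ)

theorem one_le_sampleConst {σ : ℝ} : 1 ≤ sampleConst σ := by
  have h1 : (1 : ℝ) ≤ (600000 * (1 + σ ^ 2)) ^ 2 := by
    apply one_le_pow₀
    nlinarith [sq_nonneg σ]
  unfold sampleConst
  have h2 : 0 ≤ σ ^ 2 * Real.exp (1 + 1 / σ) := by positivity
  have h3 := sq_nonneg ((1 + σ ^ 2) ^ 3 / σ ^ 2)
  linarith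

/-- Consequences of the sample-size condition in the regime `s L² ≤ n`. -/
theorem sample_size_consequences {n d s t L σ : ℝ} (hn : 1 ≤ n) (hs : 1 ≤ s) (ht : 1 ≤ t)
    (hd : 1 ≤ d) (hσ : 0 < σ)
    (h : sampleConst σ * (t ^ 2 * s ^ 3 * d ^ (2 / 3 : ℝ)) ≤ n) (hreg : s * L ^ 2 ≤ n) :
    t * s ^ 2 * (1 + σ ^ 2) * L ≤ n / 600000 ∧
    t * s ^ 2 * (1 + σ ^ 2) * L * d ≤ n ^ 2 / 600000 ∧
    s ^ 4 * L * d * t ^ 2 * ((1 + σ ^ 2) ^ 3 / σ ^ 2) ≤ n ^ 2 := by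
  set C := sampleConst σ with hC
  have hC1 : 1 ≤ C := one_le_sampleConst
  have hs0 : 0 < s := by linarith
  have hn0 : 0 < n := by linarith
  have ht0 : 0 < t := by linarith
  have hd0 : 0 < d := by linarith
  have hB0 : 0 ≤ (1 + σ ^ 2) ^ 3 / σ ^ 2 := by positivity
  have hCa : (600000 * (1 + σ ^ 2)) ^ 2 ≤ C := by
    rw [hC, sampleConst]
    have h2 : 0 ≤ σ ^ 2 * Real.exp (1 + 1 / σ) := by positivity
    have h3 := sq_nonneg ((1 + σ ^ 2) ^ 3 / σ ^ 2)
    linarith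
  have hCb : ((1 + σ ^ 2) ^ 3 / σ ^ 2) ^ 2 ≤ C := by
    rw [hC, sampleConst]
    have h2 : 0 ≤ σ ^ 2 * Real.exp (1 + 1 / σ) := by positivity
    have h3 := sq_nonneg (600000 * (1 + σ ^ 2))
    linarith
  have hd23 : 1 ≤ d ^ (2 / 3 : ℝ) := Real.one_le_rpow hd (by norm_num)
  have hlin : C * (t ^ 2 * s ^ 3) ≤ n := by
    refine le_trans (mul_le_mul_of_nonneg_left ?_ (by positivity)) h
    exact le_mul_of_one_le_right (by positivity) hd23
  -- The exponent `2/3` enters through its cube. Squaring the last two goals produces `d²` and `L²`: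
  -- the cube controls the former by `n³`, and `s L² ≤ n` supplies the fourth factor `n`.
  have hcube : C * (t ^ 6 * s ^ 9 * d ^ 2) ≤ n ^ 3 := by
    have h1 := pow_le_pow_left₀ (by positivity) h 3
    have h2 : (d ^ (2 / 3 : ℝ)) ^ 3 = d ^ 2 := by
      rw [← Real.rpow_natCast, ← Real.rpow_mul hd0.le, ← Real.rpow_natCast]
      norm_num
    calc C * (t ^ 6 * s ^ 9 * d ^ 2) ≤ C ^ 3 * (t ^ 6 * s ^ 9 * d ^ 2) := by
          gcongr
          exact le_self_pow₀ hC1 (by norm_num)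
      _ = (C * (t ^ 2 * s ^ 3 * d ^ (2 / 3 : ℝ))) ^ 3 := by rw [← h2]; ring
      _ ≤ _ := h1
  refine ⟨?_, ?_, ?_⟩
  · rw [le_div_iff₀ (by norm_num)]
    apply le_of_sq_le_sq _ hn0.le
    calc (t * s ^ 2 * (1 + σ ^ 2) * L * 600000) ^ 2
        = (600000 * (1 + σ ^ 2)) ^ 2 * (t ^ 2 * s ^ 3) * (s * L ^ 2) := by ring
      _ ≤ C * (t ^ 2 * s ^ 3) * n := by gcongr
      _ ≤ n * n := by gcongr
      _ = _ := by ring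
  · rw [le_div_iff₀ (by norm_num)]
    apply le_of_sq_le_sq _ (by positivity)
    calc (t * s ^ 2 * (1 + σ ^ 2) * L * d * 600000) ^ 2
        = (600000 * (1 + σ ^ 2)) ^ 2 * (t ^ 2 * s ^ 3 * d ^ 2) * (s * L ^ 2) := by ring
      _ ≤ C * (t ^ 6 * s ^ 9 * d ^ 2) * n := by
          gcongr <;> first | assumption | norm_num
      _ ≤ n ^ 3 * n := by gcongr
      _ = _ := by ring
  · apply le_of_sq_le_sq _ (by positivity)
    calc (s ^ 4 * L * d * t ^ 2 * ((1 + σ ^ 2) ^ 3 / σ ^ 2)) ^ 2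
        = ((1 + σ ^ 2) ^ 3 / σ ^ 2) ^ 2 * (t ^ 4 * s ^ 7 * d ^ 2) * (s * L ^ 2) := by ring
      _ ≤ C * (t ^ 6 * s ^ 9 * d ^ 2) * n := by
          gcongr <;> first | assumption | norm_num
      _ ≤ n ^ 3 * n := by gcongr
      _ = _ := by ring

theorem preGD_rate_of_regular {n d s t : ℕ} {σ κ L : ℝ} {X : Fin n → Feat d} {ε : Fin n → ℝ}
    (hn : 1 ≤ n) (hs : 1 ≤ s) (hsd : s ≤ d) (ht : 1 ≤ t) (hσ : 0 < σ) (hL : 1 / 2 ≤ L)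
    (hκ0 : 0 ≤ κ) (hκ : κ ^ 2 = 48 * L / n) (hX : RegularSample σ κ (2 * L) X ε)
    (hlog : 16 * Real.log (n * s / σ ^ 2) ≤ t)
    (h : sampleConst σ * ((t : ℝ) ^ 2 * (s : ℝ) ^ 3 * (d : ℝ) ^ (2 / 3 : ℝ)) ≤ n)
    (hreg : s * L ^ 2 ≤ n) {S : Finset (Fin d)} (hS : S.card = s) (τ : Fin d → Bool) :
    preGDExcessRisk σ (s / 4) t (signVector d s S τ) X ε ≤
      10 ^ 17 * (σ ^ 2 * L ^ 2 * ((s : ℝ) / n + (d : ℝ) * (s : ℝ) ^ 2 / (n : ℝ) ^ 2)) := by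
  have hn1 : (1 : ℝ) ≤ n := by exact_mod_cast hn
  have hs1 : (1 : ℝ) ≤ s := by exact_mod_cast hs
  have ht1 : (1 : ℝ) ≤ t := by exact_mod_cast ht
  have hsd1 : (s : ℝ) ≤ d := by exact_mod_cast hsd
  have hn0 : (0 : ℝ) < n := by linarith
  have hs0 : (0 : ℝ) < s := by linarith
  have hL0 : 0 < L := by linarith
  obtain ⟨H1, H2, H3⟩ := sample_size_consequences hn1 hs1 ht1 (hs1.trans hsd1) hσ h hreg
  have hτ : 1 ≤ 1 + σ ^ 2 := le_add_of_nonneg_right (sq_nonneg σ)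
  have hbase : (s : ℝ) ^ 2 * (1 + σ ^ 2) * L ≤ n / 600000 := by
    refine le_trans ?_ H1
    calc (s : ℝ) ^ 2 * (1 + σ ^ 2) * L = 1 * s ^ 2 * (1 + σ ^ 2) * L := by ring
      _ ≤ _ := by gcongr
  have hbase' : (s : ℝ) ^ 2 * (1 + σ ^ 2) * (L / n) ≤ 1 / 600000 := by
    rw [mul_div_assoc', div_le_iff₀ hn0]
    linarith
  have hLn0 : 0 ≤ L / n := by positivity
  have hκ' : κ ^ 2 = 48 * (L / n) := by rw [hκ]; ring
  have h1 : s * κ ≤ 1 / 32 := by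
    apply le_of_sq_le_sq _ (by norm_num)
    have h2 : (s : ℝ) ^ 2 * 1 * (L / n) ≤ (s : ℝ) ^ 2 * (1 + σ ^ 2) * (L / n) := by gcongr
    rw [mul_pow, hκ']
    linarith
  have hρle := off_support_step_le (σ := σ) hs1 hκ
  set ρ : ℝ := s / 4 * ((√(s : ℝ) + σ) * κ) ^ 2 with hρ
  have hρ0 : 0 ≤ ρ := by positivity
  have h2 : (√(s : ℝ) + σ) * κ ≤ 1 / (2 * √(s : ℝ)) := by
    have hr : 0 < √(s : ℝ) := Real.sqrt_pos.2 hs0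
    rw [le_div_iff₀ (by positivity)]
    apply le_of_sq_le_sq _ zero_le_one
    calc ((√(s : ℝ) + σ) * κ * (2 * √(s : ℝ))) ^ 2 = 16 * ρ := by
          rw [hρ, mul_pow _ (2 * √(s : ℝ)), mul_pow 2, Real.sq_sqrt hs0.le]; ring
      _ ≤ 16 * (24 * s ^ 2 * (1 + σ ^ 2) * L / n) := by gcongr
      _ = 384 * (s ^ 2 * (1 + σ ^ 2) * (L / n)) := by ring
      _ ≤ 1 ^ 2 := by linarith
  set G : ℝ := 16 * (n + (2 * d + 2 * L)) / n with hG
  obtain ⟨hG0, hGW, -⟩ := opNorm_proxy_le hn1 hs1 ht1 hsd1 hL hG H1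
  have htG : t * ρ * G ≤ 1 / 256 := by
    calc t * ρ * G ≤ t * (24 * s ^ 2 * (1 + σ ^ 2) * L / n) * (48 * (1 + d / n)) := by gcongr
      _ = 1152 * (t * s ^ 2 * (1 + σ ^ 2) * L / n) +
          1152 * (t * s ^ 2 * (1 + σ ^ 2) * L * d / n ^ 2) := by
          field_simp
          ring
      _ ≤ 1152 * (1 / 600000) + 1152 * (1 / 600000) := by
          refine add_le_add (mul_le_mul_of_nonneg_left ?_ (by norm_num))
            (mul_le_mul_of_nonneg_left ?_ (by norm_num))
          · rw [div_le_iff₀ hn0]; linarith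
          · rw [div_le_iff₀ (by positivity)]; linarith
      _ ≤ _ := by norm_num
  refine (preGDExcessRisk_le _ _ _ _ _ _).trans ((norm_preGDError_sq_le hX hn hs hσ hκ0
    (by positivity) hS τ h1 h2 hρ hG htG rfl).trans ?_)
  exact rate_bound hn1 hs1 ht1 hsd1 hL hσ hκ hρ hG rfl (pow_le_of_log_le hn hs hσ hlog) H1 H3

theorem preGD_upper_bound {σ : ℝ} (hσ : 0 < σ) {n d s t : ℕ} {δ : ℝ} (hsd : s ≤ d) (hn : 1 ≤ n)
    (hs : 1 ≤ s) (ht : 1 ≤ t) (hδ : 0 < δ) (hδ1 : δ < 1) (hdδ : 2 * δ ≤ d)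
    (hlog : 16 * Real.log (n * s / σ ^ 2) ≤ t)
    (h : sampleConst σ * ((t : ℝ) ^ 2 * (s : ℝ) ^ 3 * (d : ℝ) ^ (2 / 3 : ℝ)) ≤ n) :
    ∃ η : ℝ, 0 < η ∧
      ((prior d s hsd).toMeasure.prod (sampleLaw n d σ))
        {ω | ¬ preGDExcessRisk σ η t ω.1 ω.2.1 ω.2.2 ≤
          10 ^ 17 * (σ ^ 2 * Real.log (n * s / σ ^ 2) ^ 2 * Real.log (d / δ) ^ 2 *
            ((s : ℝ) / n + (d : ℝ) * (s : ℝ) ^ 2 / (n : ℝ) ^ 2))}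
        ≤ ENNReal.ofReal δ := by
  have hn1 : (1 : ℝ) ≤ n := by exact_mod_cast hn
  have hs1 : (1 : ℝ) ≤ s := by exact_mod_cast hs
  have ht1 : (1 : ℝ) ≤ t := by exact_mod_cast ht
  have hsd1 : (s : ℝ) ≤ d := by exact_mod_cast hsd
  have hn0 : (0 : ℝ) < n := by linarith
  have hs0 : (0 : ℝ) < s := by linarith
  have hd1 : (1 : ℝ) ≤ d := hs1.trans hsd1
  set L := Real.log (d / δ) with hLdef
  set Λ := Real.log (n * s / σ ^ 2) with hΛ
  have hL : 1 / 2 ≤ L := by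
    have h2 : (2 : ℝ) ≤ d / δ := by rw [le_div_iff₀ hδ]; exact hdδ
    have h3 := Real.log_le_log (by norm_num) h2
    have h4 := Real.log_two_gt_d9
    linarith
  have hCn : sampleConst σ ≤ n := by
    refine le_trans ?_ h
    refine le_mul_of_one_le_right (by linarith [one_le_sampleConst (σ := σ)]) ?_
    exact one_le_mul_of_one_le_of_one_le (one_le_mul_of_one_le_of_one_le (one_le_pow₀ ht1)
      (one_le_pow₀ hs1)) (Real.one_le_rpow hd1 (by norm_num))
  -- The last summand of `sampleConst` is made for this: it gives `Λ ≥ 1` and `σ Λ ≥ 1`.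
  have hΛ1 : 1 + 1 / σ ≤ Λ := by
    rw [hΛ, Real.le_log_iff_exp_le (by positivity), le_div_iff₀ (by positivity)]
    calc Real.exp (1 + 1 / σ) * σ ^ 2 ≤ sampleConst σ := by
          unfold sampleConst
          have h3 := sq_nonneg ((1 + σ ^ 2) ^ 3 / σ ^ 2)
          have h4 := sq_nonneg (600000 * (1 + σ ^ 2))
          linarith
      _ ≤ n := hCn
      _ ≤ n * s := le_mul_of_one_le_right hn0.le hs1
  have hσinv : 0 < 1 / σ := by positivity
  have hΛ2 : 1 ≤ Λ := by linarith
  have hσΛ : 1 ≤ σ ^ 2 * Λ ^ 2 := by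
    rw [← mul_pow]
    apply one_le_pow₀
    calc 1 = σ * (1 / σ) := by field_simp
      _ ≤ σ * Λ := by gcongr; linarith
  -- If `s L² ≥ n`, then `σ² Λ² ≥ 1` makes the claimed bound at least `10 ^ 17`, so a risk of `2` is
  -- enough.
  rcases le_total (s * L ^ 2) n with hreg | hreg
  · refine ⟨s / 4, by positivity, ?_⟩
    set κ := √(48 * L / n) with hκdef
    have hκ : κ ^ 2 = 48 * L / n := Real.sq_sqrt (by positivity)
    have hκ0 : 0 ≤ κ := Real.sqrt_nonneg _
    obtain ⟨H1, -, -⟩ := sample_size_consequences hn1 hs1 ht1 hd1 hσ h hreg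
    have hκ1 : κ ≤ 1 := by
      apply le_of_sq_le_sq _ zero_le_one
      rw [hκ, div_le_iff₀ hn0]
      have : 1 * 1 ^ 2 * (1 + 0) * L ≤ t * (s : ℝ) ^ 2 * (1 + σ ^ 2) * L := by
        gcongr
        exact sq_nonneg σ
      linarith
    refine (measure_prod_le_of_signVector hsd σ
      (B := {ω | ¬ RegularSample σ κ (2 * L) ω.1 ω.2}) ?_).trans
      ((measure_not_regularSample hσ hκ0 hκ1 (by positivity)).trans
      (ENNReal.ofReal_le_ofReal (failure_probability_le (hs.trans hsd) hn hδ hδ1 hdδ hκ)))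
    rintro S τ ⟨X, ε⟩ hS hω hX
    apply hω
    refine (preGD_rate_of_regular hn hs hsd ht hσ hL hκ0 hκ hX hlog h hreg hS τ).trans ?_
    have h5 : 1 ≤ Λ ^ 2 := one_le_pow₀ hΛ2
    gcongr
    exact le_mul_of_one_le_right (sq_nonneg σ) h5
  · obtain ⟨η, hη, hle⟩ := exists_stepsize_le_two (n := n) t hsd hs σ hδ
    refine ⟨η, hη, (measure_mono ?_).trans hle⟩
    intro ω hω hle2
    apply hω
    refine hle2.trans ?_
    have h5 : 1 ≤ L ^ 2 * (s / n) := by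
      rw [mul_div_assoc', le_div_iff₀ hn0]
      linarith
    have h6 : 1 ≤ (σ ^ 2 * Λ ^ 2) * (L ^ 2 * (s / n)) := one_le_mul_of_one_le_of_one_le hσΛ h5
    have h7 : 0 ≤ σ ^ 2 * Λ ^ 2 * L ^ 2 * ((d : ℝ) * (s : ℝ) ^ 2 / (n : ℝ) ^ 2) := by positivity
    linarith


/-! ### Lower bounds for linear estimators -/

theorem meanExcessRisk_eq_integral {n d : ℕ} (s : ℕ) (h : s ≤ d) (σ : ℝ)
    (est : (Fin n → Feat d) → (Fin n → ℝ) → Feat d) (X : Fin n → Feat d) (ε : Fin n → ℝ) :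
    meanExcessRisk s h σ est X ε =
      ∫ w, ‖est X (labels w X ε) - w‖ ^ 2 ∂(prior d s h).toMeasure := by
  simp only [meanExcessRisk, excessRisk_id]

/-- An exact bias and noise decomposition for fixed inputs and noise: the cross term vanishes
because the prior is centred. -/
theorem meanExcessRisk_linear {n d s : ℕ} (h : s ≤ d) (hs : 1 ≤ s) (σ : ℝ)
    {est : (Fin n → Feat d) → (Fin n → ℝ) → Feat d} {X : Fin n → Feat d}
    {T : EuclideanSpace ℝ (Fin n) →ₗ[ℝ] Feat d} (hT : ∀ y, est X y = T (WithLp.toLp 2 y))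
    (ε : Fin n → ℝ) :
    meanExcessRisk s h σ est X ε =
      (1 / (d : ℝ)) * ∑ j, ‖T (designCLM X (EuclideanSpace.single j 1)) -
        EuclideanSpace.single j 1‖ ^ 2 + ‖T (WithLp.toLp 2 ε)‖ ^ 2 := by
  have hlab : ∀ w, WithLp.toLp 2 (labels w X ε) = designCLM X w + WithLp.toLp 2 ε := by
    intro w
    ext i
    simp [labels]
  rw [meanExcessRisk_eq_integral]
  have h1 : ∀ w, est X (labels w X ε) - w =
      (T ∘ₗ (designCLM X : Feat d →ₗ[ℝ] EuclideanSpace ℝ (Fin n)) -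
        (LinearMap.id : Feat d →ₗ[ℝ] Feat d)) w + T (WithLp.toLp 2 ε) := by
    intro w
    rw [hT, hlab, map_add]
    simp only [LinearMap.sub_apply, LinearMap.comp_apply, ContinuousLinearMap.coe_coe,
      LinearMap.id_apply]
    abel
  simp only [h1]
  rw [integral_prior_norm_sq h hs]
  rfl

/-- The sum is the trace of the projection onto `Vᗮ`, hence its dimension. -/
theorem sum_norm_sq_orthogonalProjection {d m : ℕ} (V : Submodule ℝ (Feat d))
    (hV : Module.finrank ℝ V ≤ m) :
    (d : ℝ) - m ≤ ∑ j, ‖Vᗮ.starProjection (EuclideanSpace.single j 1)‖ ^ 2 := by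
  have hfin : Module.finrank ℝ V + Module.finrank ℝ Vᗮ = d := by
    rw [Submodule.finrank_add_finrank_orthogonal, finrank_euclideanSpace_fin]
  set g := stdOrthonormalBasis ℝ Vᗮ with hg
  have h1 : ∀ x : Feat d, ‖Vᗮ.starProjection x‖ ^ 2 = ∑ k, inner ℝ (g k : Feat d) x ^ 2 := by
    intro x
    rw [Submodule.starProjection_apply, ← Submodule.coe_norm, ← g.sum_sq_inner_right]
    refine Finset.sum_congr rfl fun k _ => ?_
    rw [Submodule.inner_orthogonalProjectionOnto_eq_of_mem_left]
  simp only [h1]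
  rw [Finset.sum_comm]
  have h2 : ∀ k, ∑ j, inner ℝ (g k : Feat d) (EuclideanSpace.single j 1) ^ 2 = 1 := by
    intro k
    have h3 : ‖(g k : Feat d)‖ = 1 := g.orthonormal.1 k
    have h4 := EuclideanSpace.real_norm_sq_eq (g k : Feat d)
    rw [h3, one_pow] at h4
    simp only [EuclideanSpace.inner_single_right, one_mul, conj_trivial]
    exact h4.symm
  simp only [h2, Finset.sum_const, Finset.card_univ, Fintype.card_fin, nsmul_eq_mul, mul_one]
  have : (d : ℝ) = Module.finrank ℝ V + Module.finrank ℝ Vᗮ := by exact_mod_cast hfin.symm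
  have h5 : (Module.finrank ℝ V : ℝ) ≤ m := by exact_mod_cast hV
  linarith

/-- Projecting onto the orthogonal complement of the range of `T` kills every `T (u j)`. -/
theorem sum_norm_sq_sub_ge_of_rank {n d : ℕ} (T : EuclideanSpace ℝ (Fin n) →ₗ[ℝ] Feat d)
    (u : Fin d → EuclideanSpace ℝ (Fin n)) :
    (d : ℝ) - n ≤ ∑ j, ‖T (u j) - EuclideanSpace.single j 1‖ ^ 2 := by
  have hV : Module.finrank ℝ (LinearMap.range T) ≤ n :=
    (LinearMap.finrank_range_le T).trans (by simp)
  refine (sum_norm_sq_orthogonalProjection _ hV).trans (Finset.sum_le_sum fun j _ => ?_)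
  set Q := (LinearMap.range T)ᗮ.starProjection with hQ
  have h0 : Q (T (u j)) = 0 := by
    rw [hQ, Submodule.starProjection_apply_eq_zero_iff, Submodule.orthogonal_orthogonal]
    exact ⟨u j, rfl⟩
  have h1 : Q (EuclideanSpace.single j 1) = -Q (T (u j) - EuclideanSpace.single j 1) := by
    rw [map_sub, h0, zero_sub, neg_neg]
  rw [h1, norm_neg]
  gcongr
  exact Submodule.norm_starProjection_apply_le _ _

/-- A right singular basis of a linear map. -/
theorem exists_singular_basis {n d : ℕ} (T : EuclideanSpace ℝ (Fin n) →ₗ[ℝ] Feat d) :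
    ∃ f : OrthonormalBasis (Fin n) ℝ (EuclideanSpace ℝ (Fin n)),
      ∀ c : Fin n → ℝ, ‖T (∑ i, c i • f i)‖ ^ 2 = ∑ i, ‖T (f i)‖ ^ 2 * c i ^ 2 := by
  -- Eigenvectors of `T† T` have orthogonal images under `T`.
  have hsym : (LinearMap.adjoint T ∘ₗ T).IsSymmetric := by
    intro x y
    rw [LinearMap.comp_apply, LinearMap.comp_apply, LinearMap.adjoint_inner_left,
      LinearMap.adjoint_inner_right]
  have hn : Module.finrank ℝ (EuclideanSpace ℝ (Fin n)) = n := finrank_euclideanSpace_fin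
  set f := hsym.eigenvectorBasis hn with hf
  have horth : ∀ i j, i ≠ j → inner ℝ (T (f i)) (T (f j)) = 0 := by
    intro i j hij
    rw [← LinearMap.adjoint_inner_left, ← LinearMap.comp_apply, hf,
      hsym.apply_eigenvectorBasis hn i]
    rw [inner_smul_left, ← hf, f.orthonormal.2 hij, mul_zero]
  refine ⟨f, fun c => ?_⟩
  rw [map_sum, ← real_inner_self_eq_norm_sq, sum_inner]
  refine Finset.sum_congr rfl fun i _ => ?_
  rw [inner_sum, Finset.sum_eq_single i]
  · rw [map_smul, real_inner_self_eq_norm_sq, norm_smul, mul_pow, Real.norm_eq_abs, sq_abs,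
      mul_comm]
  · intro j _ hj
    rw [map_smul, map_smul, inner_smul_left, inner_smul_right, horth i j (Ne.symm hj)]
    simp
  · simp

/-- A robust version of the rank bound. Projecting away only the images of the large singular
directions leaves a remainder `v` with `‖v‖² ≤ θ ‖u j‖²`; the factor `1/2` comes from `(a + b)² ≤ 2
a² + 2 b²`. -/
theorem sum_norm_sq_sub_ge_of_singular {n d : ℕ} {T : EuclideanSpace ℝ (Fin n) →ₗ[ℝ] Feat d}
    {f : OrthonormalBasis (Fin n) ℝ (EuclideanSpace ℝ (Fin n))}
    (hf : ∀ c : Fin n → ℝ, ‖T (∑ i, c i • f i)‖ ^ 2 = ∑ i, ‖T (f i)‖ ^ 2 * c i ^ 2)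
    {θ : ℝ} (hθ : 0 ≤ θ) (u : Fin d → EuclideanSpace ℝ (Fin n)) :
    1 / 2 * ((d : ℝ) - (Finset.univ.filter fun i => θ ≤ ‖T (f i)‖ ^ 2).card) -
      θ * ∑ j, ‖u j‖ ^ 2 ≤ ∑ j, ‖T (u j) - EuclideanSpace.single j 1‖ ^ 2 := by
  classical
  set I := Finset.univ.filter fun i => θ ≤ ‖T (f i)‖ ^ 2 with hI
  set V := Submodule.span ℝ ((I.image fun i => T (f i) : Finset (Feat d)) : Set (Feat d)) with hVdef
  have hV : Module.finrank ℝ V ≤ I.card :=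
    (finrank_span_finset_le_card _).trans Finset.card_image_le
  have hproj := sum_norm_sq_orthogonalProjection V hV
  have hterm : ∀ j, 1 / 2 * ‖Vᗮ.starProjection (EuclideanSpace.single j 1 : Feat d)‖ ^ 2 -
      θ * ‖u j‖ ^ 2 ≤ ‖T (u j) - EuclideanSpace.single j 1‖ ^ 2 := by
    intro j
    set Q := Vᗮ.starProjection with hQ
    set c : Fin n → ℝ := fun i => inner ℝ (f i) (u j) with hc
    set c₂ : Fin n → ℝ := fun i => if i ∈ I then 0 else c i with hc2
    have hu : T (u j) = ∑ i ∈ I, c i • T (f i) + T (∑ i, c₂ i • f i) := by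
      conv_lhs => rw [← f.sum_repr' (u j)]
      rw [map_sum, map_sum, ← Finset.sum_filter_add_sum_filter_not Finset.univ (· ∈ I)]
      congr 1
      · simp [hc]
      · rw [Finset.sum_filter]
        refine Finset.sum_congr rfl fun i _ => ?_
        by_cases hi : i ∈ I <;> simp [hc2, hc, hi]
    have hQ0 : Q (∑ i ∈ I, c i • T (f i)) = 0 := by
      rw [hQ, Submodule.starProjection_apply_eq_zero_iff, Submodule.orthogonal_orthogonal]
      refine Submodule.sum_mem _ fun i hi => Submodule.smul_mem _ _ (Submodule.subset_span ?_)
      exact Finset.mem_coe.2 (Finset.mem_image_of_mem _ hi)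
    have hsmall : ‖T (∑ i, c₂ i • f i)‖ ^ 2 ≤ θ * ‖u j‖ ^ 2 := by
      rw [hf, ← f.sum_sq_inner_right (u j), Finset.mul_sum]
      refine Finset.sum_le_sum fun i _ => ?_
      by_cases hi : i ∈ I
      · simp only [hc2, hi, if_true, zero_pow two_ne_zero, mul_zero]
        positivity
      · simp only [hc2, hi, if_false, hc]
        have : ‖T (f i)‖ ^ 2 ≤ θ := by
          by_contra! hcon
          exact hi (by simp [hI, hcon.le])
        gcongr
    set v := T (∑ i, c₂ i • f i) with hv
    have hQe : Q (EuclideanSpace.single j 1) = Q v - Q (T (u j) - EuclideanSpace.single j 1) := by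
      rw [map_sub, hu, map_add, hQ0]
      abel
    have h1 : ‖Q v‖ ≤ ‖v‖ := Submodule.norm_starProjection_apply_le _ _
    have h2 : ‖Q (T (u j) - EuclideanSpace.single j 1)‖ ≤ ‖T (u j) - EuclideanSpace.single j 1‖ :=
      Submodule.norm_starProjection_apply_le _ _
    have h3 : ‖Q (EuclideanSpace.single j 1)‖ ≤ ‖v‖ + ‖T (u j) - EuclideanSpace.single j 1‖ := by
      rw [hQe]
      exact (norm_sub_le _ _).trans (add_le_add h1 h2)
    have h4 := pow_le_pow_left₀ (norm_nonneg _) h3 2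
    nlinarith [sq_nonneg (‖v‖ - ‖T (u j) - EuclideanSpace.single j 1‖)]
  have hsum := Finset.sum_le_sum fun j (_ : j ∈ Finset.univ) => hterm j
  rw [Finset.sum_sub_distrib, ← Finset.mul_sum, ← Finset.mul_sum] at hsum
  linarith

/-- By rotation invariance the noise has independent Gaussian coordinates in the singular basis.
Each large singular direction contributes one factor below one, the others at most `1`. -/
theorem lintegral_exp_neg_norm_sq_le {n d : ℕ} {T : EuclideanSpace ℝ (Fin n) →ₗ[ℝ] Feat d}
    {f : OrthonormalBasis (Fin n) ℝ (EuclideanSpace ℝ (Fin n))}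
    (hf : ∀ c : Fin n → ℝ, ‖T (∑ i, c i • f i)‖ ^ 2 = ∑ i, ‖T (f i)‖ ^ 2 * c i ^ 2)
    {θ l : ℝ} (hθ : 0 ≤ θ) (hl : 0 ≤ l) (σ : ℝ) :
    ∫⁻ ε, ENNReal.ofReal (Real.exp (-(l * ‖T (WithLp.toLp 2 ε)‖ ^ 2)))
        ∂(Measure.pi fun _ : Fin n => noiseLaw σ) ≤
      ENNReal.ofReal ((√(1 + 2 * (l * σ ^ 2 * θ)))⁻¹ ^
        (Finset.univ.filter fun i => θ ≤ ‖T (f i)‖ ^ 2).card) := by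
  have hTc : Continuous T := T.continuous_of_finiteDimensional
  have hpi : (Measure.pi fun _ : Fin n => noiseLaw σ) =
      (Measure.pi fun _ : Fin n => gaussianReal 0 1).map (fun x i => σ * x i) := by
    rw [noiseLaw_eq_map]
    exact (Measure.pi_map_pi (fun _ => by fun_prop)).symm
  have hrot : ∀ F : EuclideanSpace ℝ (Fin n) → ENNReal, Measurable F →
      ∫⁻ x, F (WithLp.toLp 2 x) ∂(Measure.pi fun _ : Fin n => gaussianReal 0 1) =
        ∫⁻ x, F (∑ i, x i • f i) ∂(Measure.pi fun _ : Fin n => gaussianReal 0 1) := by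
    intro F hF
    rw [← lintegral_map hF (by fun_prop), map_pi_eq_stdGaussian,
      stdGaussian_eq_map_pi_orthonormalBasis f, lintegral_map hF (by fun_prop)]
  rw [hpi, lintegral_map (by fun_prop) (by fun_prop)]
  have h1 : ∀ x : Fin n → ℝ, ENNReal.ofReal (Real.exp
      (-(l * ‖T (WithLp.toLp 2 fun i => σ * x i)‖ ^ 2))) =
      (fun v => ENNReal.ofReal (Real.exp (-(l * σ ^ 2 * ‖T v‖ ^ 2)))) (WithLp.toLp 2 x) := by
    intro x
    have : WithLp.toLp 2 (fun i => σ * x i) = σ • (WithLp.toLp 2 x : EuclideanSpace ℝ (Fin n)) := by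
      ext i; simp
    rw [this, map_smul, norm_smul, mul_pow, Real.norm_eq_abs, sq_abs, ← mul_assoc]
  rw [lintegral_congr h1, hrot (fun v => ENNReal.ofReal (Real.exp (-(l * σ ^ 2 * ‖T v‖ ^ 2))))
    (by fun_prop)]
  have h2 : ∀ x : Fin n → ℝ, ENNReal.ofReal (Real.exp (-(l * σ ^ 2 * ‖T (∑ i, x i • f i)‖ ^ 2))) =
      ∏ i, (fun y => ENNReal.ofReal (Real.exp (-(l * σ ^ 2 * ‖T (f i)‖ ^ 2) * y ^ 2))) (x i) := by
    intro x
    rw [hf, Finset.mul_sum, ← Finset.sum_neg_distrib, Real.exp_sum,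
      ENNReal.ofReal_prod_of_nonneg fun i _ => (Real.exp_pos _).le]
    refine Finset.prod_congr rfl fun i _ => ?_
    congr 2
    ring
  rw [lintegral_congr h2, lintegral_pi_prod (fun _ : Fin n => gaussianReal 0 1)
    (f := fun i y => ENNReal.ofReal (Real.exp (-(l * σ ^ 2 * ‖T (f i)‖ ^ 2) * y ^ 2)))
    fun i => by fun_prop]
  set I := Finset.univ.filter fun i => θ ≤ ‖T (f i)‖ ^ 2 with hI
  have h3 : ∀ i, ∫⁻ y, ENNReal.ofReal (Real.exp (-(l * σ ^ 2 * ‖T (f i)‖ ^ 2) * y ^ 2))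
      ∂(gaussianReal 0 1) ≤ ENNReal.ofReal (if i ∈ I then (√(1 + 2 * (l * σ ^ 2 * θ)))⁻¹ else 1) := by
    intro i
    have hb : 0 ≤ l * σ ^ 2 * ‖T (f i)‖ ^ 2 := by positivity
    rw [lintegral_exp_mul_sq_gaussianReal (by linarith)]
    apply ENNReal.ofReal_le_ofReal
    split_ifs with hi
    · have : θ ≤ ‖T (f i)‖ ^ 2 := by simpa [hI] using hi
      apply inv_anti₀ (by positivity)
      apply Real.sqrt_le_sqrt
      have := mul_le_mul_of_nonneg_left this (by positivity : 0 ≤ l * σ ^ 2)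
      linarith
    · apply inv_le_one_of_one_le₀
      rw [Real.one_le_sqrt]
      linarith
  refine (Finset.prod_le_prod' fun i _ => h3 i).trans ?_
  rw [← ENNReal.ofReal_prod_of_nonneg fun i _ => by split_ifs <;> positivity]
  simp

theorem measure_frobenius_gt {n d : ℕ} :
    (Measure.pi fun _ : Fin n => stdGaussian (Feat d))
      {X | ¬ ∑ j, ‖designCLM X (EuclideanSpace.single j 1)‖ ^ 2 ≤ 8 * n * d} ≤
      ENNReal.ofReal (d * Real.exp (-n)) := by
  have hv : ∀ j, ‖(EuclideanSpace.single j (1 : ℝ) : Feat d)‖ = 1 := fun j => by simp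
  have hsum : ENNReal.ofReal (d * Real.exp (-n)) =
      ∑ _j : Fin d, ENNReal.ofReal (Real.exp (-n)) := by
    simp [ENNReal.ofReal_mul]
  rw [hsum]
  refine (measure_mono ?_).trans ((measure_iUnion_fintype_le _ _).trans
    (Finset.sum_le_sum fun j _ => measure_sum_inner_sq_ge_of_le n (hv j) n))
  intro X hX
  simp only [Set.mem_iUnion, Set.mem_ofPred_eq] at hX ⊢
  by_contra! hcon
  apply hX
  calc ∑ j, ‖designCLM X (EuclideanSpace.single j 1)‖ ^ 2 ≤ ∑ _j : Fin d, 4 * ((n : ℝ) + n) := by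
        refine Finset.sum_le_sum fun j _ => ?_
        rw [norm_designCLM_apply_sq]
        exact (hcon j).le
    _ = _ := by simp; ring

/-- An estimator that depends linearly on the labels, and measurably on the inputs. -/
structure IsLinearEstimator {n d : ℕ} (est : (Fin n → Feat d) → (Fin n → ℝ) → Feat d) : Prop where
  linear : ∀ X, ∃ T : EuclideanSpace ℝ (Fin n) →ₗ[ℝ] Feat d, ∀ y, est X y = T (WithLp.toLp 2 y)
  measurable : ∀ y, Measurable fun X => est X y

/-- Linearity in the labels writes the estimator as a finite sum of label times function of the
inputs, upgrading separate to joint measurability. -/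
theorem IsLinearEstimator.measurable_uncurry {n d : ℕ}
    {est : (Fin n → Feat d) → (Fin n → ℝ) → Feat d} (h : IsLinearEstimator est) :
    Measurable fun ω : (Fin n → Feat d) × (Fin n → ℝ) => est ω.1 ω.2 := by
  have h1 : ∀ X y, ∑ i, y i • est X (Pi.single i 1) = est X y := by
    intro X y
    obtain ⟨T, hT⟩ := h.linear X
    simp only [hT]
    rw [← (EuclideanSpace.basisFun (Fin n) ℝ).sum_repr (WithLp.toLp 2 y), map_sum]
    simp [EuclideanSpace.single]
  have h2 : (fun ω : (Fin n → Feat d) × (Fin n → ℝ) => est ω.1 ω.2) =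
      fun ω => ∑ i, ω.2 i • est ω.1 (Pi.single i 1) := funext fun ω => (h1 ω.1 ω.2).symm
  rw [h2]
  refine Finset.measurable_sum _ fun i _ => ?_
  exact ((measurable_pi_apply i).comp measurable_snd).smul ((h.measurable _).comp measurable_fst)

theorem measure_norm_sq_lt_le {n d : ℕ} {est : (Fin n → Feat d) → (Fin n → ℝ) → Feat d}
    (h : IsLinearEstimator est) {σ l r p : ℝ} (hl : 0 ≤ l) {A : Set (Fin n → Feat d)}
    (hA : ∀ X ∈ A, ∫⁻ ε, ENNReal.ofReal (Real.exp (-(l * ‖est X ε‖ ^ 2)))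
        ∂(Measure.pi fun _ : Fin n => noiseLaw σ) ≤ ENNReal.ofReal p) :
    sampleLaw n d σ {ω | ω.1 ∈ A ∧ ‖est ω.1 ω.2‖ ^ 2 < r} ≤
      ENNReal.ofReal (Real.exp (l * r)) * ENNReal.ofReal p := by
  set μ := (Measure.pi fun _ : Fin n => stdGaussian (Feat d)) with hμ
  set ν := (Measure.pi fun _ : Fin n => noiseLaw σ) with hν
  set Ψ : (Fin n → Feat d) × (Fin n → ℝ) → ENNReal := fun ω =>
    ENNReal.ofReal (Real.exp (-(l * ‖est ω.1 ω.2‖ ^ 2))) with hΨ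
  have hΨm : Measurable Ψ :=
    ((((h.measurable_uncurry.norm.pow_const 2).const_mul l).neg).exp).ennreal_ofReal
  set Φ : (Fin n → Feat d) → ENNReal := fun X => ∫⁻ ε, Ψ (X, ε) ∂ν with hΦ
  have hΦm : Measurable Φ := hΨm.lintegral_prod_right'
  -- `A` may fail to be measurable (it will be defined through chosen singular bases); `G` is a
  -- measurable set containing it on which the same estimate holds.
  set G : Set (Fin n → Feat d) := {X | Φ X ≤ ENNReal.ofReal p} with hG
  have hGm : MeasurableSet G := measurableSet_le hΦm measurable_const
  set F : (Fin n → Feat d) × (Fin n → ℝ) → ENNReal := fun ω =>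
    G.indicator (fun _ => (1 : ENNReal)) ω.1 * Ψ ω with hF
  have hFm : Measurable F :=
    ((measurable_const.indicator hGm).comp measurable_fst).mul hΨm
  have hint : ∫⁻ ω, F ω ∂(μ.prod ν) ≤ ENNReal.ofReal p := by
    rw [lintegral_prod _ hFm.aemeasurable]
    calc _ ≤ ∫⁻ _X, ENNReal.ofReal p ∂μ := by
          refine lintegral_mono fun X => ?_
          simp only [hF]
          rw [lintegral_const_mul _ (f := fun ε => Ψ (X, ε)) (hΨm.comp measurable_prodMk_left)]
          by_cases hX : X ∈ G
          · rw [Set.indicator_of_mem hX, one_mul]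
            exact hX
          · rw [Set.indicator_of_notMem hX, zero_mul]
            exact bot_le
      _ = _ := by simp
  have hmarkov := mul_meas_ge_le_lintegral (μ := μ.prod ν) hFm (ENNReal.ofReal (Real.exp (-(l * r))))
  have hsub : {ω : (Fin n → Feat d) × (Fin n → ℝ) | ω.1 ∈ A ∧ ‖est ω.1 ω.2‖ ^ 2 < r} ⊆
      {ω | ENNReal.ofReal (Real.exp (-(l * r))) ≤ F ω} := by
    rintro ω ⟨hωA, hω⟩
    have hωG : ω.1 ∈ G := hA ω.1 hωA
    simp only [Set.mem_ofPred_eq, hF, hΨ]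
    rw [Set.indicator_of_mem hωG, one_mul]
    apply ENNReal.ofReal_le_ofReal
    apply Real.exp_le_exp.2
    have := mul_le_mul_of_nonneg_left hω.le hl
    linarith
  calc sampleLaw n d σ {ω | ω.1 ∈ A ∧ ‖est ω.1 ω.2‖ ^ 2 < r}
      ≤ (μ.prod ν) {ω | ENNReal.ofReal (Real.exp (-(l * r))) ≤ F ω} := measure_mono hsub
    _ = ENNReal.ofReal (Real.exp (l * r)) * (ENNReal.ofReal (Real.exp (-(l * r))) *
        (μ.prod ν) {ω | ENNReal.ofReal (Real.exp (-(l * r))) ≤ F ω}) := by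
        rw [← mul_assoc, ← ENNReal.ofReal_mul (Real.exp_pos _).le, ← Real.exp_add]
        simp
    _ ≤ _ := by
        gcongr
        exact hmarkov.trans hint

/-- Small-ball constant: `exp (4 (B + 2)) = 1 + 2 q / 64`. -/
noncomputable def ballConst (B : ℝ) : ℝ := 32 * (Real.exp (4 * (B + 2)) - 1)

theorem ballConst_pos {B : ℝ} (hB : 0 < B) : 0 < ballConst B := by
  have := Real.add_one_lt_exp (x := 4 * (B + 2)) (by linarith)
  unfold ballConst
  linarith

theorem linear_lower_bound_low_dim {n d s : ℕ} {σ M B δ c : ℝ} (hsd : s ≤ d) (hσ : 0 < σ)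
    (hσM : σ ^ 2 ≤ M) (hB : 0 < B) (hn : 1 ≤ n) (hs : 1 ≤ s) (hδ : 0 < δ) (hδ1 : δ < 1)
    (hc : 0 < c) (hcM : c * (8 * M) ≤ 1) (hcB : c * ballConst B ≤ 1)
    {est : (Fin n → Feat d) → (Fin n → ℝ) → Feat d} (h : IsLinearEstimator est)
    (hnd : 2 * (d + Real.log (1 / δ)) ≤ n) (hlog : Real.log (1 / δ) ≤ B * d) :
    sampleLaw n d σ {ω | meanExcessRisk s hsd σ est ω.1 ω.2 < c * (σ ^ 2 * d / n)} ≤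
      ENNReal.ofReal δ := by
  have hn0 : (0 : ℝ) < n := by exact_mod_cast hn
  have hd1 : (1 : ℝ) ≤ d := by exact_mod_cast hs.trans hsd
  have hlog0 : 0 ≤ Real.log (1 / δ) := Real.log_nonneg (by rw [le_div_iff₀ hδ]; linarith)
  have hδe : δ = Real.exp (-Real.log (1 / δ)) := by
    rw [Real.exp_neg, Real.exp_log (by positivity)]; simp
  have hdn : (d : ℝ) ≤ n := by linarith
  set q := ballConst B with hq
  have hq0 : 0 < q := ballConst_pos hB
  set r := c * (σ ^ 2 * d / n) with hr
  set l := q * n / σ ^ 2 with hl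
  have hl0 : 0 ≤ l := by positivity
  choose T hT using h.linear
  choose f hf using fun X => exists_singular_basis (T X)
  -- Against a Frobenius norm squared of at most `8 n d`, this loses `θ · 8 n d = d/8`, half of the
  -- `d/4` gained when fewer than `d/2` squared singular values reach `θ`.
  set θ : ℝ := 1 / (64 * n) with hθ
  have hθ0 : 0 ≤ θ := by positivity
  set A : Set (Fin n → Feat d) := {X | (d : ℝ) ≤
    2 * (Finset.univ.filter fun i => θ ≤ ‖T X (f X i)‖ ^ 2).card} with hAdef
  have hA : ∀ X ∈ A, ∫⁻ ε, ENNReal.ofReal (Real.exp (-(l * ‖est X ε‖ ^ 2)))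
      ∂(Measure.pi fun _ : Fin n => noiseLaw σ) ≤ ENNReal.ofReal (Real.exp (-((B + 2) * d))) := by
    intro X hX
    rw [hAdef, Set.mem_ofPred_eq] at hX
    simp only [hT]
    refine (lintegral_exp_neg_norm_sq_le (hf X) hθ0 hl0 σ).trans (ENNReal.ofReal_le_ofReal ?_)
    -- `ballConst` is chosen so that each large direction gains `exp (-2 (B + 2))`; at least `d/2`
    -- of them give `exp (-(B + 2) d)`.
    have h1 : 1 + 2 * (l * σ ^ 2 * θ) = Real.exp (2 * (B + 2)) ^ 2 := by
      rw [hl, hθ, hq, ballConst, ← Real.exp_nat_mul]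
      field_simp
      push_cast
      ring_nf
    rw [h1, Real.sqrt_sq (Real.exp_pos _).le, ← Real.exp_neg, ← Real.exp_nat_mul]
    apply Real.exp_le_exp.2
    have := mul_le_mul_of_nonneg_right hX (by linarith : 0 ≤ B + 2)
    linarith
  have hsub : {ω : (Fin n → Feat d) × (Fin n → ℝ) | meanExcessRisk s hsd σ est ω.1 ω.2 < r} ⊆
      {X : Fin n → Feat d | ¬ ∑ j, ‖designCLM X (EuclideanSpace.single j 1)‖ ^ 2 ≤ 8 * n * d} ×ˢ
        Set.univ ∪ {ω | ω.1 ∈ A ∧ ‖est ω.1 ω.2‖ ^ 2 < r} := by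
    rintro ⟨X, ε⟩ hω
    simp only [Set.mem_ofPred_eq] at hω
    rw [meanExcessRisk_linear hsd hs σ (hT X)] at hω
    set b := ∑ j, ‖T X (designCLM X (EuclideanSpace.single j 1)) -
      EuclideanSpace.single j 1‖ ^ 2 with hb
    have hb0 : 0 ≤ 1 / (d : ℝ) * b := by positivity
    by_cases hX : ∑ j, ‖designCLM X (EuclideanSpace.single j 1)‖ ^ 2 ≤ 8 * n * d
    · refine Or.inr ⟨?_, ?_⟩
      · rw [hAdef, Set.mem_ofPred_eq]
        by_contra! hcon
        have h1 := sum_norm_sq_sub_ge_of_singular (hf X) hθ0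
          fun j => designCLM X (EuclideanSpace.single j 1)
        rw [← hb] at h1
        have h2 : θ * ∑ j, ‖designCLM X (EuclideanSpace.single j 1)‖ ^ 2 ≤ d / 8 := by
          calc _ ≤ θ * (8 * n * d) := by gcongr
            _ = _ := by rw [hθ]; field_simp; norm_num
        have h3 : (d : ℝ) / 8 ≤ b := by linarith
        have h4 : 1 / 8 ≤ 1 / (d : ℝ) * b := by
          rw [one_div_mul_eq_div, le_div_iff₀ (by linarith)]
          linarith
        have h5 : r ≤ 1 / 8 := by
          have h6 : σ ^ 2 * d / n ≤ M := by
            rw [div_le_iff₀ hn0]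
            exact mul_le_mul hσM hdn (by linarith) ((sq_nonneg σ).trans hσM)
          have h7 := mul_le_mul_of_nonneg_left h6 hc.le
          linarith
        have h8 := sq_nonneg ‖T X (WithLp.toLp 2 ε)‖
        linarith
      · rw [hT]
        linarith
    · exact Or.inl ⟨hX, trivial⟩
  refine (measure_mono hsub).trans ((measure_union_le _ _).trans ?_)
  have h1 : sampleLaw n d σ ({X : Fin n → Feat d |
      ¬ ∑ j, ‖designCLM X (EuclideanSpace.single j 1)‖ ^ 2 ≤ 8 * n * d} ×ˢ Set.univ) ≤
      ENNReal.ofReal (δ / 2) := by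
    rw [sampleLaw, Measure.prod_prod, measure_univ, mul_one]
    refine measure_frobenius_gt.trans (ENNReal.ofReal_le_ofReal ?_)
    have h2 : (d : ℝ) ≤ Real.exp (d - 1) := by
      have := Real.add_one_le_exp ((d : ℝ) - 1)
      linarith
    have h3 : (2 : ℝ) ≤ Real.exp 1 := by
      have := Real.add_one_le_exp (1 : ℝ)
      linarith
    have h4 : d * Real.exp (-n) * 2 ≤ δ := by
      calc d * Real.exp (-n) * 2 ≤ Real.exp (d - 1) * Real.exp (-n) * Real.exp 1 := by gcongr
        _ = Real.exp (d - n) := by rw [← Real.exp_add, ← Real.exp_add]; congr 1; ring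
        _ ≤ Real.exp (-Real.log (1 / δ)) := Real.exp_le_exp.2 (by linarith)
        _ = δ := hδe.symm
    linarith
  have h2 : sampleLaw n d σ {ω | ω.1 ∈ A ∧ ‖est ω.1 ω.2‖ ^ 2 < r} ≤ ENNReal.ofReal (δ / 2) := by
    refine (measure_norm_sq_lt_le h hl0 hA).trans ?_
    rw [← ENNReal.ofReal_mul (Real.exp_pos _).le, ← Real.exp_add]
    apply ENNReal.ofReal_le_ofReal
    have h3 : l * r = c * q * d := by rw [hl, hr]; field_simp
    have h4 : l * r ≤ d := by
      rw [h3]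
      exact mul_le_of_le_one_left (by linarith) hcB
    have h5 : (2 : ℝ) ≤ Real.exp 1 := by
      have := Real.add_one_le_exp (1 : ℝ)
      linarith
    -- Of the exponent `(B + 2) d`, one `d` pays for `l r`, another for the factor `2 ≤ exp 1`, and
    -- `B d` for `log (1/δ)`.
    have h6 : Real.exp (l * r + -((B + 2) * d)) * 2 ≤ δ := by
      calc _ ≤ Real.exp (l * r + -((B + 2) * d)) * Real.exp 1 := by gcongr
        _ = Real.exp (l * r + -((B + 2) * d) + 1) := (Real.exp_add _ _).symm
        _ ≤ Real.exp (-Real.log (1 / δ)) := Real.exp_le_exp.2 (by linarith)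
        _ = δ := hδe.symm
    linarith
  calc _ ≤ ENNReal.ofReal (δ / 2) + ENNReal.ofReal (δ / 2) := add_le_add h1 h2
    _ = _ := by rw [← ENNReal.ofReal_add (by positivity) (by positivity)]; congr 1; ring

/-- Only the rank enters, so the bound holds for every sample, not just with high probability. -/
theorem linear_lower_bound_high_dim {n d s : ℕ} (hsd : s ≤ d) (hs : 1 ≤ s) (σ : ℝ)
    {est : (Fin n → Feat d) → (Fin n → ℝ) → Feat d} {X : Fin n → Feat d}
    {T : EuclideanSpace ℝ (Fin n) →ₗ[ℝ] Feat d} (hT : ∀ y, est X y = T (WithLp.toLp 2 y))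
    (ε : Fin n → ℝ) : 1 - (n : ℝ) / d ≤ meanExcessRisk s hsd σ est X ε := by
  have hd0 : (0 : ℝ) < d := by exact_mod_cast hs.trans hsd
  rw [meanExcessRisk_linear hsd hs σ hT]
  have h1 := sum_norm_sq_sub_ge_of_rank T fun j => designCLM X (EuclideanSpace.single j 1)
  have h2 := mul_le_mul_of_nonneg_left h1 (by positivity : 0 ≤ 1 / (d : ℝ))
  have h3 : 1 / (d : ℝ) * (d - n) = 1 - n / d := by field_simp
  have h4 := sq_nonneg ‖T (WithLp.toLp 2 ε)‖
  linarith


/-! ### The baselines -/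

theorem isLinearEstimator_gd {n d : ℕ} (η : ℝ) (t : ℕ) :
    IsLinearEstimator (gdEstimator (n := n) (d := d) η t) := by
  induction t with
  | zero =>
    exact ⟨fun X => ⟨0, fun y => by simp [gdEstimator_zero]⟩,
      fun y => by simp only [gdEstimator_zero]; fun_prop⟩
  | succ t ih =>
    refine ⟨fun X => ?_, fun y => ?_⟩
    · obtain ⟨T, hT⟩ := ih.linear X
      let R : EuclideanSpace ℝ (Fin n) →ₗ[ℝ] Feat d :=
        { toFun := fun v => ∑ i, (inner ℝ (T v) (X i) - v i) • X i
          map_add' := fun u v => by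
            rw [← Finset.sum_add_distrib]
            refine Finset.sum_congr rfl fun i _ => ?_
            rw [← add_smul, map_add, inner_add_left, PiLp.add_apply]
            congr 1
            ring
          map_smul' := fun c v => by
            rw [RingHom.id_apply, Finset.smul_sum]
            refine Finset.sum_congr rfl fun i _ => ?_
            rw [smul_smul, map_smul, inner_smul_left, PiLp.smul_apply, smul_eq_mul, conj_trivial,
              mul_sub] }
      refine ⟨T - η • (1 / (n : ℝ)) • R, fun y => ?_⟩
      rw [gdEstimator_succ, hT]
      rfl
    · simp only [gdEstimator_succ]
      have h := ih.measurable y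
      have h1 : ∀ i, Measurable fun X : Fin n → Feat d =>
          (inner ℝ (gdEstimator η t X y) (X i) - y i) • X i := fun i =>
        ((h.inner (measurable_pi_apply i)).sub_const (y i)).fun_smul (measurable_pi_apply i)
      exact h.sub (((Finset.measurable_sum _ fun i _ => h1 i).const_smul (1 / (n : ℝ))).const_smul η)

theorem isLinearEstimator_ridge {n d : ℕ} (lam : ℝ) :
    IsLinearEstimator (ridgeEstimator (n := n) (d := d) lam) := by
  refine ⟨fun X => ?_, fun y => ?_⟩
  · let M := (1 / (n : ℝ)) • ((empCov X + lam • (1 : Matrix (Fin d) (Fin d) ℝ))⁻¹ *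
      (design X).transpose)
    refine ⟨(WithLp.linearEquiv 2 ℝ (Fin d → ℝ)).symm.toLinearMap ∘ₗ M.mulVecLin ∘ₗ
      (WithLp.linearEquiv 2 ℝ (Fin n → ℝ)).toLinearMap, fun y => ?_⟩
    simp only [ridgeEstimator, Matrix.mulVec_mulVec, ← Matrix.smul_mulVec]
    rfl
  · have hD : Continuous fun X : Fin n → Feat d => design X := by
      refine continuous_matrix fun i j => ?_
      simp only [design, Matrix.of_apply]
      fun_prop
    have hM : Continuous fun X : Fin n → Feat d =>
        empCov X + lam • (1 : Matrix (Fin d) (Fin d) ℝ) := by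
      unfold empCov
      exact ((hD.matrix_transpose.matrix_mul hD).const_smul (1 / (n : ℝ))).fun_add
        continuous_const
    -- Adjugate over determinant is measurable everywhere, including at singular matrices, where the
    -- inverse is `0` by convention.
    have hinv : ∀ i j, Measurable fun X : Fin n → Feat d =>
        (empCov X + lam • (1 : Matrix (Fin d) (Fin d) ℝ))⁻¹ i j := by
      intro i j
      simp only [Matrix.inv_def, Ring.inverse_eq_inv', Matrix.smul_apply, smul_eq_mul]
      exact hM.matrix_det.measurable.inv.mul (hM.matrix_adjugate.matrix_elem i j).measurable
    have hv : ∀ j, Measurable fun X : Fin n → Feat d => (design X).transpose.mulVec y j := fun j =>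
      ((continuous_apply j).comp (hD.matrix_transpose.matrix_mulVec continuous_const)).measurable
    have hcoord : Measurable fun X : Fin n → Feat d => (1 / (n : ℝ)) •
        ((empCov X + lam • (1 : Matrix (Fin d) (Fin d) ℝ))⁻¹.mulVec
          ((design X).transpose.mulVec y)) := by
      refine measurable_pi_iff.2 fun i => ?_
      simp only [Pi.smul_apply, Matrix.mulVec_eq_sum, smul_eq_mul]
      simp only [Finset.sum_apply, Pi.smul_apply, Matrix.transpose_apply, MulOpposite.smul_eq_mul_unop,
        MulOpposite.unop_op]
      refine (Finset.measurable_sum _ fun j _ => ?_).const_mul _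
      exact (hinv i j).mul (hv j)
    exact (PiLp.continuous_toLp 2 (fun _ : Fin d => ℝ)).measurable.comp hcoord

/-! ### Normal equations, and OLS as a limit of ridge. -/

theorem covMap_eq_empCov {n d : ℕ} (X : Fin n → Feat d) (w : Feat d) :
    covMap X w = WithLp.toLp 2 ((empCov X).mulVec w) := by
  ext j
  rw [covMap_apply_apply]
  simp only [empCov, Matrix.smul_mulVec, ← Matrix.mulVec_mulVec, Pi.smul_apply, smul_eq_mul]
  congr 1
  simp only [Matrix.mulVec, dotProduct, Matrix.transpose_apply, design, Matrix.of_apply]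
  refine Finset.sum_congr rfl fun i _ => ?_
  rw [PiLp.inner_apply, mul_comm]
  rfl

theorem inner_covMap {n d : ℕ} (X : Fin n → Feat d) (u v : Feat d) :
    inner ℝ (covMap X u) v = 1 / n * ∑ i, inner ℝ u (X i) * inner ℝ v (X i) := by
  rw [covMap_apply, inner_smul_left, sum_inner, conj_trivial]
  congr 1
  refine Finset.sum_congr rfl fun i _ => ?_
  rw [inner_smul_left, conj_trivial, real_inner_comm v]

theorem covMap_isSymmetric {n d : ℕ} (X : Fin n → Feat d) : (covMap X).IsSymmetric := by
  intro u v
  rw [inner_covMap, real_inner_comm, inner_covMap]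
  simp only [mul_comm]

theorem inner_covMap_self_nonneg {n d : ℕ} (X : Fin n → Feat d) (u : Feat d) :
    0 ≤ inner ℝ (covMap X u) u := by
  rw [inner_covMap]
  have : 0 ≤ ∑ i, inner ℝ u (X i) * inner ℝ u (X i) :=
    Finset.sum_nonneg fun i _ => mul_self_nonneg _
  positivity

/-- Pairing with `u` and dropping the nonnegative covariance term. It yields both the invertibility
of the ridge matrix and the convergence to OLS. -/
theorem norm_le_of_regularized {n d : ℕ} (X : Fin n → Feat d) {lam : ℝ}
    {u b : Feat d} (h : covMap X u + lam • u = b) : lam * ‖u‖ ≤ ‖b‖ := by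
  have h1 : lam * ‖u‖ ^ 2 ≤ ‖b‖ * ‖u‖ := by
    have h2 := real_inner_le_norm b u
    rw [← h, inner_add_left, inner_smul_left, conj_trivial, real_inner_self_eq_norm_sq, h] at h2
    linarith [inner_covMap_self_nonneg X u]
  rcases (norm_nonneg u).eq_or_lt with h0 | h0
  · rw [← h0, mul_zero]; exact norm_nonneg b
  · refine le_of_mul_le_mul_right ?_ h0
    linarith

theorem ridgeEstimator_spec {n d : ℕ} (X : Fin n → Feat d) (y : Fin n → ℝ) {lam : ℝ}
    (hl : 0 < lam) :
    covMap X (ridgeEstimator lam X y) + lam • ridgeEstimator lam X y =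
      (1 / (n : ℝ)) • ∑ i, y i • X i := by
  set M := empCov X + lam • (1 : Matrix (Fin d) (Fin d) ℝ) with hM
  have hMv : ∀ w : Feat d, covMap X w + lam • w = WithLp.toLp 2 (M.mulVec w) := by
    intro w
    rw [covMap_eq_empCov, hM, Matrix.add_mulVec, Matrix.smul_mulVec, Matrix.one_mulVec]
    rfl
  have hunit : IsUnit M := by
    rw [← Matrix.mulVec_injective_iff_isUnit]
    intro u v huv
    have h1 : covMap X (WithLp.toLp 2 (u - v)) + lam • WithLp.toLp 2 (u - v) = 0 := by
      rw [hMv]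
      simp only [Matrix.mulVec_sub]
      rw [huv, sub_self]
      rfl
    have h2 := norm_le_of_regularized X h1
    rw [norm_zero] at h2
    have h3 : ‖(WithLp.toLp 2 (u - v) : Feat d)‖ ≤ 0 := by
      by_contra! hcon
      have := mul_pos hl hcon
      linarith
    have h4 := norm_le_zero_iff.1 h3
    have h5 : u - v = 0 := congrArg WithLp.ofLp h4
    exact sub_eq_zero.1 h5
  rw [hMv, ridgeEstimator]
  ext j
  simp only [Matrix.mulVec_smul, Matrix.mulVec_mulVec]
  rw [← Matrix.mul_assoc, Matrix.mul_nonsing_inv _ ((Matrix.isUnit_iff_isUnit_det _).1 hunit),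
    Matrix.one_mul]
  simp [Matrix.mulVec, dotProduct, design, mul_comm]

theorem IsOLS.normal_eq {n d : ℕ} {X : Fin n → Feat d} {y : Fin n → ℝ} {w : Feat d}
    (h : IsOLS X y w) : covMap X w = (1 / (n : ℝ)) • ∑ i, y i • X i := by
  have hmin : IsLocalMin (empLoss X y) w := Filter.Eventually.of_forall h.1
  have h1 : gradient (empLoss X y) w = 0 := by
    rw [gradient, hmin.fderiv_eq_zero, map_zero]
  rw [gradient_empLoss] at h1
  rw [covMap_apply, ← sub_eq_zero, ← smul_sub, ← Finset.sum_sub_distrib, ← h1]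
  simp only [sub_smul]

/-- Removing the component in the kernel of `Σ̂` preserves the fit, so minimality of the norm makes
`w` orthogonal to the kernel; by symmetry of `Σ̂` it lies in the range. -/
theorem IsOLS.mem_range {n d : ℕ} (hn : 1 ≤ n) {X : Fin n → Feat d} {y : Fin n → ℝ} {w : Feat d}
    (h : IsOLS X y w) : ∃ b, covMap X b = w := by
  have hn0 : (0 : ℝ) < n := by exact_mod_cast hn
  set N := LinearMap.ker (covMap X) with hN
  set k := N.starProjection w with hk
  have hkN : k ∈ N := Submodule.starProjection_apply_mem _ _
  have hkX : ∀ i, inner ℝ k (X i) = 0 := by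
    have h1 : inner ℝ (covMap X k) k = 0 := by rw [LinearMap.mem_ker.1 hkN, inner_zero_left]
    rw [inner_covMap] at h1
    have h2 : ∑ i, inner ℝ k (X i) * inner ℝ k (X i) = 0 := by
      rcases mul_eq_zero.1 h1 with h3 | h3
      · exact absurd h3 (by positivity)
      · exact h3
    intro i
    have h3 := (Finset.sum_eq_zero_iff_of_nonneg fun i _ => mul_self_nonneg _).1 h2 i
      (Finset.mem_univ i)
    exact mul_self_eq_zero.1 h3
  have hls : IsLeastSquares X y (w - k) := by
    intro w'
    have : empLoss X y (w - k) = empLoss X y w := by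
      simp only [empLoss, inner_sub_left, hkX, sub_zero]
    rw [this]
    exact h.1 w'
  have hle := h.2 _ hls
  have hpyth : ‖w‖ ^ 2 = ‖k‖ ^ 2 + ‖w - k‖ ^ 2 := by
    have horth : inner ℝ k (w - k) = 0 :=
      (Submodule.mem_orthogonal _ _).1 (Submodule.sub_starProjection_mem_orthogonal w) k hkN
    have h1 := norm_add_sq_real k (w - k)
    rw [add_sub_cancel, horth] at h1
    linarith
  have hk0 : k = 0 := by
    have h1 := pow_le_pow_left₀ (norm_nonneg _) hle 2
    have h2 : ‖k‖ ^ 2 ≤ 0 := by linarith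
    exact norm_eq_zero.1 (pow_eq_zero_iff two_ne_zero |>.1 (le_antisymm h2 (sq_nonneg _)))
  have hw : w ∈ Nᗮ := by
    rw [← Submodule.starProjection_apply_eq_zero_iff]
    exact hk0
  rw [hN, ← (covMap_isSymmetric X).orthogonal_range, Submodule.orthogonal_orthogonal] at hw
  exact hw

theorem tendsto_ridge_of_isOLS {n d : ℕ} (hn : 1 ≤ n) {X : Fin n → Feat d} {y : Fin n → ℝ}
    {w : Feat d} (h : IsOLS X y w) :
    Filter.Tendsto (fun k : ℕ => ridgeEstimator (1 / ((k : ℝ) + 1)) X y) Filter.atTop (nhds w) := by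
  obtain ⟨b, hb⟩ := h.mem_range hn
  rw [tendsto_iff_norm_sub_tendsto_zero]
  have hlim : Filter.Tendsto (fun k : ℕ => 2 * ‖b‖ * (1 / ((k : ℝ) + 1))) Filter.atTop (nhds 0) := by
    simpa using (tendsto_one_div_add_atTop_nhds_zero_nat (𝕜 := ℝ)).const_mul (2 * ‖b‖)
  refine squeeze_zero (fun k => norm_nonneg _) (fun k => ?_) hlim
  set l : ℝ := 1 / ((k : ℝ) + 1) with hl
  have hl0 : 0 < l := by positivity
  set v := ridgeEstimator l X y - w with hv
  have h1 : covMap X v + l • v = -(l • w) := by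
    rw [hv, map_sub, smul_sub, sub_add_sub_comm, ridgeEstimator_spec X y hl0, ← h.normal_eq]
    abel
  -- The shift by `l b`, where `w = Σ̂ b`, cancels the first-order term `-l w` and leaves a right
  -- side of order `l²`; dividing by `l` gives `‖v‖ ≤ 2 l ‖b‖`.
  have h2 : covMap X (v + l • b) + l • (v + l • b) = (l * l) • b := by
    rw [map_add, map_smul, hb, smul_add, smul_smul, add_add_add_comm, h1]
    abel
  have h3 := norm_le_of_regularized X h2
  rw [norm_smul, Real.norm_eq_abs, abs_of_nonneg (by positivity), mul_assoc] at h3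
  have h4 : ‖v + l • b‖ ≤ l * ‖b‖ := le_of_mul_le_mul_left h3 hl0
  calc ‖v‖ = ‖(v + l • b) - l • b‖ := by rw [add_sub_cancel_right]
    _ ≤ ‖v + l • b‖ + ‖l • b‖ := norm_sub_le _ _
    _ ≤ l * ‖b‖ + l * ‖b‖ := by
        gcongr
        rw [norm_smul, Real.norm_eq_abs, abs_of_pos hl0]
    _ = _ := by ring

theorem tendsto_meanExcessRisk {n d s : ℕ} (hsd : s ≤ d) (σ : ℝ)
    {est : (Fin n → Feat d) → (Fin n → ℝ) → Feat d}
    {ests : ℕ → (Fin n → Feat d) → (Fin n → ℝ) → Feat d} {X : Fin n → Feat d}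
    (h : ∀ y, Filter.Tendsto (fun k => ests k X y) Filter.atTop (nhds (est X y))) (ε : Fin n → ℝ) :
    Filter.Tendsto (fun k => meanExcessRisk s hsd σ (ests k) X ε) Filter.atTop
      (nhds (meanExcessRisk s hsd σ est X ε)) := by
  simp only [meanExcessRisk_eq_integral, integral_prior]
  exact (tendsto_finsetSum _ fun S _ => tendsto_finsetSum _ fun τ _ =>
    (((h _).sub_const _).norm.pow 2)).const_mul _

/-- A strict inequality in the limit holds along the sequence from some index on, so the event lies
in an increasing union; no measurability of `f` or `g` is needed. -/
theorem measure_lt_le_of_tendsto {Ω : Type*} [MeasurableSpace Ω] (μ : Measure Ω) {f : Ω → ℝ}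
    {g : ℕ → Ω → ℝ} (h : ∀ ω, Filter.Tendsto (fun k => g k ω) Filter.atTop (nhds (f ω))) {r : ℝ}
    {p : ENNReal} (hg : ∀ k, μ {ω | g k ω < r} ≤ p) : μ {ω | f ω < r} ≤ p := by
  set A : ℕ → Set Ω := fun N => {ω | ∀ k, N ≤ k → g k ω < r} with hA
  have hmono : Monotone A := fun N N' hN ω hω k hk => hω k (hN.trans hk)
  have hsub : {ω | f ω < r} ⊆ ⋃ N, A N := by
    intro ω hω
    obtain ⟨N, hN⟩ := Filter.eventually_atTop.1 ((h ω).eventually_lt_const hω)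
    exact Set.mem_iUnion.2 ⟨N, hN⟩
  refine (measure_mono hsub).trans ?_
  rw [hmono.measure_iUnion]
  exact iSup_le fun N => (measure_mono fun ω (hω : ω ∈ A N) => hω N le_rfl).trans (hg N)

theorem baseline_lower_bounds {n d s : ℕ} {σ M B δ c : ℝ} (hsd : s ≤ d) (hσ : 0 < σ)
    (hσM : σ ^ 2 ≤ M) (hB : 0 < B) (hn : 1 ≤ n) (hs : 1 ≤ s) (hδ : 0 < δ) (hδ1 : δ < 1)
    (hc : 0 < c) (hcM : c * (8 * M) ≤ 1) (hcM2 : c * (2 * (1 + M)) ≤ 1)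
    (hcB : c * ballConst B ≤ 1)
    {est : (Fin n → Feat d) → (Fin n → ℝ) → Feat d} (h : IsBaseline est) :
    (2 * (d + Real.log (1 / δ)) ≤ n → Real.log (1 / δ) ≤ B * d →
      sampleLaw n d σ {ω | ¬ c * (σ ^ 2 * d / n) ≤ meanExcessRisk s hsd σ est ω.1 ω.2} ≤
        ENNReal.ofReal δ) ∧
    (2 * (n + Real.log (1 / δ)) ≤ d →
      sampleLaw n d σ {ω | ¬ c * (1 - (n : ℝ) / d + σ ^ 2 * n / d) ≤
        meanExcessRisk s hsd σ est ω.1 ω.2} ≤ ENNReal.ofReal δ) := by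
  have hd0 : (0 : ℝ) < d := by exact_mod_cast hs.trans hsd
  have hlim : IsLinearEstimator est ∨ ∃ ests : ℕ → (Fin n → Feat d) → (Fin n → ℝ) → Feat d,
      (∀ k, IsLinearEstimator (ests k)) ∧
      ∀ X y, Filter.Tendsto (fun k => ests k X y) Filter.atTop (nhds (est X y)) := by
    rcases h with ⟨lam, -, rfl⟩ | hols | ⟨η, t, -, rfl⟩
    · exact Or.inl (isLinearEstimator_ridge lam)
    · exact Or.inr ⟨fun k => ridgeEstimator (1 / ((k : ℝ) + 1)),
        fun k => isLinearEstimator_ridge _, fun X y => tendsto_ridge_of_isOLS hn (hols X y)⟩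
    · exact Or.inl (isLinearEstimator_gd η t)
  constructor
  · intro hnd hlog
    simp only [not_le]
    rcases hlim with hl | ⟨ests, hl, hlim⟩
    · exact linear_lower_bound_low_dim hsd hσ hσM hB hn hs hδ hδ1 hc hcM hcB hl hnd hlog
    · exact measure_lt_le_of_tendsto (sampleLaw n d σ)
        (f := fun ω => meanExcessRisk s hsd σ est ω.1 ω.2)
        (g := fun k ω => meanExcessRisk s hsd σ (ests k) ω.1 ω.2)
        (r := c * (σ ^ 2 * d / n))
        (fun ω => tendsto_meanExcessRisk hsd σ (hlim ω.1) ω.2)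
        fun k => linear_lower_bound_low_dim hsd hσ hσM hB hn hs hδ hδ1 hc hcM hcB (hl k) hnd hlog
  · intro hdn
    have hlog0 : 0 ≤ Real.log (1 / δ) := Real.log_nonneg (by rw [le_div_iff₀ hδ]; linarith)
    have hhalf : (n : ℝ) / d ≤ 1 / 2 := by
      rw [div_le_iff₀ hd0]
      linarith
    have hnd0 : 0 ≤ (n : ℝ) / d := by positivity
    -- For `d ≥ 2n` the quantity `1 - n/d` is at least `1/2`, while the bracket is at most `1 + M`;
    -- the noise term is absorbed into the constant.
    have hle : c * (1 - (n : ℝ) / d + σ ^ 2 * n / d) ≤ 1 - (n : ℝ) / d := by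
      have h1 : σ ^ 2 * n / d ≤ M := by
        rw [mul_div_assoc]
        calc σ ^ 2 * (n / d) ≤ M * 1 := by
              apply mul_le_mul hσM (by linarith) hnd0 ((sq_nonneg σ).trans hσM)
          _ = M := mul_one M
      have h2 := mul_le_mul_of_nonneg_left (by linarith :
        1 - (n : ℝ) / d + σ ^ 2 * n / d ≤ 1 + M) hc.le
      linarith
    have hall : ∀ X ε, 1 - (n : ℝ) / d ≤ meanExcessRisk s hsd σ est X ε := by
      intro X ε
      rcases hlim with hl | ⟨ests, hl, hlim⟩
      · obtain ⟨T, hT⟩ := hl.linear X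
        exact linear_lower_bound_high_dim hsd hs σ hT ε
      · refine ge_of_tendsto' (tendsto_meanExcessRisk hsd σ (hlim X) ε) fun k => ?_
        obtain ⟨T, hT⟩ := (hl k).linear X
        exact linear_lower_bound_high_dim hsd hs σ hT ε
    have hempty : {ω : (Fin n → Feat d) × (Fin n → ℝ) |
        ¬ c * (1 - (n : ℝ) / d + σ ^ 2 * n / d) ≤ meanExcessRisk s hsd σ est ω.1 ω.2} = ∅ := by
      ext ω
      simpa using hle.trans (hall ω.1 ω.2)
    rw [hempty, measure_empty]
    exact bot_le

end SparseRegression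

/-! ### Choice of the constants. -/

theorem theorem3 :
    -- upper bound for preprocess-then-optimize
    (∃ c : ℝ, 0 < c ∧ ∃ K : ℝ, 0 < K ∧ ∀ σ : ℝ, 0 < σ → ∃ C : ℝ, 0 < C ∧
      ∀ (n d s t : ℕ) (δ : ℝ) (hsd : s ≤ d), 1 ≤ n → 1 ≤ s → 1 ≤ t →
        0 < δ → δ < 1 → 2 * δ ≤ d →
        K * Real.log (n * s / σ ^ 2) ≤ t →
        C * ((t : ℝ) ^ 2 * (s : ℝ) ^ 3 * (d : ℝ) ^ (2 / 3 : ℝ)) ≤ n →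
        ∃ η : ℝ, 0 < η ∧
          ((SparseRegression.prior d s hsd).toMeasure.prod (SparseRegression.sampleLaw n d σ))
            {ω | ¬ SparseRegression.preGDExcessRisk σ η t ω.1 ω.2.1 ω.2.2 ≤
              c * (σ ^ 2 * Real.log (n * s / σ ^ 2) ^ 2 * Real.log (d / δ) ^ 2 *
                ((s : ℝ) / n + (d : ℝ) * (s : ℝ) ^ 2 / (n : ℝ) ^ 2))}
            ≤ ENNReal.ofReal δ) ∧
    -- lower bounds for ridge regression, OLS and gradient descent on the raw features
    (∀ M B : ℝ, 0 < M → 0 < B → ∃ C : ℝ, 0 < C ∧ ∃ c : ℝ, 0 < c ∧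
      ∀ (σ : ℝ) (n d s : ℕ) (δ : ℝ) (hsd : s ≤ d), 0 < σ → σ ^ 2 ≤ M → 1 ≤ n → 1 ≤ s →
        0 < δ → δ < 1 →
        ∀ est : (Fin n → SparseRegression.Feat d) → (Fin n → ℝ) → SparseRegression.Feat d,
          SparseRegression.IsBaseline est →
          (C * (d + Real.log (1 / δ)) ≤ n → Real.log (1 / δ) ≤ B * d →
            SparseRegression.sampleLaw n d σ
              {ω | ¬ c * (σ ^ 2 * d / n) ≤
                SparseRegression.meanExcessRisk s hsd σ est ω.1 ω.2}
              ≤ ENNReal.ofReal δ) ∧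
          (C * (n + Real.log (1 / δ)) ≤ d →
            SparseRegression.sampleLaw n d σ
              {ω | ¬ c * (1 - (n : ℝ) / d + σ ^ 2 * n / d) ≤
                SparseRegression.meanExcessRisk s hsd σ est ω.1 ω.2}
              ≤ ENNReal.ofReal δ)) := by
  refine ⟨⟨10 ^ 17, by norm_num, 16, by norm_num, fun σ hσ =>
    ⟨SparseRegression.sampleConst σ, zero_lt_one.trans_le SparseRegression.one_le_sampleConst, ?_⟩⟩,
    fun M B hM hB => ⟨2, two_pos, ?_⟩⟩
  · intro n d s t δ hsd hn hs ht hδ hδ1 hdδ hlog h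
    exact SparseRegression.preGD_upper_bound hσ hsd hn hs ht hδ hδ1 hdδ hlog h
  · have hq := SparseRegression.ballConst_pos hB
    -- The reciprocal of the sum satisfies all three smallness conditions on `c` at once.
    set c : ℝ := 1 / (8 * M + 2 * (1 + M) + SparseRegression.ballConst B) with hc
    have hc0 : 0 < c := by positivity
    have hsum : c * (8 * M) + c * (2 * (1 + M)) + c * SparseRegression.ballConst B = 1 := by
      rw [hc]
      field_simp
    have h1 : 0 ≤ c * (8 * M) := by positivity
    have h2 : 0 ≤ c * (2 * (1 + M)) := by positivity
    have h3 : 0 ≤ c * SparseRegression.ballConst B := by positivity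
    refine ⟨c, hc0, fun σ n d s δ hsd hσ hσM hn hs hδ hδ1 est hest => ?_⟩
    exact SparseRegression.baseline_lower_bounds hsd hσ hσM hB hn hs hδ hδ1 hc0 (by linarith)
      (by linarith) (by linarith) hest
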